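/- **Setting.** Let $F$ be a non-archimedean local field of characteristic zero with ring of integers $\mathfrak o$, maximal ideal $\mathfrak p$, uniformizer $\varpi$ and $q=\#(\mathfrak o/\mathfrak p)$. Let $a,b\in\mathfrak o$, $c\in\mathfrak o^\times$ with $d=b^2-4ac\neq 0$. Put $L=F(\sqrt d)$ if $d\notin F^{\times 2}$, and $L=F\oplus F$ if $d\in F^{\times2}$ (then a square root $\sqrt d\in F$ is fixed, and the formal root in $L$ is $(\sqrt d,-\sqrt d)$). Assume that $d$ generates the discriminant of $L/F$ if $L$ is a field, and $d\in\mathfrak o^\times$ otherwise. Let $(\frac L{\mathfrak p})=-1,0,1$ according to whether $d\notin F^{\times2}, d\notin\mathfrak p$ (inert), $d\notin F^{\times 2},d\in\mathfrak p$ (ramified), $d\in F^{\times2}$ (split). Let $\mathfrak o_L$ be the integral closure of $\mathfrak o$ in $L$, $\mathfrak P=\mathfrak p\mathfrak o_L$, $\alpha=\frac{b+\sqrt d}{2c}\in\mathfrak o_L$. In the ramified case let $w_0\in\mathfrak o$ be any element with $\alpha+w_0\notin\mathfrak o_L^\times$ (it is unique modulo $\mathfrak p$). Let $J=\begin{bmatrix}0&1_2\\-1_2&0\end{bmatrix}$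 and $H(F)=\mathrm{GSp}_4(F)=\{g\in \mathrm{GL}_4(F): {}^tgJg=\mu J,\ \mu\in F^\times\}$. Let $\mathrm I$ be the Iwahori subgroup of all $g\in\mathrm{GSp}_4(\mathfrak o)$ with $$g\equiv\begin{bmatrix}*&0&*&*\\ *&*&*&*\\0&0&*&*\\0&0&0&*\end{bmatrix}\pmod{\mathfrak p}.$$ Let $$s_1=\begin{bmatrix}&1\\1\\&&&1\\&&1\end{bmatrix},\quad s_2=\begin{bmatrix}&&1\\&1\\-1\\&&&1\end{bmatrix},\quad \eta_0=\begin{bmatrix}&&&1\\&&1\\&\varpi\\\varpi\end{bmatrix},\quad W_w=\begin{bmatrix}1\\w&1\\&&1&-w\\&&&1\end{bmatrix},$$ and, for $l,m\in\mathbb Z$ with $m\ge0$, $h(l,m)=\mathrm{diag}(\varpi^{2m+l},\varpi^{m+l},1,\varpi^m)$. Put $W^{(1)}=\{1,s_2,s_2s_1,s_2s_1s_2\}$. Let $\Omega$ be an unramified character of $F^\times$ with $\Omega^2=1$ and $\omega=-\Omega(\varpi)$. Let $\psi$ be an additive character of $F$ with conductor $\mathfrak o$, $S=\begin{bmatrix}a&b/2\\b/2&c\end{bmatrix}$,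 and $\theta\big(\begin{bmatrix}1&X\\&1\end{bmatrix}\big)=\psi(\mathrm{tr}(SX))$ on $U(F)=\{\begin{bmatrix}1&X\\&1\end{bmatrix}:{}^tX=X\}$. Let $T(F)=\{g\in\mathrm{GL}_2(F):{}^tgSg=\det(g)S\}$, embedded in $H(F)$ by $g\mapsto\begin{bmatrix}g\\&\det(g)\,{}^tg^{-1}\end{bmatrix}$ and identified with $L^\times$ by $\begin{bmatrix}x+\frac b2y&cy\\-ay&x-\frac b2y\end{bmatrix}\mapsto x+y\frac{\sqrt d}2$ (in the split case $\mapsto(x+y\frac{\sqrt d}2,\,x-y\frac{\sqrt d}2)$). Let $\Lambda:L^\times\to\mathbb C^\times$ be a (continuous, not necessarily unitary) character trivial on $F^\times$, and $$m_0=c(\Lambda)=\min\{m\ge0:\Lambda|_{(1+\mathfrak P^m)\cap\mathfrak o_L^\times}\equiv1\}.$$ Let $B(\Lambda,\theta)^{\mathrm I}$ be the complex vector space of smooth functions $B:H(F)\to\mathbb C$ that are right $\mathrm I$-invariant and satisfy $B(tuh)=\Lambda(t)\theta(u)B(h)$ for $t\in T(F)$, $u\in U(F)$, $h\in H(F)$,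 and, for all $h\in H(F)$, $$\sum_{w\in\mathfrak o/\mathfrak p}B\Big(h\begin{bmatrix}1&w\\&1\\&&1\\&&-w&1\end{bmatrix}\Big)+B(hs_1)=0,\quad B(h\eta_0)=\omega B(h),\quad \sum_{y\in\mathfrak o/\mathfrak p}B\Big(h\begin{bmatrix}1\\&1\\y&&1\\&&&1\end{bmatrix}\Big)+B(hs_2)=0.$$ For $B\in B(\Lambda,\theta)^{\mathrm I}$ put $C_{m_0}=B(h(0,m_0-1))$ if $m_0\ge1$ and $C_0=B(1)$ if $m_0=0$. For $l,m\in\mathbb Z$, $m\geq 0$, put $A_{l,m}=q^{-4(m-m_0+1)}(-\omega q^{-3})^l$ if $m_0\ge1$ and $A_{l,m}=q^{-4m}(-\omega q^{-3})^l$ if $m_0=0$. **Proposition.** Every $B\in B(\Lambda,\theta)^{\mathrm I}$ has the following values. 1. For all $l\in\mathbb Z$, $m\ge0$: * $B(h(l,m))$, $B(h(l,m)s_2)$, $B(h(l,m)s_2s_1)$ are $0$ if $l\le-1$ or $m\le m_0-2$; otherwise they are $A_{l,m}C_{m_0}$, $-\frac1qA_{l,m}C_{m_0}$, $\frac1{q^2}A_{l,m}C_{m_0}$,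 respectively. * $B(h(l,m)s_2s_1s_2)$ is $0$ if $l\le-2$ or $m\le m_0-2$; otherwise it is $\omega A_{0,m}C_{m_0}$ if $l=-1$ and $-\frac1{q^3}A_{l,m}C_{m_0}$ if $l\ge0$. 2. For all $l\in\mathbb Z$, $m>0$: * $B(h(l,m)s_1)$ is $0$ if $l\le-1$ or $m\le m_0-1$, and $-qA_{l,m}C_{m_0}$ otherwise. * $B(h(l,m)s_1s_2)$, $B(h(l,m)s_1s_2s_1)$, $B(h(l,m)s_1s_2s_1s_2)$ are $0$ if $l\le-2$ or $m\le m_0-1$; otherwise they are $-\omega q^3A_{0,m}C_{m_0}$, $\omega q^2A_{0,m}C_{m_0}$, $-\omega qA_{0,m}C_{m_0}$ if $l=-1$, and $A_{l,m}C_{m_0}$, $-\frac1qA_{l,m}C_{m_0}$, $\frac1{q^2}A_{l,m}C_{m_0}$ if $l\ge0$. 3. Let $m_0\ge1$. For all $l\in\mathbb Z$ and $s\in W^{(1)}$: if $(\frac L{\mathfrak p})=0$, then $B(h(l,0)W_{w_0}s_1s)=0$; if $(\frac L{\mathfrak p})=1$, then $B(h(l,0)W_ws_1s)=0$ for $w=\frac{-b\pm\sqrt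 d}{2c}$. 4. Let $m_0=0$. * (a) If $(\frac L{\mathfrak p})=-1$, then $C_0=0$. * (b) If $(\frac L{\mathfrak p})=0$, then for all $l\in\mathbb Z$: $B(h(l,0)W_{w_0}s_1)$ is $0$ if $l\le-1$ and $-qA_{l,0}C_0$ if $l\ge0$; $B(h(l,0)W_{w_0}s_1s_2)$ is $0$ if $l\le-2$, $-\omega q^3C_0$ if $l=-1$, and $A_{l,0}C_0$ if $l\ge0$; $B(h(l,0)W_{w_0}s_1s_2s_1)$ and $B(h(l,0)W_{w_0}s_1s_2s_1s_2)$ are $0$ if $l\le-2$, and $\omega q^2A_{l+1,0}C_0$, respectively $-\omega qA_{l+1,0}C_0$, if $l\ge-1$. * (c) If $(\frac L{\mathfrak p})=0$ and $\Lambda=\Omega\circ N_{L/F}$, then $C_0=0$. * Let $(\frac L{\mathfrak p})=1$, and write $w_\pm=\frac{-b\pm\sqrt d}{2c}$ and $\lambda=\omega\Lambda((1,\varpi))$. * (d) $B(h(l,0)W_{w_-}s_1s)=\lambda^{-1}B(h(l,0)W_{w_+}s_1s)$ for all $l\in\mathbb Z$, $s\in W^{(1)}$. * (e) If $\lambda=-1$,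 then $C_0=0$, and for all $l\in\mathbb Z$: $B(h(l,0)W_{w_+}s_1)$ and $B(h(l,0)W_{w_+}s_1s_2)$ are $0$ if $l\le-1$, and $A_{l,0}B(W_{w_+}s_1)$, respectively $-\frac1qA_{l,0}B(W_{w_+}s_1)$, if $l\ge0$; $B(h(l,0)W_{w_+}s_1s_2s_1)$ and $B(h(l,0)W_{w_+}s_1s_2s_1s_2)$ are $0$ if $l\le-2$, and $-\omega qA_{l+1,0}B(W_{w_+}s_1)$, respectively $\omega A_{l+1,0}B(W_{w_+}s_1)$, if $l\ge-1$. * (f) If $\lambda\ne-1$, then for all $l\in\mathbb Z$: $B(h(l,0)W_{w_-}s_1)$ and $B(h(l,0)W_{w_-}s_1s_2)$ are $0$ if $l\le-1$, and $-\frac{q-1}{1+\lambda}A_{l,0}C_0$, respectively $\frac{q-1}{q(1+\lambda)}A_{l,0}C_0$, if $l\ge0$; $B(h(l,0)W_{w_-}s_1s_2s_1)$ and $B(h(l,0)W_{w_-}s_1s_2s_1s_2)$ are $0$ if $l\le-2$, and $\frac{\omega q(q-1)}{1+\lambda}A_{l+1,0}C_0$, respectively $-\frac{\omega(q-1)}{1+\lambda}A_{l+1,0}C_0$,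 if $l\ge-1$. **Corollary.** $\dim_{\mathbb C} B(\Lambda,\theta)^{\mathrm I}\le1$ for every such $\Lambda$. -/

import Mathlib

open ValuativeRel
open scoped Matrix

noncomputable section

namespace SteinbergBessel

/-! ### The group `GSp₄` -/

section Group

variable {F : Type*} [Field F]

/-- The `4 × 4` matrix with `2 × 2` blocks `A, B` (first row) and `C, D` (second row). -/
def block (A B C D : Matrix (Fin 2) (Fin 2) F) : Matrix (Fin 4) (Fin 4) F :=
  !![A 0 0, A 0 1, B 0 0, B 0 1;
     A 1 0, A 1 1, B 1 0, B 1 1;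
     C 0 0, C 0 1, D 0 0, D 0 1;
     C 1 0, C 1 1, D 1 0, D 1 1]

/-- The alternating form `J = [0, 1₂; -1₂, 0]`. -/
def J (F : Type*) [Field F] : Matrix (Fin 4) (Fin 4) F :=
  !![0, 0, 1, 0;
     0, 0, 0, 1;
     -1, 0, 0, 0;
     0, -1, 0, 0]

theorem J_mul_J : J F * J F = -1 := by
  ext i j
  fin_cases i <;> fin_cases j <;> simp [J, Matrix.mul_apply, Fin.sum_univ_four]

/-- `GSp₄(F) = {g ∈ GL₄(F) : ᵗg J g = μ J for some μ ∈ Fˣ}`. -/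
def GSp4 (F : Type*) [Field F] : Subgroup (GL (Fin 4) F) where
  carrier := {g | ∃ μ : Fˣ,
    (g : Matrix (Fin 4) (Fin 4) F)ᵀ * J F * (g : Matrix (Fin 4) (Fin 4) F) = (μ : F) • J F}
  one_mem' := ⟨1, by simp⟩
  mul_mem' := by
    rintro g h ⟨μ, hg⟩ ⟨ν, hh⟩
    refine ⟨μ * ν, ?_⟩
    have : ((g * h : GL (Fin 4) F) : Matrix (Fin 4) (Fin 4) F)ᵀ * J F *
        ((g * h : GL (Fin 4) F) : Matrix (Fin 4) (Fin 4) F) =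
        (h : Matrix (Fin 4) (Fin 4) F)ᵀ * ((g : Matrix (Fin 4) (Fin 4) F)ᵀ * J F *
          (g : Matrix (Fin 4) (Fin 4) F)) * (h : Matrix (Fin 4) (Fin 4) F) := by
      simp [Matrix.transpose_mul, Matrix.mul_assoc]
    rw [this, hg, Matrix.mul_smul, Matrix.smul_mul, hh, smul_smul, Units.val_mul]
  inv_mem' := by
    rintro g ⟨μ, hg⟩
    refine ⟨μ⁻¹, ?_⟩
    have h1 : (g : Matrix (Fin 4) (Fin 4) F) *
        ((g⁻¹ : GL (Fin 4) F) : Matrix (Fin 4) (Fin 4) F) = 1 := by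
      rw [← Units.val_mul]; simp
    have h2 : ((g⁻¹ : GL (Fin 4) F) : Matrix (Fin 4) (Fin 4) F)ᵀ *
        (g : Matrix (Fin 4) (Fin 4) F)ᵀ = 1 := by
      rw [← Matrix.transpose_mul, h1, Matrix.transpose_one]
    set x := ((g⁻¹ : GL (Fin 4) F) : Matrix (Fin 4) (Fin 4) F)
    set y := (g : Matrix (Fin 4) (Fin 4) F)
    have h3 : xᵀ * (yᵀ * J F * y) * x = J F := by
      calc xᵀ * (yᵀ * J F * y) * x = (xᵀ * yᵀ) * J F * (y * x) := by
            simp only [Matrix.mul_assoc]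
        _ = J F := by rw [h1, h2]; simp
    rw [hg, Matrix.mul_smul, Matrix.smul_mul] at h3
    rw [← h3, smul_smul, h3]
    simp

/-- The element of `GSp₄(F)` given by a matrix `M` with `ᵗM J M = μ J`, `μ ≠ 0`. -/
def ofMatrix (M : Matrix (Fin 4) (Fin 4) F) (μ : F) (hμ : μ ≠ 0)
    (h : Mᵀ * J F * M = μ • J F) : GSp4 F :=
  have hinv : ((-μ⁻¹) • (J F * Mᵀ * J F)) * M = 1 := by
    rw [Matrix.smul_mul, Matrix.mul_assoc, Matrix.mul_assoc, ← Matrix.mul_assoc Mᵀ, h,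
      Matrix.mul_smul, J_mul_J, smul_smul]
    simp [hμ]
  ⟨⟨M, (-μ⁻¹) • (J F * Mᵀ * J F), mul_eq_one_comm.mp hinv, hinv⟩, Units.mk0 μ hμ, h⟩

/-- The matrix of an element of `GSp₄(F)`. -/
def toMat (g : GSp4 F) : Matrix (Fin 4) (Fin 4) F := ((g : GL (Fin 4) F) : Matrix (Fin 4) (Fin 4) F)

@[simp] theorem toMat_ofMatrix (M : Matrix (Fin 4) (Fin 4) F) (μ : F) (hμ : μ ≠ 0)
    (h : Mᵀ * J F * M = μ • J F) : toMat (ofMatrix M μ hμ h) = M := rfl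

theorem toMat_injective : Function.Injective (toMat : GSp4 F → Matrix (Fin 4) (Fin 4) F) :=
  fun _ _ h => Subtype.ext (Units.ext h)

/-- The Weyl element `s₁`. -/
def s₁ : GSp4 F :=
  ofMatrix !![0, 1, 0, 0;
              1, 0, 0, 0;
              0, 0, 0, 1;
              0, 0, 1, 0] 1 one_ne_zero (by
    ext i j
    fin_cases i <;> fin_cases j <;> simp [J, Matrix.mul_apply, Fin.sum_univ_four])

/-- The Weyl element `s₂`. -/
def s₂ : GSp4 F :=
  ofMatrix !![0, 0, 1, 0;
              0, 1, 0, 0;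
              -1, 0, 0, 0;
              0, 0, 0, 1] 1 one_ne_zero (by
    ext i j
    fin_cases i <;> fin_cases j <;> simp [J, Matrix.mul_apply, Fin.sum_univ_four])

/-- The representatives `{1, s₂, s₂s₁, s₂s₁s₂}` of `{1, s₁} \ W`. -/
def W1 : Set (GSp4 F) := {1, s₂, s₂ * s₁, s₂ * s₁ * s₂}

/-- The Atkin-Lehner element `η₀`. -/
def η₀ (ϖ : Fˣ) : GSp4 F :=
  ofMatrix !![0, 0, 0, 1;
              0, 0, 1, 0;
              0, (ϖ : F), 0, 0;
              (ϖ : F), 0, 0, 0] (-(ϖ : F)) (neg_ne_zero.mpr ϖ.ne_zero) (by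
    ext i j
    fin_cases i <;> fin_cases j <;> simp [J, Matrix.mul_apply, Fin.sum_univ_four])

/-- The upper triangular unipotent elements of the Siegel Levi subgroup. -/
def upperLevi (w : F) : GSp4 F :=
  ofMatrix !![1, w, 0, 0;
              0, 1, 0, 0;
              0, 0, 1, 0;
              0, 0, -w, 1] 1 one_ne_zero (by
    ext i j
    fin_cases i <;> fin_cases j <;> simp [J, Matrix.mul_apply, Fin.sum_univ_four])

/-- The unipotent elements with the entry `y` in place `(3, 1)`. -/
def lowerLong (y : F) : GSp4 F :=
  ofMatrix !![1, 0, 0, 0;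
              0, 1, 0, 0;
              y, 0, 1, 0;
              0, 0, 0, 1] 1 one_ne_zero (by
    ext i j
    fin_cases i <;> fin_cases j <;> simp [J, Matrix.mul_apply, Fin.sum_univ_four])

/-- The lower triangular unipotent elements `W_w` of the Siegel Levi subgroup. -/
def Wmat (w : F) : GSp4 F :=
  ofMatrix !![1, 0, 0, 0;
              w, 1, 0, 0;
              0, 0, 1, -w;
              0, 0, 0, 1] 1 one_ne_zero (by
    ext i j
    fin_cases i <;> fin_cases j <;> simp [J, Matrix.mul_apply, Fin.sum_univ_four])

/-- `h(l, m) = diag(ϖ^(2m+l), ϖ^(m+l), 1, ϖ^m)`. -/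
def hElt (ϖ : Fˣ) (l : ℤ) (m : ℕ) : GSp4 F :=
  ofMatrix !![(ϖ : F) ^ (2 * (m : ℤ) + l), 0, 0, 0;
              0, (ϖ : F) ^ ((m : ℤ) + l), 0, 0;
              0, 0, 1, 0;
              0, 0, 0, (ϖ : F) ^ (m : ℤ)] ((ϖ : F) ^ (2 * (m : ℤ) + l))
    (zpow_ne_zero _ ϖ.ne_zero) (by
    have key : (ϖ : F) ^ ((m : ℤ) + l) * (ϖ : F) ^ m = (ϖ : F) ^ (2 * (m : ℤ) + l) := by
      rw [← zpow_natCast, ← zpow_add₀ ϖ.ne_zero]; congr 1; ring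
    ext i j
    fin_cases i <;> fin_cases j <;> simp [J, Matrix.mul_apply, Fin.sum_univ_four, key]
    rw [mul_comm, key])

/-- The embedding `g ↦ [g, 0; 0, det(g) ᵗg⁻¹]` of `GL₂(F)` in `GSp₄(F)`. -/
def levi (g : GL (Fin 2) F) : GSp4 F :=
  ofMatrix (block (g : Matrix (Fin 2) (Fin 2) F) 0 0
      ((g : Matrix (Fin 2) (Fin 2) F).det •
        ((g⁻¹ : GL (Fin 2) F) : Matrix (Fin 2) (Fin 2) F)ᵀ))
    (g : Matrix (Fin 2) (Fin 2) F).det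
    ((Matrix.isUnit_iff_isUnit_det _).mp g.isUnit).ne_zero (by
    have hdet := ((Matrix.isUnit_iff_isUnit_det _).mp g.isUnit).ne_zero
    rw [Matrix.coe_units_inv, Matrix.inv_def, Matrix.adjugate_fin_two, Ring.inverse_eq_inv',
      Matrix.transpose_smul, smul_smul, mul_inv_cancel₀ hdet, one_smul]
    ext i j
    fin_cases i <;> fin_cases j <;>
      simp [J, block, Matrix.mul_apply, Fin.sum_univ_four, Matrix.det_fin_two] <;> ring)

/-- The element `[1₂, X; 0, 1₂]` of the unipotent radical of the Siegel parabolic, `ᵗX = X`. -/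
def siegelUnip (X : Matrix (Fin 2) (Fin 2) F) (hX : X.IsSymm) : GSp4 F :=
  ofMatrix (block 1 X 0 1) 1 one_ne_zero (by
    have h01 : X 1 0 = X 0 1 := hX.apply 0 1
    ext i j
    fin_cases i <;> fin_cases j <;>
      simp [J, block, Matrix.mul_apply, Fin.sum_univ_four, h01])

end Group

/-! ### The quadratic algebra `L` and the Bessel torus -/

section Quadratic

variable {F : Type*} [Field F]

/-- `d = b² - 4ac`. -/
abbrev disc (a b c : F) : F := b ^ 2 - 4 * a * c

/-- `L = F(√d)`, that is `F[x]/(x² - d)`, with elements `x + y √d` (`x = re`, `y = im`).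
It is a field if `d` is not a square; if `d = δ²` it is `F × F`, see `splitEquiv`. -/
abbrev L (a b c : F) : Type _ := QuadraticAlgebra F (disc a b c) 0

/-- If `d = δ² ≠ 0`, the identification `L = F ⊕ F`, `x + y √d ↦ (x + y δ, x - y δ)`. -/
def splitEquiv [CharZero F] {a b c δ : F} (hδ : δ ^ 2 = disc a b c) (hd : disc a b c ≠ 0) :
    L a b c ≃ₐ[F] F × F :=
  have hδ0 : δ ≠ 0 := by rintro rfl; exact hd (by rw [← hδ]; simp)
  { toFun := fun z => (z.re + z.im * δ, z.re - z.im * δ)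
    invFun := fun p => ⟨(p.1 + p.2) / 2, (p.1 - p.2) / (2 * δ)⟩
    left_inv := fun z => by
      ext
      · simp
      · simp only
        field_simp
        ring
    right_inv := fun p => by
      ext
      · simp only
        field_simp
        ring
      · simp only
        field_simp
        ring
    map_mul' := fun z w => by
      ext
      · simp [← hδ]; ring
      · simp [← hδ]; ring
    map_add' := fun z w => by
      ext
      · simp; ring
      · simp; ring
    commutes' := fun r => by
      ext <;> simp [QuadraticAlgebra.algebraMap_eq] }

/-- The unit of `L` that corresponds to `(u, v) ∈ Fˣ × Fˣ` when `d = δ²`. -/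
def splitUnit [CharZero F] {a b c δ : F} (hδ : δ ^ 2 = disc a b c) (hd : disc a b c ≠ 0)
    (u v : Fˣ) : (L a b c)ˣ :=
  Units.map ((splitEquiv hδ hd).symm : F × F →* L a b c) (MulEquiv.prodUnits.symm (u, v))

/-- `S = [a, b/2; b/2, c]`. -/
def Smat (a b c : F) : Matrix (Fin 2) (Fin 2) F := !![a, b / 2; b / 2, c]

/-- The map `x + y √d / 2 ↦ [x + (b/2) y, c y; -a y, x - (b/2) y]` from `L` to `M₂(F)`. -/
def torusAlg [CharZero F] (a b c : F) : L a b c →ₐ[F] Matrix (Fin 2) (Fin 2) F where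
  toFun z := !![z.re + b * z.im, 2 * c * z.im; -2 * a * z.im, z.re - b * z.im]
  map_one' := by
    ext i j
    fin_cases i <;> fin_cases j <;> simp [QuadraticAlgebra.re_one, QuadraticAlgebra.im_one]
  map_zero' := by ext i j; fin_cases i <;> fin_cases j <;> simp
  map_add' z w := by
    ext i j; fin_cases i <;> fin_cases j <;> simp <;> ring
  map_mul' z w := by
    ext i j; fin_cases i <;> fin_cases j <;> simp [Matrix.mul_apply] <;> ring
  commutes' r := by
    ext i j
    fin_cases i <;> fin_cases j <;>
      simp [QuadraticAlgebra.algebraMap_eq, Matrix.algebraMap_matrix_apply]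

/-- The map `Lˣ → GL₂(F)`, inverse to the isomorphism `T(F) ≅ Lˣ`
(see `mem_torus_iff` and `torusUnit_injective`). -/
def torusUnit [CharZero F] (a b c : F) : (L a b c)ˣ →* GL (Fin 2) F :=
  Units.map (torusAlg a b c : L a b c →* Matrix (Fin 2) (Fin 2) F)

/-- `T(F) = {g ∈ GL₂(F) : ᵗg S g = det(g) S}`. -/
def torus (a b c : F) : Set (GL (Fin 2) F) :=
  {g | (g : Matrix (Fin 2) (Fin 2) F)ᵀ * Smat a b c * (g : Matrix (Fin 2) (Fin 2) F) =
    (g : Matrix (Fin 2) (Fin 2) F).det • Smat a b c}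

theorem torusUnit_injective [CharZero F] {a b c : F} (hc : c ≠ 0) :
    Function.Injective (torusUnit a b c) := by
  intro z w h
  have h' : torusAlg a b c z = torusAlg a b c w := congrArg Units.val h
  have h00 := congrFun (congrFun h' 0) 0
  have h01 := congrFun (congrFun h' 0) 1
  simp [torusAlg, hc] at h00 h01
  apply Units.ext
  ext
  · rw [h01] at h00
    simpa using h00
  · exact h01

theorem mem_torus_iff [CharZero F] {a b c : F} (hc : c ≠ 0) (g : GL (Fin 2) F) :
    g ∈ torus a b c ↔ ∃ z : (L a b c)ˣ, torusUnit a b c z = g := by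
  have hD := ((Matrix.isUnit_iff_isUnit_det _).mp g.isUnit).ne_zero
  constructor
  · intro h
    have h01 := congrFun (congrFun h 0) 1
    have h11 := congrFun (congrFun h 1) 1
    simp only [Smat, Matrix.mul_apply, Fin.sum_univ_two, Matrix.transpose_apply,
      Matrix.det_fin_two, Matrix.smul_apply, smul_eq_mul, Matrix.of_apply, Matrix.cons_val',
      Matrix.cons_val_zero, Matrix.cons_val_one, Matrix.cons_val_fin_one] at h01 h11
    rw [Matrix.det_fin_two] at hD
    set p := (g : Matrix (Fin 2) (Fin 2) F) 0 0 with hp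
    set q := (g : Matrix (Fin 2) (Fin 2) F) 0 1 with hq
    set r := (g : Matrix (Fin 2) (Fin 2) F) 1 0 with hr
    set s := (g : Matrix (Fin 2) (Fin 2) F) 1 1 with hs
    have e1 : a * q + r * c = 0 := by
      apply mul_left_cancel₀ hD
      linear_combination s * h01 - r * h11
    have e2 : b * q + c * s - p * c = 0 := by
      apply mul_left_cancel₀ hD
      linear_combination -q * h01 + p * h11
    let z : L a b c := ⟨(p + s) / 2, q / (2 * c)⟩
    have hz : torusAlg a b c z = (g : Matrix (Fin 2) (Fin 2) F) := by
      ext i j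
      fin_cases i <;> fin_cases j <;> simp [torusAlg, z, ← hp, ← hq, ← hr, ← hs] <;>
        field_simp
      · linear_combination e2
      · linear_combination -e1
      · linear_combination -e2
    have hzz : z * ⟨(p + s) / 2, -(q / (2 * c))⟩ = algebraMap F (L a b c) (p * s - q * r) := by
      ext
      · simp [z, QuadraticAlgebra.algebraMap_eq]
        field_simp
        linear_combination (-(c * p) + c * s - b * q) * e2 + 4 * c * q * e1
      · simp [z, QuadraticAlgebra.algebraMap_eq]
        ring
    have hu : IsUnit z := by
      have : IsUnit (algebraMap F (L a b c) (p * s - q * r)) := (IsUnit.mk0 _ hD).map _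
      rw [← hzz] at this
      exact isUnit_of_mul_isUnit_left this
    exact ⟨hu.unit, Units.ext hz⟩
  · rintro ⟨z, rfl⟩
    change (torusAlg a b c z)ᵀ * Smat a b c * torusAlg a b c z =
      (torusAlg a b c z).det • Smat a b c
    ext i j
    fin_cases i <;> fin_cases j <;>
      simp [torusAlg, Smat, Matrix.mul_apply, Fin.sum_univ_two, Matrix.det_fin_two] <;> ring

end Quadratic

/-! ### Arithmetic of `F` and `L` -/

section Arithmetic

variable {F : Type*} [Field F] [ValuativeRel F]

/-- `x ∈ 𝔭`. -/
def InP (x : F) : Prop := valuation F x < 1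

/-- `x ∈ 𝔬ˣ`. -/
def IsIntUnit (x : F) : Prop := valuation F x = 1

/-- `ϖ` is a uniformizer of `F`. -/
def IsUniformizer (ϖ : Fˣ) : Prop := ∃ p : 𝒪[F], Irreducible p ∧ (p : F) = ϖ

/-- `𝔬_L`, the integral closure of `𝔬` in `L` (for `L = F ⊕ F` this is `𝔬 ⊕ 𝔬`). -/
abbrev OL (a b c : F) : Subalgebra 𝒪[F] (L a b c) := integralClosure 𝒪[F] (L a b c)

/-- The discriminant of `L / F`: the `𝔬`-module generated by the discriminants of all pairs of
elements of `𝔬_L`. -/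
def discriminant (a b c : F) : Submodule 𝒪[F] F :=
  Submodule.span 𝒪[F] {t | ∃ e : Fin 2 → L a b c, (∀ i, e i ∈ OL a b c) ∧ Algebra.discr F e = t}

open Classical in
/-- The Legendre symbol `(L / 𝔭)`: split `1`, ramified `0`, inert `-1`. -/
def legendre (a b c : F) : ℤ :=
  if IsSquare (disc a b c) then 1 else if InP (disc a b c) then 0 else -1

/-- `α = (b + √d) / (2c)`. -/
def α (a b c : F) : L a b c := ⟨b / (2 * c), 1 / (2 * c)⟩

/-- `α + w ∈ 𝔬_L` is not a unit of `𝔬_L` (that is, `α + w ∈ 𝔭_L` when `L` is a field). -/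
def AlphaAddNonunit (a b c w : F) : Prop :=
  ∃ z : OL a b c, (z : L a b c) = α a b c + algebraMap F (L a b c) w ∧ ¬ IsUnit z

/-- `𝔓 = 𝔭 𝔬_L`. -/
def PL (a b c : F) : Ideal (OL a b c) := Ideal.map (algebraMap 𝒪[F] (OL a b c)) 𝓂[F]

/-- `Λ` is trivial on `(1 + 𝔓ᵐ) ∩ 𝔬_Lˣ`. -/
def TrivialAt {a b c : F} (Λ : (L a b c)ˣ →* ℂˣ) (m : ℕ) : Prop :=
  ∀ u : (OL a b c)ˣ, (u : OL a b c) - 1 ∈ PL a b c ^ m →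
    Λ (Units.map ((OL a b c).val : OL a b c →* L a b c) u) = 1

/-- `Λ` is continuous, that is, has an open kernel: the groups `(1 + 𝔓ᵐ) ∩ 𝔬_Lˣ` form a basis of
neighbourhoods of `1` in `Lˣ`. -/
def IsSmoothChar {a b c : F} (Λ : (L a b c)ˣ →* ℂˣ) : Prop := ∃ m, TrivialAt Λ m

/-- `c(Λ) = min {m ≥ 0 : Λ is trivial on (1 + 𝔓ᵐ) ∩ 𝔬_Lˣ}`. -/
def conductorExp {a b c : F} (Λ : (L a b c)ˣ →* ℂˣ) : ℕ := sInf {m | TrivialAt Λ m}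

/-- The additive character `ψ` has conductor `𝔬`: `x𝔬 ⊆ ker ψ` exactly if `x ∈ 𝔬`. -/
def HasConductorO (ψ : AddChar F Circle) : Prop :=
  ∀ x : F, (∀ y ∈ 𝒪[F], ψ (x * y) = 1) ↔ x ∈ 𝒪[F]

end Arithmetic

/-! ### The space `B(Λ, θ)^I` -/

section Bessel

variable {F : Type*} [Field F] [ValuativeRel F]

/-- `K^H = GSp₄(𝔬)`. -/
def KH (F : Type*) [Field F] [ValuativeRel F] : Subgroup (GSp4 F) :=
  (Matrix.GeneralLinearGroup.map (n := Fin 4) (algebraMap 𝒪[F] F)).range.comap (GSp4 F).subtype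

/-- The Iwahori subgroup: the elements of `K^H` that are congruent modulo `𝔭` to a matrix
`[*, 0, *, *; *, *, *, *; 0, 0, *, *; 0, 0, 0, *]`. -/
def Iwahori (F : Type*) [Field F] [ValuativeRel F] : Set (GSp4 F) :=
  {k | k ∈ KH F ∧ InP (toMat k 0 1) ∧ InP (toMat k 2 0) ∧ InP (toMat k 2 1) ∧
    InP (toMat k 3 0) ∧ InP (toMat k 3 1) ∧ InP (toMat k 3 2)}

/-- A representative in `𝔬` of an element of `𝔬 / 𝔭`. -/
def rep (x : 𝓀[F]) : F :=
  ((Function.surjInv (IsLocalRing.residue_surjective (R := 𝒪[F])) x : 𝒪[F]) : F)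

/-- `θ([1, X; 0, 1]) = ψ(tr(S X))`. -/
def θ (ψ : AddChar F Circle) (a b c : F) (X : Matrix (Fin 2) (Fin 2) F) : ℂ :=
  (ψ (Smat a b c * X).trace : ℂ)

/-- The space `B(Λ, θ)^I` of smooth functions on `GSp₄(F)` that are right invariant under the
Iwahori subgroup, transform on the left under `R(F) = T(F) U(F)` by `Λ ⊗ θ`, and satisfy the three
Hecke conditions; in the sums the choice of the representatives does not matter, by the invariance
under the Iwahori subgroup. -/
def besselSpace [TopologicalSpace F] [IsNonarchimedeanLocalField F] [CharZero F] (ϖ : Fˣ) (a b c : F) (ψ : AddChar F Circle)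
    (Λ : (L a b c)ˣ →* ℂˣ) (ω : ℂ) : Submodule ℂ (GSp4 F → ℂ) where
  carrier := {B | IsLocallyConstant B ∧
    (∀ h, ∀ k ∈ Iwahori F, B (h * k) = B h) ∧
    (∀ (z : (L a b c)ˣ) (X : Matrix (Fin 2) (Fin 2) F) (hX : X.IsSymm) (h : GSp4 F),
      B (levi (torusUnit a b c z) * siegelUnip X hX * h) = (Λ z : ℂ) * θ ψ a b c X * B h) ∧
    (∀ h, (∑ᶠ w : 𝓀[F], B (h * upperLevi (rep w))) + B (h * s₁) = 0) ∧
    (∀ h, B (h * η₀ ϖ) = ω * B h) ∧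
    (∀ h, (∑ᶠ y : 𝓀[F], B (h * lowerLong (rep y))) + B (h * s₂) = 0)}
  zero_mem' := ⟨IsLocallyConstant.const 0, by simp, by simp, by simp, by simp, by simp⟩
  add_mem' := by
    rintro B B' ⟨h1, h2, h3, h4, h5, h6⟩ ⟨h1', h2', h3', h4', h5', h6'⟩
    refine ⟨h1.add h1', ?_, ?_, ?_, ?_, ?_⟩
    · intro h k hk
      simp [h2 h k hk, h2' h k hk]
    · intro z X hX h
      simp [h3 z X hX h, h3' z X hX h, mul_add]
    · intro h
      simp only [Pi.add_apply]
      rw [finsum_add_distrib (Set.toFinite _) (Set.toFinite _)]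
      linear_combination h4 h + h4' h
    · intro h
      simp [h5 h, h5' h, mul_add]
    · intro h
      simp only [Pi.add_apply]
      rw [finsum_add_distrib (Set.toFinite _) (Set.toFinite _)]
      linear_combination h6 h + h6' h
  smul_mem' := by
    rintro t B ⟨h1, h2, h3, h4, h5, h6⟩
    refine ⟨h1.comp (fun x => t • x), ?_, ?_, ?_, ?_, ?_⟩
    · intro h k hk
      simp [h2 h k hk]
    · intro z X hX h
      simp only [Pi.smul_apply, smul_eq_mul, h3 z X hX h]
      ring
    · intro h
      simp only [Pi.smul_apply]
      rw [← smul_finsum, ← smul_add, h4 h, smul_zero]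
    · intro h
      simp only [Pi.smul_apply, smul_eq_mul, h5 h]
      ring
    · intro h
      simp only [Pi.smul_apply]
      rw [← smul_finsum, ← smul_add, h6 h, smul_zero]

/-- The constants `A_{l,m}`. -/
def coefA (q ω : ℂ) (m₀ : ℕ) (l : ℤ) (m : ℕ) : ℂ :=
  if 1 ≤ m₀ then q ^ (-4 * ((m : ℤ) - m₀ + 1)) * (-ω * q ^ (-3 : ℤ)) ^ l
  else q ^ (-4 * (m : ℤ)) * (-ω * q ^ (-3 : ℤ)) ^ l

/-- The constant `C_{m₀}` of a function `B`. -/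
def constC (ϖ : Fˣ) (m₀ : ℕ) (B : GSp4 F → ℂ) : ℂ :=
  if 1 ≤ m₀ then B (hElt ϖ 0 (m₀ - 1)) else B 1

end Bessel

end SteinbergBessel

end

open SteinbergBessel

/-! A function `B` in `B(Λ, θ)^I` is determined by its values at representatives of the double
cosets `R(F) \ GSp₄(F) / I`, where `R(F) = T(F) U(F)`, and the Hecke conditions turn into recursions
between these values.

*Recursions.* Put `g = h(l, m) W_w`; here `m = 0` or `w = 0`. Conjugating `U(F)` by `g` turns `θ`
into the character of phase `ϖ^l (P x + P' y + c z)`, where `P = c w² + b w ϖ^m + a ϖ^(2m)` is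
`formValue` and `P' = 2 c w + b ϖ^m` is `formDeriv`. If a line of unipotent elements is normalized
into the Iwahori subgroup and the phase is not trivial on it, the value vanishes
(`IsBessel.cell_eq_zero`); this gives the vanishing for negative `l`. If the phase is trivial, the
sum over `𝔬/𝔭` in a Hecke condition has `q` equal terms (`IsBessel.cell_hecke_s₁`,
`IsBessel.cell_hecke_s₂`), and the values at `g s`, `g s s₁` or `g s s₂` differ by the factor
`-1/q`. Since the Atkin-Lehner element `η₀` is `s₂ s₁ s₂` up to a diagonal element, its eigenvalue
`ω` relates the last of these values to the first one for `l + 1`. Together this is a recursion in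
`l` with ratio `-ω q⁻³`. Another form of the Atkin-Lehner relation, `IsBessel.hElt_s₁s₂`,
exchanges `(l, m)` and `(l - 1, m + 1)` and gives the recursion in `m` with ratio `q⁻⁴`.

*The torus.* The units of `𝔬_L` congruent to `1` modulo `𝔓^(m+1)` lie in `h(l, m) I h(l, m)⁻¹`,
those congruent to `1` modulo `𝔓^m` in the conjugate by `h(l, m) s₁` if `m ≥ 1`, and all units in
the conjugate by `h(l, 0) W_w s₁` if `w` is a root modulo `𝔭`. So the values with `m` small
compared with `m₀` vanish (`IsBessel.hElt_eq_zero`, `IsBessel.hElt_s₁_eq_zero`,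
`IsBessel.cell_s₁_mul_eq_zero`). This uses `𝔬_L = 𝔬 + 𝔬 ξ` with `ξ = (b + √d)/2`, a consequence of
the hypothesis on the discriminant (`int_of_lin_mem_OL`). For `m = 0` the lines in `(𝔬/𝔭)²` that
are not roots of the form `c x² + b x y + a y²` are permuted transitively by the units of `𝔬_L`.
So for `m₀ = 0` the first Hecke condition at `h(l, 0)` is a linear relation between `C₀` and the
values at the roots modulo `𝔭` (`IsBessel.sum_roots`). There are none, one, or two of these in the
inert, ramified and split case. Finally, a uniformizer of the ramified `L`, or the element `(1,
ϖ)` of the split `L`, acts on the lines of the roots like the Atkin-Lehner element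
(`IsBessel.char_mul_cell_of_ramified`, `IsBessel.char_mul_cell_of_split`); this relates the values
at the two roots, and forces `C₀ = 0` in the exceptional cases.

*Dimension.* The values cover all double cosets. The group `GSp₄(F)` is the union of the `P s I`
with `P` the Siegel parabolic subgroup and `s ∈ W⁽¹⁾` (`exists_siegel_decomposition`), and
`GL₂(F)` is the union of the `T(F) diag(ϖ^m, 1) GL₂(𝔬)` (`exists_levi_decomposition`). So `B`
vanishes if `C` and the values at the roots do (`IsBessel.eq_zero_of_constC`), and by the
relations above there is one point at which no nonzero `B` vanishes (`exists_eval_injective`). -/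

namespace SteinbergBessel

/-! ### Arithmetic of the local field -/

section Valuation

variable {F : Type*} [Field F] [ValuativeRel F]

theorem mem_int {x : F} : x ∈ 𝒪[F] ↔ valuation F x ≤ 1 := Iff.rfl

theorem InP.int {x : F} (h : InP x) : x ∈ 𝒪[F] := le_of_lt h

theorem InP.add {x y : F} (hx : InP x) (hy : InP y) : InP (x + y) :=
  lt_of_le_of_lt ((valuation F).map_add x y) (max_lt hx hy)

theorem InP.neg {x : F} (hx : InP x) : InP (-x) := by
  rw [InP, Valuation.map_neg]; exact hx

theorem InP.sub {x y : F} (hx : InP x) (hy : InP y) : InP (x - y) := by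
  rw [sub_eq_add_neg]; exact hx.add hy.neg

theorem InP.mul_left {x y : F} (hx : x ∈ 𝒪[F]) (hy : InP y) : InP (x * y) := by
  rw [InP, map_mul]
  exact lt_of_le_of_lt (mul_le_of_le_one_left' hx) hy

theorem InP.mul_right {x y : F} (hx : InP x) (hy : y ∈ 𝒪[F]) : InP (x * y) := by
  rw [mul_comm]; exact InP.mul_left hy hx

theorem InP.zero : InP (0 : F) := by simp [InP]

theorem IsIntUnit.int {x : F} (h : IsIntUnit x) : x ∈ 𝒪[F] := le_of_eq h

theorem IsIntUnit.ne_zero {x : F} (h : IsIntUnit x) : x ≠ 0 := by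
  rintro rfl; simp [IsIntUnit] at h

theorem IsIntUnit.inv {x : F} (h : IsIntUnit x) : IsIntUnit x⁻¹ := by
  rw [IsIntUnit, map_inv₀, h, inv_one]

theorem IsIntUnit.mul {x y : F} (h : IsIntUnit x) (h' : IsIntUnit y) : IsIntUnit (x * y) := by
  rw [IsIntUnit, map_mul, h, h', one_mul]

theorem IsIntUnit.div {x y : F} (h : IsIntUnit x) (h' : IsIntUnit y) : IsIntUnit (x / y) := by
  rw [div_eq_mul_inv]; exact h.mul h'.inv

theorem IsIntUnit.neg {x : F} (h : IsIntUnit x) : IsIntUnit (-x) := by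
  rw [IsIntUnit, Valuation.map_neg]; exact h

theorem IsIntUnit.one : IsIntUnit (1 : F) := by simp [IsIntUnit]

theorem IsIntUnit.of_mul {x y : F} (hx : x ∈ 𝒪[F]) (hy : y ∈ 𝒪[F]) (h : IsIntUnit (x * y)) :
    IsIntUnit x := by
  rw [IsIntUnit, map_mul] at h
  refine le_antisymm hx ?_
  rw [← h]
  exact mul_le_of_le_one_right' hy

theorem IsIntUnit.of_pow_two {x : F} (h : IsIntUnit (x ^ 2)) : IsIntUnit x := by
  rw [IsIntUnit, map_pow] at h
  exact le_antisymm ((pow_le_one_iff (by norm_num)).mp h.le)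
    (not_lt.mp fun h' => ((pow_lt_one_iff (by norm_num)).mpr h').ne h)

theorem IsIntUnit.add_inP {x y : F} (hx : IsIntUnit x) (hy : InP y) : IsIntUnit (x + y) := by
  rw [IsIntUnit, Valuation.map_add_eq_of_lt_left, hx]
  rw [hx]; exact hy

theorem IsIntUnit.not_inP {x : F} (hx : IsIntUnit x) : ¬ InP x := by
  rw [InP, hx]; exact lt_irrefl _

theorem isIntUnit_of_not_inP {x : F} (hx : x ∈ 𝒪[F]) (h : ¬ InP x) : IsIntUnit x :=
  le_antisymm hx (not_lt.mp h)

theorem InP.of_pow_two {x : F} (h : InP (x ^ 2)) : InP x := by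
  rw [InP, map_pow] at h
  exact (pow_lt_one_iff (by norm_num)).mp h

theorem InP.of_mul_unit {x y : F} (hx : IsIntUnit x) (h : InP (x * y)) : InP y := by
  rwa [InP, map_mul, hx, one_mul] at h

theorem int_of_sq_int {x : F} (h : x ^ 2 ∈ 𝒪[F]) : x ∈ 𝒪[F] := by
  rw [mem_int, map_pow] at h
  exact (pow_le_one_iff (by norm_num)).mp h

theorem IsIntUnit.inv_int {x : F} (h : IsIntUnit x) : x⁻¹ ∈ 𝒪[F] := h.inv.int

theorem isUnit_iff_isIntUnit (x : 𝒪[F]) : IsUnit x ↔ IsIntUnit (x : F) :=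
  Valuation.Integers.isUnit_iff_valuation_eq_one (Valuation.integer.integers (valuation F))

theorem mem_maximalIdeal_iff_inP (x : 𝒪[F]) : x ∈ 𝓂[F] ↔ InP (x : F) := by
  rw [IsLocalRing.mem_maximalIdeal, mem_nonunits_iff, isUnit_iff_isIntUnit]
  exact ⟨fun h => lt_of_le_of_ne x.2 h, fun h h' => h'.not_inP h⟩

theorem rep_int (x : 𝓀[F]) : rep x ∈ 𝒪[F] :=
  (Function.surjInv (IsLocalRing.residue_surjective (R := 𝒪[F])) x).2

theorem residue_eq_iff (x y : 𝒪[F]) :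
    IsLocalRing.residue 𝒪[F] x = IsLocalRing.residue 𝒪[F] y ↔ InP ((x : F) - y) := by
  rw [← sub_eq_zero, ← map_sub, IsLocalRing.residue_eq_zero_iff, mem_maximalIdeal_iff_inP]
  rfl

theorem exists_rep_sub_inP {x : F} (hx : x ∈ 𝒪[F]) : ∃ r : 𝓀[F], InP (rep r - x) := by
  refine ⟨IsLocalRing.residue 𝒪[F] ⟨x, hx⟩, ?_⟩
  have := Function.surjInv_eq (IsLocalRing.residue_surjective (R := 𝒪[F]))
    (IsLocalRing.residue 𝒪[F] ⟨x, hx⟩)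
  exact (residue_eq_iff _ _).mp this

theorem rep_inj {r s : 𝓀[F]} (h : InP (rep r - rep s)) : r = s := by
  have := (residue_eq_iff _ _).mpr h
  rwa [Function.surjInv_eq IsLocalRing.residue_surjective,
    Function.surjInv_eq IsLocalRing.residue_surjective] at this

theorem IsUniformizer.inP {ϖ : Fˣ} (hϖ : IsUniformizer ϖ) : InP (ϖ : F) := by
  obtain ⟨p, hp, h⟩ := hϖ
  rw [← h, ← mem_maximalIdeal_iff_inP]
  exact hp.not_isUnit

/-- An additive character of conductor `𝔬` is nontrivial on `x 𝔬` if `x ∉ 𝔬`. -/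
theorem exists_char_ne_one {ψ : AddChar F Circle} (hψ : HasConductorO ψ) {x : F}
    (hx : x ∉ 𝒪[F]) : ∃ y ∈ 𝒪[F], ψ (x * y) ≠ 1 := by
  by_contra! h
  exact hx ((hψ x).mp h)

theorem char_eq_one {ψ : AddChar F Circle} (hψ : HasConductorO ψ) {x : F}
    (hx : x ∈ 𝒪[F]) : ψ x = 1 := by
  simpa using (hψ x).mpr hx 1 (one_mem _)

theorem IsUniformizer.int {ϖ : Fˣ} (hϖ : IsUniformizer ϖ) : (ϖ : F) ∈ 𝒪[F] := hϖ.inP.int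

theorem IsUniformizer.zpow_int {ϖ : Fˣ} (hϖ : IsUniformizer ϖ) {n : ℤ} (hn : 0 ≤ n) :
    (ϖ : F) ^ n ∈ 𝒪[F] := by
  lift n to ℕ using hn
  rw [zpow_natCast]
  exact pow_mem hϖ.int n

theorem IsUniformizer.pow_inP {ϖ : Fˣ} (hϖ : IsUniformizer ϖ) {n : ℕ} (hn : n ≠ 0) :
    InP ((ϖ : F) ^ n) := by
  obtain ⟨k, rfl⟩ := Nat.exists_eq_succ_of_ne_zero hn
  rw [pow_succ]
  exact InP.mul_left (pow_mem hϖ.int k) hϖ.inP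

theorem IsUniformizer.not_int_zpow {ϖ : Fˣ} (hϖ : IsUniformizer ϖ) {n : ℤ} (hn : n ≤ -1) :
    (ϖ : F) ^ n ∉ 𝒪[F] := by
  intro h
  have h1 : IsIntUnit ((ϖ : F) ^ n * (ϖ : F) ^ (-n)) := by
    rw [← zpow_add₀ ϖ.ne_zero]; simp [IsIntUnit]
  have h2 := IsIntUnit.of_mul (hϖ.zpow_int (n := -n) (by omega)) h (by rwa [mul_comm] at h1)
  obtain ⟨k, hk⟩ : ∃ k : ℕ, -n = (k + 1 : ℕ) := ⟨(-n - 1).toNat, by omega⟩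
  rw [hk, zpow_natCast] at h2
  exact h2.not_inP (hϖ.pow_inP (by omega))

end Valuation

section LocalField

variable {F : Type*} [Field F] [ValuativeRel F] [TopologicalSpace F]
  [IsNonarchimedeanLocalField F] {ϖ : Fˣ}

theorem InP.exists_eq_mul (hϖ : IsUniformizer ϖ) {x : F} (hx : InP x) :
    ∃ y ∈ 𝒪[F], x = ϖ * y := by
  obtain ⟨p, hp, h⟩ := hϖ
  have h1 : (⟨x, hx.int⟩ : 𝒪[F]) ∈ 𝓂[F] := (mem_maximalIdeal_iff_inP _).mpr hx
  rw [hp.maximalIdeal_eq, Ideal.mem_span_singleton] at h1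
  obtain ⟨y, hy⟩ := h1
  exact ⟨y, y.2, by rw [← h]; exact congrArg Subtype.val hy⟩

theorem exists_int_eq_unit_mul_pow (hϖ : IsUniformizer ϖ) {x : F} (hx : x ∈ 𝒪[F]) (hx0 : x ≠ 0) :
    ∃ (n : ℕ) (u : F), IsIntUnit u ∧ x = u * (ϖ : F) ^ n := by
  obtain ⟨p, hp, h⟩ := hϖ
  have h0 : (⟨x, hx⟩ : 𝒪[F]) ≠ 0 := fun h => hx0 (congrArg Subtype.val h)
  obtain ⟨n, u, hu⟩ := IsDiscreteValuationRing.eq_unit_mul_pow_irreducible h0 hp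
  refine ⟨n, (u : 𝒪[F]), (isUnit_iff_isIntUnit _).mp u.isUnit, ?_⟩
  rw [← h]
  exact congrArg Subtype.val hu

theorem exists_eq_unit_mul_zpow (hϖ : IsUniformizer ϖ) {x : F} (hx0 : x ≠ 0) :
    ∃ (n : ℤ) (u : F), IsIntUnit u ∧ x = u * (ϖ : F) ^ n := by
  rcases le_total (valuation F x) 1 with h | h
  · obtain ⟨n, u, hu, e⟩ := exists_int_eq_unit_mul_pow hϖ (x := x) h hx0
    exact ⟨n, u, hu, by simpa using e⟩
  · have h' : x⁻¹ ∈ 𝒪[F] := by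
      rw [mem_int, map_inv₀]
      exact inv_le_one_of_one_le₀ h
    obtain ⟨n, u, hu, e⟩ := exists_int_eq_unit_mul_pow hϖ h' (inv_ne_zero hx0)
    refine ⟨-n, u⁻¹, hu.inv, ?_⟩
    rw [← inv_inv x, e, mul_inv]
    simp

/-- Hensel's lemma for the polynomial `c x² + b x + a` with unit discriminant. -/
theorem exists_root_of_inP {a b c w : F} (ha : a ∈ 𝒪[F]) (hb : b ∈ 𝒪[F]) (hc : IsIntUnit c)
    (hd : IsIntUnit (disc a b c)) (hw : w ∈ 𝒪[F]) (h : InP (a + b * w + c * w ^ 2)) :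
    IsSquare (disc a b c) := by
  let _ := IsTopologicalAddGroup.rightUniformSpace F
  have _ := isUniformAddGroup_of_addCommGroup (G := F)
  have hH : HenselianRing 𝒪[F] 𝓂[F] := inferInstance
  have hbc : b / c ∈ 𝒪[F] := by rw [div_eq_mul_inv]; exact mul_mem hb hc.inv_int
  have hac : a / c ∈ 𝒪[F] := by rw [div_eq_mul_inv]; exact mul_mem ha hc.inv_int
  let β : 𝒪[F] := ⟨b / c, hbc⟩
  let γ : 𝒪[F] := ⟨a / c, hac⟩
  let f : Polynomial 𝒪[F] := Polynomial.X ^ 2 + Polynomial.C β * Polynomial.X + Polynomial.C γ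
  have hf : f.Monic := by
    simp only [f]
    monicity!
  have hev : ∀ x : 𝒪[F], ((f.eval x : 𝒪[F]) : F) = (a + b * x + c * (x : F) ^ 2) / c := by
    intro x
    have : f.eval x = x ^ 2 + β * x + γ := by simp [f]
    rw [this]
    simp only [Subring.coe_add, Subring.coe_pow, Subring.coe_mul, β, γ]
    field_simp [hc.ne_zero]
    ring
  have hder : ((f.derivative.eval ⟨w, hw⟩ : 𝒪[F]) : F) = (b + 2 * c * w) / c := by
    have : f.derivative.eval ⟨w, hw⟩ = ⟨w, hw⟩ + ⟨w, hw⟩ + β := by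
      simp only [f, Polynomial.derivative_add, Polynomial.derivative_X_pow,
        Polynomial.derivative_C_mul, Polynomial.derivative_X, Polynomial.derivative_C,
        Polynomial.eval_add, Polynomial.eval_mul, Polynomial.eval_C, Polynomial.eval_pow,
        Polynomial.eval_X, Polynomial.eval_one, Polynomial.eval_zero]
      push_cast
      simp only [pow_one, two_mul, mul_one, add_zero]
    rw [this]
    simp only [Subring.coe_add, β]
    field_simp [hc.ne_zero]
    ring
  have h2 : IsIntUnit (b + 2 * c * w) := by
    apply IsIntUnit.of_pow_two
    have e : (b + 2 * c * w) ^ 2 = disc a b c + (4 * c) * (a + b * w + c * w ^ 2) := by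
      simp only [disc]; ring
    rw [e]
    refine hd.add_inP (InP.mul_left (mul_mem ?_ hc.int) h)
    exact (4 : 𝒪[F]).2
  obtain ⟨r, hr, -⟩ := hH.is_henselian f hf ⟨w, hw⟩
    ((mem_maximalIdeal_iff_inP _).mpr (by
      rw [hev, div_eq_mul_inv]; exact h.mul_right hc.inv_int))
    (by
      apply IsUnit.map
      rw [isUnit_iff_isIntUnit, hder]
      exact h2.div hc)
  have hr' := congrArg Subtype.val hr
  change ((f.eval r : 𝒪[F]) : F) = 0 at hr'
  rw [hev, div_eq_zero_iff] at hr'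
  have hr0 : a + b * (r : F) + c * (r : F) ^ 2 = 0 := hr'.resolve_right hc.ne_zero
  refine ⟨b + 2 * c * r, ?_⟩
  simp only [disc]
  linear_combination (-4 * c) * hr0

end LocalField

/-! ### The order `𝔬_L` and the conductor of `Λ` -/

section QuadraticOrder

variable {F : Type*} [Field F]

/-- The element `x + y ξ` of `L`, where `ξ = (b + √d) / 2` is a root of `T² - b T + a c`. -/
def lin (a b c x y : F) : L a b c := ⟨x + b * y / 2, y / 2⟩

theorem int_of_algebraMap_mem_OL [ValuativeRel F] {a b c x : F}
    (h : algebraMap F (L a b c) x ∈ OL a b c) :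
    x ∈ 𝒪[F] := by
  have h1 : IsIntegral 𝒪[F] x :=
    (isIntegral_algebraMap_iff (QuadraticAlgebra.algebraMap_injective)).mp h
  obtain ⟨y, rfl⟩ := (IsIntegrallyClosed.isIntegral_iff (K := F)).mp h1
  exact y.2

variable [CharZero F]

/-- The norm of `x + y ξ`. -/
def nm (a b c x y : F) : F := x ^ 2 + b * x * y + a * c * y ^ 2

theorem lin_mul (a b c x y x' y' : F) : lin a b c x y * lin a b c x' y' =
    lin a b c (x * x' - a * c * (y * y')) (x * y' + x' * y + b * (y * y')) := by
  ext <;> simp [lin, disc] <;> ring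

theorem lin_eq (a b c : F) (z : L a b c) : lin a b c (z.re - b * z.im) (2 * z.im) = z := by
  ext <;> simp [lin]
  ring

/-- The unit `x + y ξ` of `L`, if its norm does not vanish. -/
def linUnit {a b c x y : F} (h : nm a b c x y ≠ 0) : (L a b c)ˣ where
  val := lin a b c x y
  inv := lin a b c ((x + b * y) / nm a b c x y) (-y / nm a b c x y)
  val_inv := by
    rw [lin_mul]
    ext <;> simp [lin, QuadraticAlgebra.re_one, QuadraticAlgebra.im_one] <;> field_simp <;>
      simp only [nm] <;> ring
  inv_val := by
    rw [lin_mul]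
    ext <;> simp [lin, QuadraticAlgebra.re_one, QuadraticAlgebra.im_one] <;> field_simp <;>
      simp only [nm] <;> ring

@[simp] theorem linUnit_val {a b c x y : F} (h : nm a b c x y ≠ 0) :
    (linUnit h : L a b c) = lin a b c x y := rfl

theorem torusUnit_linUnit {a b c x y : F} (h : nm a b c x y ≠ 0) :
    (torusUnit a b c (linUnit h) : Matrix (Fin 2) (Fin 2) F) =
      !![x + b * y, c * y; -(a * y), x] := by
  change torusAlg a b c (lin a b c x y) = _
  ext i j
  fin_cases i <;> fin_cases j <;> simp [torusAlg, lin] <;> ring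

theorem norm_lin (a b c x y : F) : QuadraticAlgebra.norm (lin a b c x y) = nm a b c x y := by
  simp [QuadraticAlgebra.norm, lin, nm, disc]
  ring

theorem splitUnit_eq_linUnit {a b c δ : F} {ϖ : Fˣ} (hδ : δ ^ 2 = disc a b c)
    (hd : disc a b c ≠ 0) :
    ∃ h, splitUnit hδ hd 1 ϖ =
      linUnit (x := (1 + ϖ) / 2 - b * ((1 - ϖ) / (2 * δ))) (y := (1 - ϖ) / δ) h := by
  have e : (splitUnit hδ hd 1 ϖ : L a b c) =
      lin a b c ((1 + ϖ) / 2 - b * ((1 - ϖ) / (2 * δ))) ((1 - ϖ) / δ) := by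
    change (⟨(1 + ϖ) / 2, (1 - ϖ) / (2 * δ)⟩ : L a b c) = _
    have hδ0 : δ ≠ 0 := by rintro rfl; exact hd (by rw [← hδ]; simp)
    ext <;> simp [lin] <;> field_simp
    ring
  refine ⟨?_, Units.ext e⟩
  rw [← norm_lin, ← e]
  exact ((splitUnit hδ hd 1 ϖ).isUnit.map QuadraticAlgebra.norm).ne_zero

theorem discr_one_lin (a b c x y : F) :
    Algebra.discr F ![(1 : L a b c), lin a b c x y] = y ^ 2 * disc a b c := by
  have htr : ∀ z : L a b c, Algebra.trace F (L a b c) z = 2 * z.re := by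
    intro z
    rw [Algebra.trace_eq_matrix_trace (QuadraticAlgebra.basis _ _), Matrix.trace_fin_two]
    simp only [Algebra.leftMulMatrix_eq_repr_mul]
    have h0 : QuadraticAlgebra.basis (disc a b c) 0 0 = ⟨1, 0⟩ := by
      apply (QuadraticAlgebra.basis (disc a b c) 0).repr.injective
      ext i
      fin_cases i <;> simp
    have h1 : QuadraticAlgebra.basis (disc a b c) 0 1 = ⟨0, 1⟩ := by
      apply (QuadraticAlgebra.basis (disc a b c) 0).repr.injective
      ext i
      fin_cases i <;> simp
    simp [h0, h1, two_mul]
  rw [Algebra.discr_def, Matrix.det_fin_two]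
  simp only [Algebra.traceMatrix_apply, Algebra.traceForm_apply, htr]
  simp [lin, QuadraticAlgebra.re_one]
  ring

variable [ValuativeRel F]

/-- An element of `L` with integral trace and norm is integral. -/
theorem lin_mem_OL_of_trace_norm {a b c x y : F} (ht : 2 * x + b * y ∈ 𝒪[F])
    (hn : nm a b c x y ∈ 𝒪[F]) : lin a b c x y ∈ OL a b c := by
  refine ⟨Polynomial.X ^ 2 + Polynomial.C (-⟨_, ht⟩) * Polynomial.X
    + Polynomial.C ⟨_, hn⟩, by monicity!, ?_⟩
  simp only [Polynomial.eval₂_add, Polynomial.eval₂_mul, Polynomial.eval₂_pow,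
    Polynomial.eval₂_X, Polynomial.eval₂_C, map_neg, Polynomial.eval₂_neg]
  change lin a b c x y ^ 2 + -(algebraMap F (L a b c) (2 * x + b * y)) * lin a b c x y +
    algebraMap F (L a b c) (nm a b c x y) = 0
  ext <;> simp [lin, pow_two, QuadraticAlgebra.algebraMap_eq, disc, nm] <;> ring

theorem lin_mem_OL {a b c x y : F} (ha : a ∈ 𝒪[F]) (hb : b ∈ 𝒪[F]) (hc : c ∈ 𝒪[F])
    (hx : x ∈ 𝒪[F]) (hy : y ∈ 𝒪[F]) : lin a b c x y ∈ OL a b c :=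
  lin_mem_OL_of_trace_norm (add_mem (mul_mem (2 : 𝒪[F]).2 hx) (mul_mem hb hy))
    (add_mem (add_mem (pow_mem hx 2) (mul_mem (mul_mem hb hx) hy))
      (mul_mem (mul_mem ha hc) (pow_mem hy 2)))

/-- The standing hypotheses on `a, b, c`: integrality, `c` a unit, and `d` a generator of the
discriminant of `L / F`. -/
structure IsAdmissible (a b c : F) : Prop where
  a_int : a ∈ 𝒪[F]
  b_int : b ∈ 𝒪[F]
  c_unit : IsIntUnit c
  disc_ne : disc a b c ≠ 0
  field : ¬ IsSquare (disc a b c) → discriminant a b c = Submodule.span 𝒪[F] {disc a b c}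
  split : IsSquare (disc a b c) → IsIntUnit (disc a b c)

/-- The integral closure is `𝔬 + 𝔬 ξ`: this is where the hypothesis on the discriminant enters. -/
theorem int_of_lin_mem_OL {a b c x y : F} (adm : IsAdmissible a b c)
    (h : lin a b c x y ∈ OL a b c) : x ∈ 𝒪[F] ∧ y ∈ 𝒪[F] := by
  have hy : y ∈ 𝒪[F] := by
    apply int_of_sq_int
    by_cases hs : IsSquare (disc a b c)
    · have hconj : lin a b c (x + b * y) (-y) ∈ OL a b c := by
        let σ : L a b c →ₐ[F] L a b c :=
          { toFun := fun z => ⟨z.re, -z.im⟩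
            map_one' := by ext <;> simp [QuadraticAlgebra.re_one, QuadraticAlgebra.im_one]
            map_mul' := fun z w => by ext <;> (simp; try ring)
            map_zero' := by ext <;> simp
            map_add' := fun z w => by ext <;> (simp; try ring)
            commutes' := fun r => by ext <;> simp [QuadraticAlgebra.algebraMap_eq] }
        have hσ : σ (lin a b c x y) = lin a b c (x + b * y) (-y) := by
          ext <;> simp [lin, σ] <;> ring
        rw [← hσ]
        exact IsIntegral.map (σ.restrictScalars 𝒪[F]) h
      have hdif : algebraMap F (L a b c) (y ^ 2 * disc a b c) ∈ OL a b c := by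
        have : algebraMap F (L a b c) (y ^ 2 * disc a b c) =
            (lin a b c x y - lin a b c (x + b * y) (-y)) ^ 2 := by
          ext <;> simp [lin, pow_two, QuadraticAlgebra.algebraMap_eq] <;> ring
        rw [this]
        exact pow_mem (sub_mem h hconj) 2
      have := mul_mem (int_of_algebraMap_mem_OL hdif) (adm.split hs).inv_int
      rwa [mul_assoc, mul_inv_cancel₀ adm.disc_ne, mul_one] at this
    · have hmem : y ^ 2 * disc a b c ∈ discriminant a b c := by
        apply Submodule.subset_span
        refine ⟨![1, lin a b c x y], ?_, discr_one_lin a b c x y⟩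
        intro i
        fin_cases i
        · exact one_mem _
        · exact h
      rw [adm.field hs, Submodule.mem_span_singleton] at hmem
      obtain ⟨r, hr⟩ := hmem
      have : (r : F) = y ^ 2 := mul_right_cancel₀ adm.disc_ne hr
      rw [← this]
      exact r.2
  refine ⟨?_, hy⟩
  apply int_of_algebraMap_mem_OL (a := a) (b := b) (c := c)
  have : algebraMap F (L a b c) x = lin a b c x y - lin a b c 0 y := by
    ext <;> simp [lin, QuadraticAlgebra.algebraMap_eq]
  rw [this]
  exact sub_mem h (lin_mem_OL adm.a_int adm.b_int adm.c_unit.int (zero_mem _) hy)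

omit [CharZero F] in
theorem IsAdmissible.nm_int {a b c x y : F} (adm : IsAdmissible a b c) (hx : x ∈ 𝒪[F])
    (hy : y ∈ 𝒪[F]) : nm a b c x y ∈ 𝒪[F] :=
  add_mem (add_mem (pow_mem hx 2) (mul_mem (mul_mem adm.b_int hx) hy))
    (mul_mem (mul_mem adm.a_int adm.c_unit.int) (pow_mem hy 2))

omit [CharZero F] in
theorem IsAdmissible.disc_int {a b c : F} (adm : IsAdmissible a b c) : disc a b c ∈ 𝒪[F] :=
  sub_mem (pow_mem adm.b_int 2) (mul_mem (mul_mem (4 : 𝒪[F]).2 adm.a_int) adm.c_unit.int)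

/-- The unit `x + y ξ` of `𝔬_L`. -/
def linUnitOL {a b c x y : F} (adm : IsAdmissible a b c) (hx : x ∈ 𝒪[F]) (hy : y ∈ 𝒪[F])
    (h : IsIntUnit (nm a b c x y)) : (OL a b c)ˣ where
  val := ⟨lin a b c x y, lin_mem_OL adm.a_int adm.b_int adm.c_unit.int hx hy⟩
  inv := ⟨lin a b c ((x + b * y) / nm a b c x y) (-y / nm a b c x y), by
    refine lin_mem_OL adm.a_int adm.b_int adm.c_unit.int ?_ ?_ <;> rw [div_eq_mul_inv]
    · exact mul_mem (add_mem hx (mul_mem adm.b_int hy)) h.inv_int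
    · exact mul_mem (neg_mem hy) h.inv_int⟩
  val_inv := Subtype.ext (linUnit h.ne_zero).val_inv
  inv_val := Subtype.ext (linUnit h.ne_zero).inv_val

theorem exists_linUnitOL {a b c : F} (adm : IsAdmissible a b c) (u : (OL a b c)ˣ) :
    ∃ (x y : F) (hx : x ∈ 𝒪[F]) (hy : y ∈ 𝒪[F]) (h : IsIntUnit (nm a b c x y)),
      linUnitOL adm hx hy h = u := by
  have key : ∀ v : OL a b c, ∃ x y : F, x ∈ 𝒪[F] ∧ y ∈ 𝒪[F] ∧ lin a b c x y = v := by
    intro v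
    have h := lin_eq a b c (v : L a b c)
    obtain ⟨hx, hy⟩ := int_of_lin_mem_OL adm (by rw [h]; exact v.2)
    exact ⟨_, _, hx, hy, h⟩
  obtain ⟨x, y, hx, hy, e⟩ := key u
  obtain ⟨x', y', hx', hy', e'⟩ := key (u⁻¹ : (OL a b c)ˣ)
  have h1 : lin a b c x y * lin a b c x' y' = 1 := by
    rw [e, e', ← MulMemClass.coe_mul, Units.mul_inv]
    rfl
  have h2 : nm a b c x y * nm a b c x' y' = 1 := by
    rw [← norm_lin, ← norm_lin, ← map_mul, h1, map_one]
  have h3 : IsIntUnit (nm a b c x y) := by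
    refine IsIntUnit.of_mul (adm.nm_int hx hy) (adm.nm_int hx' hy') ?_
    rw [h2]
    exact IsIntUnit.one
  exact ⟨x, y, hx, hy, h3, Units.ext (Subtype.ext e)⟩

/-- A translate `α + w` that is not a unit of `𝔬_L` is a root of `c x² + b x + a` modulo `𝔭`. -/
theorem AlphaAddNonunit.inP {a b c w : F} (adm : IsAdmissible a b c) (hw : w ∈ 𝒪[F])
    (h : AlphaAddNonunit a b c w) : InP (a + b * w + c * w ^ 2) := by
  obtain ⟨z, hz, hu⟩ := h
  by_contra hP
  apply hu
  have hc0 := adm.c_unit.ne_zero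
  have hPint : a + b * w + c * w ^ 2 ∈ 𝒪[F] :=
    add_mem (add_mem adm.a_int (mul_mem adm.b_int hw)) (mul_mem adm.c_unit.int (pow_mem hw 2))
  have e : nm a b c w c⁻¹ = (a + b * w + c * w ^ 2) / c := by
    simp only [nm]
    field_simp
    ring
  have hn : IsIntUnit (nm a b c w c⁻¹) := by
    rw [e]
    exact (isIntUnit_of_not_inP hPint hP).div adm.c_unit
  have : z = linUnitOL adm hw adm.c_unit.inv_int hn := by
    apply Subtype.ext
    rw [hz]
    change _ = lin a b c w c⁻¹
    ext <;> simp [lin, α, QuadraticAlgebra.algebraMap_eq] <;> field_simp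
    ring
  rw [this]
  exact Units.isUnit _

omit [CharZero F] in
theorem trivialAt_conductorExp {a b c : F} {Λ : (L a b c)ˣ →* ℂˣ} (h : IsSmoothChar Λ) :
    TrivialAt Λ (conductorExp Λ) := Nat.sInf_mem (s := {m | TrivialAt Λ m}) h

variable [TopologicalSpace F] [IsNonarchimedeanLocalField F] {ϖ : Fˣ}

omit [CharZero F] in
theorem mem_PL_pow_iff {a b c : F} (hϖ : IsUniformizer ϖ) (m : ℕ) (z : OL a b c) :
    z ∈ PL a b c ^ m ↔ ∃ t ∈ OL a b c, (z : L a b c) = algebraMap F (L a b c) (ϖ ^ m) * t := by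
  obtain ⟨p, hp, h⟩ := hϖ
  rw [PL, hp.maximalIdeal_eq, Ideal.map_span, Set.image_singleton, Ideal.span_singleton_pow,
    Ideal.mem_span_singleton, ← map_pow]
  have e : ((algebraMap 𝒪[F] (OL a b c) (p ^ m) : OL a b c) : L a b c) =
      algebraMap F (L a b c) (ϖ ^ m) := by
    rw [← h]; rfl
  constructor
  · rintro ⟨t, rfl⟩
    exact ⟨t, t.2, by rw [MulMemClass.coe_mul, e]⟩
  · rintro ⟨t, ht, hz⟩
    exact ⟨⟨t, ht⟩, Subtype.ext (by rw [MulMemClass.coe_mul, e, hz])⟩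

/-- `Λ` is trivial on `(1 + 𝔓ᵐ) ∩ 𝔬_Lˣ`, in the coordinates given by `𝔬_L = 𝔬 + 𝔬 ξ`. -/
theorem trivialAt_iff {a b c : F} (adm : IsAdmissible a b c) (hϖ : IsUniformizer ϖ)
    (Λ : (L a b c)ˣ →* ℂˣ) (m : ℕ) :
    TrivialAt Λ m ↔ ∀ (x y : F) (h : IsIntUnit (nm a b c (1 + ϖ ^ m * x) (ϖ ^ m * y))),
      x ∈ 𝒪[F] → y ∈ 𝒪[F] → Λ (linUnit h.ne_zero) = 1 := by
  have hmap : ∀ {x y : F} (hx : x ∈ 𝒪[F]) (hy : y ∈ 𝒪[F]) (h : IsIntUnit (nm a b c x y)),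
      Units.map ((OL a b c).val : OL a b c →* L a b c) (linUnitOL adm hx hy h) =
        linUnit h.ne_zero := fun hx hy h => Units.ext rfl
  constructor
  · intro H x y h hx hy
    have hX : 1 + ϖ ^ m * x ∈ 𝒪[F] := add_mem (one_mem _) (mul_mem (pow_mem hϖ.int m) hx)
    have hY : ϖ ^ m * y ∈ 𝒪[F] := mul_mem (pow_mem hϖ.int m) hy
    rw [← hmap hX hY h]
    apply H
    rw [mem_PL_pow_iff hϖ]
    refine ⟨lin a b c x y, lin_mem_OL adm.a_int adm.b_int adm.c_unit.int hx hy, ?_⟩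
    change lin a b c _ _ - 1 = _
    ext <;> simp [lin, QuadraticAlgebra.algebraMap_eq, QuadraticAlgebra.re_one,
      QuadraticAlgebra.im_one] <;> ring
  · intro H u hu
    obtain ⟨X, Y, hX, hY, h, rfl⟩ := exists_linUnitOL adm u
    rw [mem_PL_pow_iff hϖ] at hu
    obtain ⟨t, ht, e⟩ := hu
    rw [← lin_eq a b c t] at ht e
    obtain ⟨hx, hy⟩ := int_of_lin_mem_OL adm ht
    set x := t.re - b * t.im
    set y := 2 * t.im
    change lin a b c X Y - 1 = _ at e
    have e2 : Y = ϖ ^ m * y := by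
      have := congrArg QuadraticAlgebra.im e
      simp [lin, QuadraticAlgebra.algebraMap_eq, QuadraticAlgebra.im_one] at this
      linear_combination 2 * this
    have e1 : X = 1 + ϖ ^ m * x := by
      have := congrArg QuadraticAlgebra.re e
      simp [lin, QuadraticAlgebra.algebraMap_eq, QuadraticAlgebra.re_one] at this
      linear_combination this - b / 2 * e2
    subst e1 e2
    rw [hmap hX hY h]
    exact H x y h hx hy

/-- In the ramified case `c x² + b x + a` takes no value in `𝔭²`. -/
theorem IsAdmissible.eq_unit_mul_of_inP {a b c w : F} (adm : IsAdmissible a b c)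
    (hϖ : IsUniformizer ϖ) (hd : InP (disc a b c))
    (h : InP (a + b * w + c * w ^ 2)) :
    InP (b + 2 * c * w) ∧ ∃ u, IsIntUnit u ∧ a + b * w + c * w ^ 2 = ϖ * u := by
  have hϖ0 := ϖ.ne_zero
  have hb' : InP (b + 2 * c * w) := by
    apply InP.of_pow_two
    have e : (b + 2 * c * w) ^ 2 = disc a b c + (4 * c) * (a + b * w + c * w ^ 2) := by
      simp only [disc]; ring
    rw [e]
    exact hd.add (InP.mul_left (mul_mem (4 : 𝒪[F]).2 adm.c_unit.int) h)
  refine ⟨hb', ?_⟩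
  obtain ⟨u, hu, e⟩ := h.exists_eq_mul hϖ
  refine ⟨u, isIntUnit_of_not_inP hu fun hP => ?_, e⟩
  -- otherwise `(c w + ξ) / ϖ` would be integral
  obtain ⟨v, hv, e2⟩ := hP.exists_eq_mul hϖ
  obtain ⟨r, hr, e3⟩ := hb'.exists_eq_mul hϖ
  have hz : lin a b c (c * w / ϖ) (1 / ϖ) ∈ OL a b c := by
    apply lin_mem_OL_of_trace_norm
    · have : 2 * (c * w / ϖ) + b * (1 / ϖ) = r := by
        field_simp
        linear_combination e3
      rwa [this]
    · have : nm a b c (c * w / ϖ) (1 / ϖ) = c * v := by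
        simp only [nm]
        field_simp
        rw [e2] at e
        linear_combination c * e
      rw [this]
      exact mul_mem adm.c_unit.int hv
  have h1 := (int_of_lin_mem_OL adm hz).2
  have h2 : InP ((1 / ϖ) * (ϖ : F)) := InP.mul_left h1 hϖ.inP
  rw [one_div, inv_mul_cancel₀ hϖ0] at h2
  exact IsIntUnit.one.not_inP h2

theorem exists_linUnit_ne_one {a b c : F} (adm : IsAdmissible a b c) (hϖ : IsUniformizer ϖ)
    {Λ : (L a b c)ˣ →* ℂˣ} {m : ℕ} (hm : m < conductorExp Λ) :
    ∃ (x y : F) (h : IsIntUnit (nm a b c (1 + ϖ ^ m * x) (ϖ ^ m * y))),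
      x ∈ 𝒪[F] ∧ y ∈ 𝒪[F] ∧ Λ (linUnit h.ne_zero) ≠ 1 := by
  have := Nat.notMem_of_lt_sInf hm
  rw [Set.mem_ofPred_eq, trivialAt_iff adm hϖ] at this
  push Not at this
  obtain ⟨x, y, h, hx, hy, hne⟩ := this
  exact ⟨x, y, h, hx, hy, hne⟩

end QuadraticOrder

/-! ### Identities in `GSp₄` -/

section GroupIdentities

variable {F : Type*} [Field F]

theorem toMat_mul (g h : GSp4 F) : toMat (g * h) = toMat g * toMat h := rfl

theorem toMat_one : toMat (1 : GSp4 F) = 1 := rfl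

theorem toMat_inv_mul {g g' : GSp4 F} {M : Matrix (Fin 4) (Fin 4) F}
    (e : toMat g' = toMat g * M) : toMat (g⁻¹ * g') = M := by
  rw [toMat_mul, e, ← Matrix.mul_assoc, ← toMat_mul, inv_mul_cancel, toMat_one, one_mul]

theorem toMat_s₁ : toMat (s₁ : GSp4 F) = !![0, 1, 0, 0; 1, 0, 0, 0; 0, 0, 0, 1; 0, 0, 1, 0] := rfl

theorem toMat_s₂ : toMat (s₂ : GSp4 F) = !![0, 0, 1, 0; 0, 1, 0, 0; -1, 0, 0, 0; 0, 0, 0, 1] := rfl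

theorem toMat_η₀ (ϖ : Fˣ) : toMat (η₀ ϖ) =
    !![0, 0, 0, 1; 0, 0, 1, 0; 0, (ϖ : F), 0, 0; (ϖ : F), 0, 0, 0] := rfl

theorem toMat_upperLevi (w : F) : toMat (upperLevi w) =
    !![1, w, 0, 0; 0, 1, 0, 0; 0, 0, 1, 0; 0, 0, -w, 1] := rfl

theorem toMat_lowerLong (y : F) : toMat (lowerLong y) =
    !![1, 0, 0, 0; 0, 1, 0, 0; y, 0, 1, 0; 0, 0, 0, 1] := rfl

theorem toMat_Wmat (w : F) : toMat (Wmat w) =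
    !![1, 0, 0, 0; w, 1, 0, 0; 0, 0, 1, -w; 0, 0, 0, 1] := rfl

theorem toMat_hElt (ϖ : Fˣ) (l : ℤ) (m : ℕ) : toMat (hElt ϖ l m) =
    !![(ϖ : F) ^ m * (ϖ : F) ^ (l + m), 0, 0, 0; 0, (ϖ : F) ^ (l + m), 0, 0;
      0, 0, 1, 0; 0, 0, 0, (ϖ : F) ^ m] := by
  rw [← zpow_natCast, ← zpow_add₀ ϖ.ne_zero, add_comm l, ← add_assoc, ← two_mul]
  rfl

theorem toMat_levi (A : GL (Fin 2) F) : toMat (levi A) =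
    !![A 0 0, A 0 1, 0, 0; A 1 0, A 1 1, 0, 0; 0, 0, A 1 1, -A 1 0; 0, 0, -A 0 1, A 0 0] := by
  have hdet := ((Matrix.isUnit_iff_isUnit_det _).mp A.isUnit).ne_zero
  rw [levi, toMat_ofMatrix, Matrix.coe_units_inv, Matrix.inv_def, Matrix.adjugate_fin_two,
    Ring.inverse_eq_inv', Matrix.transpose_smul, smul_smul, mul_inv_cancel₀ hdet, one_smul]
  ext i j
  fin_cases i <;> fin_cases j <;> simp [block]

/-- The element `[1₂, X; 0, 1₂]` with `X = [x, y; y, z]`. -/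
def symUnip (x y z : F) : GSp4 F :=
  siegelUnip !![x, y; y, z] (by ext i j; fin_cases i <;> fin_cases j <;> rfl)

theorem toMat_symUnip (x y z : F) : toMat (symUnip x y z) =
    !![1, 0, x, y; 0, 1, y, z; 0, 0, 1, 0; 0, 0, 0, 1] := by
  change block 1 _ 0 1 = _
  ext i j
  fin_cases i <;> fin_cases j <;> simp [block]

/-- The element `diag(t, t, 1, 1)`. -/
def simil (t : Fˣ) : GSp4 F :=
  ofMatrix !![(t : F), 0, 0, 0; 0, (t : F), 0, 0; 0, 0, 1, 0; 0, 0, 0, 1] t t.ne_zero (by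
    ext i j
    fin_cases i <;> fin_cases j <;> simp [J, Matrix.mul_apply, Fin.sum_univ_four])

theorem toMat_simil (t : Fˣ) : toMat (simil t) =
    !![(t : F), 0, 0, 0; 0, (t : F), 0, 0; 0, 0, 1, 0; 0, 0, 0, 1] := rfl

/-- The element `[p, q; r, s]` of `GL₂(F)`. -/
def gl2 (p q r s : F) (h : p * s - q * r ≠ 0) : GL (Fin 2) F :=
  Matrix.GeneralLinearGroup.mkOfDetNeZero !![p, q; r, s] (by rwa [Matrix.det_fin_two_of])

theorem coe_gl2 (p q r s : F) (h : p * s - q * r ≠ 0) :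
    (gl2 p q r s h : Matrix (Fin 2) (Fin 2) F) = !![p, q; r, s] := rfl

/-- Multiplication of two `4 × 4` matrices given by their entries. -/
theorem mul_fin_four (a₁ a₂ a₃ a₄ b₁ b₂ b₃ b₄ c₁ c₂ c₃ c₄ d₁ d₂ d₃ d₄
    a₁' a₂' a₃' a₄' b₁' b₂' b₃' b₄' c₁' c₂' c₃' c₄' d₁' d₂' d₃' d₄' : F) :
    !![a₁, a₂, a₃, a₄; b₁, b₂, b₃, b₄; c₁, c₂, c₃, c₄; d₁, d₂, d₃, d₄] *
      !![a₁', a₂', a₃', a₄'; b₁', b₂', b₃', b₄'; c₁', c₂', c₃', c₄'; d₁', d₂', d₃', d₄'] =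
    !![a₁ * a₁' + a₂ * b₁' + a₃ * c₁' + a₄ * d₁', a₁ * a₂' + a₂ * b₂' + a₃ * c₂' + a₄ * d₂',
        a₁ * a₃' + a₂ * b₃' + a₃ * c₃' + a₄ * d₃', a₁ * a₄' + a₂ * b₄' + a₃ * c₄' + a₄ * d₄';
      b₁ * a₁' + b₂ * b₁' + b₃ * c₁' + b₄ * d₁', b₁ * a₂' + b₂ * b₂' + b₃ * c₂' + b₄ * d₂',
        b₁ * a₃' + b₂ * b₃' + b₃ * c₃' + b₄ * d₃', b₁ * a₄' + b₂ * b₄' + b₃ * c₄' + b₄ * d₄';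
      c₁ * a₁' + c₂ * b₁' + c₃ * c₁' + c₄ * d₁', c₁ * a₂' + c₂ * b₂' + c₃ * c₂' + c₄ * d₂',
        c₁ * a₃' + c₂ * b₃' + c₃ * c₃' + c₄ * d₃', c₁ * a₄' + c₂ * b₄' + c₃ * c₄' + c₄ * d₄';
      d₁ * a₁' + d₂ * b₁' + d₃ * c₁' + d₄ * d₁', d₁ * a₂' + d₂ * b₂' + d₃ * c₂' + d₄ * d₂',
        d₁ * a₃' + d₂ * b₃' + d₃ * c₃' + d₄ * d₃',
        d₁ * a₄' + d₂ * b₄' + d₃ * c₄' + d₄ * d₄'] := by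
  ext i j
  fin_cases i <;> fin_cases j <;> simp [Matrix.mul_apply, Fin.sum_univ_four]

theorem s₁_mul_s₁ : (s₁ * s₁ : GSp4 F) = 1 := by
  apply toMat_injective
  rw [toMat_mul, toMat_s₁, mul_fin_four, toMat_one]
  ext i j
  fin_cases i <;> fin_cases j <;> simp

theorem s₁_mul_upperLevi (w : F) : s₁ * upperLevi w = Wmat w * s₁ := by
  apply toMat_injective
  simp only [toMat_mul, toMat_s₁, toMat_upperLevi, toMat_Wmat, mul_fin_four]
  simp

theorem s₁_mul_symUnip (x y z : F) : s₁ * symUnip x y z = symUnip z y x * s₁ := by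
  apply toMat_injective
  simp only [toMat_mul, toMat_s₁, toMat_symUnip, mul_fin_four]
  simp

theorem s₂_mul_symUnip (z : F) : s₂ * symUnip 0 0 z = symUnip 0 0 z * s₂ := by
  apply toMat_injective
  simp only [toMat_mul, toMat_s₂, toMat_symUnip, mul_fin_four]
  simp

theorem s₂_mul_Wmat (w : F) : s₂ * Wmat w = symUnip 0 (-w) 0 * s₂ := by
  apply toMat_injective
  simp only [toMat_mul, toMat_s₂, toMat_symUnip, toMat_Wmat, mul_fin_four]
  simp

theorem s₂_mul_lowerLong (y : F) : s₂ * lowerLong y = symUnip (-y) 0 0 * s₂ := by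
  apply toMat_injective
  simp only [toMat_mul, toMat_s₂, toMat_symUnip, toMat_lowerLong, mul_fin_four]
  simp

theorem Wmat_mul_symUnip (w x y z : F) : Wmat w * symUnip x y z =
    symUnip x (y + w * x) (z + 2 * w * y + w ^ 2 * x) * Wmat w := by
  apply toMat_injective
  simp only [toMat_mul, toMat_symUnip, toMat_Wmat, mul_fin_four]
  simp
  refine ⟨?_, ?_, ?_⟩ <;> ring

theorem hElt_mul_symUnip (ϖ : Fˣ) (l : ℤ) (m : ℕ) (x y z : F) : hElt ϖ l m * symUnip x y z =
    symUnip ((ϖ : F) ^ m * (ϖ : F) ^ (l + m) * x) ((ϖ : F) ^ (l + m) * y) ((ϖ : F) ^ l * z) *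
      hElt ϖ l m := by
  apply toMat_injective
  simp only [toMat_mul, toMat_symUnip, toMat_hElt, mul_fin_four]
  simp [zpow_add₀ ϖ.ne_zero]
  constructor <;> ring

theorem hElt_mul_simil (ϖ : Fˣ) (l : ℤ) (m : ℕ) : hElt ϖ l m * simil ϖ = hElt ϖ (l + 1) m := by
  apply toMat_injective
  simp only [toMat_mul, toMat_simil, toMat_hElt, mul_fin_four]
  have : (ϖ : F) ^ (l + 1 + m) = ϖ ^ (l + m) * ϖ := by
    rw [← zpow_add_one₀ ϖ.ne_zero]; congr 1; ring
  simp [this, mul_assoc]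

theorem simil_mul_Wmat (t : Fˣ) (w : F) : simil t * Wmat w = Wmat w * simil t := by
  apply toMat_injective
  simp only [toMat_mul, toMat_simil, toMat_Wmat, mul_fin_four]
  simp [mul_comm]

theorem simil_mul_s₁ (t : Fˣ) : simil t * s₁ = s₁ * simil t := by
  apply toMat_injective
  simp only [toMat_mul, toMat_simil, toMat_s₁, mul_fin_four]
  simp

theorem simil_mul_levi (t : Fˣ) (A : GL (Fin 2) F) : simil t * levi A = levi A * simil t := by
  apply toMat_injective
  simp only [toMat_mul, toMat_simil, toMat_levi, mul_fin_four]
  simp [mul_comm]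

theorem levi_mul (A A' : GL (Fin 2) F) : levi (A * A') = levi A * levi A' := by
  apply toMat_injective
  simp only [toMat_mul, toMat_levi, mul_fin_four]
  simp [Matrix.mul_apply, Fin.sum_univ_two]
  constructor <;> ring

theorem simil_mul (t u : Fˣ) : simil (t * u) = simil t * simil u := by
  apply toMat_injective
  simp only [toMat_mul, toMat_simil, mul_fin_four]
  simp

theorem hElt_zero_zero (ϖ : Fˣ) : hElt ϖ 0 0 = 1 := by
  apply toMat_injective
  rw [toMat_hElt, toMat_one]
  ext i j
  fin_cases i <;> fin_cases j <;> simp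

theorem hElt_eq_levi (ϖ : Fˣ) (l : ℤ) (m : ℕ) : hElt ϖ l m =
    levi (gl2 ((ϖ : F) ^ m) 0 0 1 (by simp)) * simil (ϖ ^ (l + m)) := by
  apply toMat_injective
  simp only [toMat_mul, toMat_simil, toMat_hElt, toMat_levi, coe_gl2, mul_fin_four]
  simp

theorem hElt_mul_upperLevi (ϖ : Fˣ) (l : ℤ) (m : ℕ) (w : F) : hElt ϖ l m * upperLevi w =
    levi (gl2 ((ϖ : F) ^ m) ((ϖ : F) ^ m * w) 0 1 (by simp)) * simil (ϖ ^ (l + m)) := by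
  apply toMat_injective
  simp only [toMat_mul, toMat_simil, toMat_hElt, toMat_levi, coe_gl2, mul_fin_four,
    toMat_upperLevi]
  simp
  ring

theorem hElt_mul_Wmat_mul_s₁ (ϖ : Fˣ) (l : ℤ) (m : ℕ) (w : F) : hElt ϖ l m * Wmat w * s₁ =
    levi (gl2 0 (-(ϖ : F) ^ m) (-1) (-w) (by simp)) * simil (ϖ ^ (l + m)) * simil (-1) := by
  apply toMat_injective
  simp only [toMat_mul, toMat_simil, toMat_hElt, toMat_levi, coe_gl2, mul_fin_four,
    toMat_Wmat, toMat_s₁]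
  simp
  ring

/-- The elements `h(l, m) W_w`. -/
def cell (ϖ : Fˣ) (m : ℕ) (w : F) (l : ℤ) : GSp4 F := hElt ϖ l m * Wmat w

theorem Wmat_zero : Wmat (0 : F) = 1 := by
  apply toMat_injective
  rw [toMat_Wmat, toMat_one]
  ext i j
  fin_cases i <;> fin_cases j <;> simp

theorem cell_zero (ϖ : Fˣ) (m : ℕ) (l : ℤ) : cell ϖ m 0 l = hElt ϖ l m := by
  rw [cell, Wmat_zero, mul_one]

theorem cell_mul_simil (ϖ : Fˣ) (m : ℕ) (w : F) (l : ℤ) :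
    cell ϖ m w l * simil ϖ = cell ϖ m w (l + 1) := by
  rw [cell, cell, mul_assoc, ← simil_mul_Wmat, ← mul_assoc, hElt_mul_simil]

theorem levi_scalar_mul {t : F} (ht : t * t - 0 * 0 ≠ 0) (g : GSp4 F) :
    levi (gl2 t 0 0 t ht) * g = g * levi (gl2 t 0 0 t ht) := by
  apply toMat_injective
  have : toMat (levi (gl2 t 0 0 t ht)) = t • (1 : Matrix (Fin 4) (Fin 4) F) := by
    rw [toMat_levi]
    ext i j
    fin_cases i <;> fin_cases j <;> simp [coe_gl2]
  rw [toMat_mul, toMat_mul, this]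
  simp

theorem one_mem_W1 : (1 : GSp4 F) ∈ W1 := Or.inl rfl

theorem s₂_mem_W1 : (s₂ : GSp4 F) ∈ W1 := Or.inr (Or.inl rfl)

theorem s₂s₁_mem_W1 : (s₂ * s₁ : GSp4 F) ∈ W1 := Or.inr (Or.inr (Or.inl rfl))

theorem s₂s₁s₂_mem_W1 : (s₂ * s₁ * s₂ : GSp4 F) ∈ W1 := Or.inr (Or.inr (Or.inr rfl))

end GroupIdentities

/-! ### The Iwahori subgroup -/

section IwahoriSubgroup

variable {F : Type*} [Field F] [ValuativeRel F]

/-- The shape of the matrices of the elements of the Iwahori subgroup; for elements of `GSp₄(F)`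
it suffices to ask that the first and the third diagonal entry be units, see `mem_Iwahori`. -/
structure IwahoriShape (M : Matrix (Fin 4) (Fin 4) F) : Prop where
  int : ∀ i j, M i j ∈ 𝒪[F]
  h01 : InP (M 0 1)
  h20 : InP (M 2 0)
  h21 : InP (M 2 1)
  h30 : InP (M 3 0)
  h31 : InP (M 3 1)
  h32 : InP (M 3 2)
  unit0 : IsIntUnit (M 0 0)
  unit2 : IsIntUnit (M 2 2)

theorem iwahoriShape_of {a₁ a₂ a₃ a₄ b₁ b₂ b₃ b₄ c₁ c₂ c₃ c₄ d₁ d₂ d₃ d₄ : F}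
    (ha₁ : IsIntUnit a₁) (ha₂ : InP a₂) (ha₃ : a₃ ∈ 𝒪[F]) (ha₄ : a₄ ∈ 𝒪[F])
    (hb₁ : b₁ ∈ 𝒪[F]) (hb₂ : b₂ ∈ 𝒪[F]) (hb₃ : b₃ ∈ 𝒪[F]) (hb₄ : b₄ ∈ 𝒪[F])
    (hc₁ : InP c₁) (hc₂ : InP c₂) (hc₃ : IsIntUnit c₃) (hc₄ : c₄ ∈ 𝒪[F])
    (hd₁ : InP d₁) (hd₂ : InP d₂) (hd₃ : InP d₃) (hd₄ : d₄ ∈ 𝒪[F]) :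
    IwahoriShape !![a₁, a₂, a₃, a₄; b₁, b₂, b₃, b₄; c₁, c₂, c₃, c₄; d₁, d₂, d₃, d₄] where
  int i j := by
    fin_cases i <;> fin_cases j
    exacts [ha₁.int, ha₂.int, ha₃, ha₄, hb₁, hb₂, hb₃, hb₄, hc₁.int, hc₂.int, hc₃.int, hc₄,
      hd₁.int, hd₂.int, hd₃.int, hd₄]
  h01 := ha₂
  h20 := hc₁
  h21 := hc₂
  h30 := hd₁
  h31 := hd₂
  h32 := hd₃
  unit0 := ha₁
  unit2 := hc₃

theorem mem_Iwahori {k : GSp4 F} (h : IwahoriShape (toMat k)) : k ∈ Iwahori F := by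
  refine ⟨?_, h.h01, h.h20, h.h21, h.h30, h.h31, h.h32⟩
  obtain ⟨μ, hμ⟩ := k.2
  change (toMat k)ᵀ * J F * toMat k = (μ : F) • J F at hμ
  have hμ1 : IsIntUnit (μ : F) := by
    have e := congrFun (congrFun hμ 0) 2
    simp [J, Matrix.mul_apply, Fin.sum_univ_four] at e
    rw [← e]
    have : -(toMat k 2 0 * toMat k 0 2) + -(toMat k 3 0 * toMat k 1 2) +
        toMat k 0 0 * toMat k 2 2 + toMat k 1 0 * toMat k 3 2 =
        toMat k 0 0 * toMat k 2 2 + (toMat k 1 0 * toMat k 3 2 -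
          (toMat k 2 0 * toMat k 0 2 + toMat k 3 0 * toMat k 1 2)) := by ring
    rw [this]
    exact (h.unit0.mul h.unit2).add_inP ((InP.mul_left (h.int _ _) h.h32).sub
      ((h.h20.mul_right (h.int _ _)).add (h.h30.mul_right (h.int _ _))))
  have hdet : IsIntUnit (toMat k).det := by
    have e := congrArg Matrix.det hμ
    have hJ : (J F).det * (J F).det = 1 := by
      rw [← Matrix.det_mul, J_mul_J, Matrix.det_neg]
      norm_num
    rw [Matrix.det_mul, Matrix.det_mul, Matrix.det_transpose, Matrix.det_smul] at e
    have e2 : (toMat k).det ^ 2 = (μ : F) ^ 4 := by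
      have := congrArg (· * (J F).det) e
      simp only [Fintype.card_fin] at this
      linear_combination this + ((toMat k).det ^ 2 - (μ : F) ^ 4) * (-hJ)
    apply IsIntUnit.of_pow_two
    rw [e2, IsIntUnit, map_pow, hμ1, one_pow]
  let M : Matrix (Fin 4) (Fin 4) 𝒪[F] := fun i j => ⟨toMat k i j, h.int i j⟩
  have hM : (algebraMap 𝒪[F] F).mapMatrix M = toMat k := rfl
  have hu : IsUnit M := by
    rw [Matrix.isUnit_iff_isUnit_det, isUnit_iff_isIntUnit]
    have : ((M.det : 𝒪[F]) : F) = (toMat k).det := by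
      rw [← hM, ← RingHom.map_det]
      rfl
    rwa [this]
  exact ⟨hu.unit, Units.ext hM⟩

/-- Conjugation by an element of `W⁽¹⁾` maps the lower triangular Iwahori subgroup of `GL₂(𝔬)`
into the Iwahori subgroup. -/
theorem exists_iwahori_levi_mul (A : GL (Fin 2) F) (h00 : IsIntUnit (A 0 0)) (h01 : InP (A 0 1))
    (h10 : A 1 0 ∈ 𝒪[F]) (h11 : IsIntUnit (A 1 1)) {s : GSp4 F} (hs : s ∈ W1) :
    ∃ k ∈ Iwahori F, levi A * s = s * k := by
  suffices ∃ M, IwahoriShape M ∧ toMat (levi A * s) = toMat s * M by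
    obtain ⟨M, hM, e⟩ := this
    refine ⟨s⁻¹ * (levi A * s), mem_Iwahori ?_, by group⟩
    rwa [toMat_inv_mul e]
  have hz := InP.zero (F := F)
  have h0 := zero_mem 𝒪[F]
  rcases hs with rfl | rfl | rfl | rfl
  · refine ⟨!![A 0 0, A 0 1, 0, 0; A 1 0, A 1 1, 0, 0; 0, 0, A 1 1, -A 1 0; 0, 0, -A 0 1, A 0 0],
      iwahoriShape_of h00 h01 h0 h0 h10 h11.int h0 h0 hz hz h11 (neg_mem h10) hz hz h01.neg
      h00.int, ?_⟩
    rw [mul_one, toMat_one, one_mul, toMat_levi]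
  · refine ⟨!![A 1 1, 0, 0, A 1 0; 0, A 1 1, A 1 0, 0; 0, A 0 1, A 0 0, 0; A 0 1, 0, 0, A 0 0],
      iwahoriShape_of h11 hz h0 h10 h0 h11.int h10 h0 hz h01 h00 h0 h01 hz hz h00.int, ?_⟩
    simp only [toMat_mul, toMat_levi, toMat_s₂, mul_fin_four]
    simp
  · refine ⟨!![A 1 1, 0, 0, A 1 0; 0, A 1 1, A 1 0, 0; 0, A 0 1, A 0 0, 0; A 0 1, 0, 0, A 0 0],
      iwahoriShape_of h11 hz h0 h10 h0 h11.int h10 h0 hz h01 h00 h0 h01 hz hz h00.int, ?_⟩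
    simp only [toMat_mul, toMat_levi, toMat_s₂, toMat_s₁, mul_fin_four]
    simp
  · refine ⟨!![A 0 0, -A 0 1, 0, 0; -A 1 0, A 1 1, 0, 0; 0, 0, A 1 1, A 1 0; 0, 0, A 0 1, A 0 0],
      iwahoriShape_of h00 h01.neg h0 h0 (neg_mem h10) h11.int h0 h0 hz hz h11 h10 hz hz h01
      h00.int, ?_⟩
    simp only [toMat_mul, toMat_levi, toMat_s₂, toMat_s₁, mul_fin_four]
    simp

theorem exists_iwahori_simil_mul (t : Fˣ) (ht : IsIntUnit (t : F)) {s : GSp4 F} (hs : s ∈ W1) :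
    ∃ k ∈ Iwahori F, simil t * s = s * k := by
  suffices ∃ M, IwahoriShape M ∧ toMat (simil t * s) = toMat s * M by
    obtain ⟨M, hM, e⟩ := this
    refine ⟨s⁻¹ * (simil t * s), mem_Iwahori ?_, by group⟩
    rwa [toMat_inv_mul e]
  have hz := InP.zero (F := F)
  have h0 := zero_mem 𝒪[F]
  have h1 := IsIntUnit.one (F := F)
  rcases hs with rfl | rfl | rfl | rfl
  · refine ⟨!![(t : F), 0, 0, 0; 0, (t : F), 0, 0; 0, 0, 1, 0; 0, 0, 0, 1],
      iwahoriShape_of ht hz h0 h0 h0 ht.int h0 h0 hz hz h1 h0 hz hz hz h1.int, ?_⟩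
    rw [mul_one, toMat_one, one_mul, toMat_simil]
  · refine ⟨!![1, 0, 0, 0; 0, (t : F), 0, 0; 0, 0, (t : F), 0; 0, 0, 0, 1],
      iwahoriShape_of h1 hz h0 h0 h0 ht.int h0 h0 hz hz ht h0 hz hz hz h1.int, ?_⟩
    simp only [toMat_mul, toMat_simil, toMat_s₂, mul_fin_four]
    simp
  · refine ⟨!![(t : F), 0, 0, 0; 0, 1, 0, 0; 0, 0, 1, 0; 0, 0, 0, (t : F)],
      iwahoriShape_of ht hz h0 h0 h0 h1.int h0 h0 hz hz h1 h0 hz hz hz ht.int, ?_⟩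
    simp only [toMat_mul, toMat_simil, toMat_s₂, toMat_s₁, mul_fin_four]
    simp
  · refine ⟨!![1, 0, 0, 0; 0, 1, 0, 0; 0, 0, (t : F), 0; 0, 0, 0, (t : F)],
      iwahoriShape_of h1 hz h0 h0 h0 h1.int h0 h0 hz hz ht h0 hz hz hz ht.int, ?_⟩
    simp only [toMat_mul, toMat_simil, toMat_s₂, toMat_s₁, mul_fin_four]
    simp

end IwahoriSubgroup

/-! ### Bessel functions and the Hecke relations -/

section ResidueField

variable {F : Type*} [Field F] [ValuativeRel F] [TopologicalSpace F]
  [IsNonarchimedeanLocalField F]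

theorem finsum_const_residue (v : ℂ) :
    ∑ᶠ _ : 𝓀[F], v = (Nat.card 𝓀[F] : ℂ) * v := by
  have := Fintype.ofFinite 𝓀[F]
  rw [finsum_eq_sum_of_fintype, Finset.sum_const, Finset.card_univ, nsmul_eq_mul,
    Nat.card_eq_fintype_card]

theorem one_lt_card_residue : 1 < Nat.card 𝓀[F] := Finite.one_lt_card

theorem card_residue_ne_zero : (Nat.card 𝓀[F] : ℂ) ≠ 0 := by
  have := one_lt_card_residue (F := F)
  exact_mod_cast (by omega : Nat.card 𝓀[F] ≠ 0)

theorem card_residue_sub_one_ne_zero : (Nat.card 𝓀[F] : ℂ) - 1 ≠ 0 := by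
  have := one_lt_card_residue (F := F)
  rw [sub_ne_zero]
  exact_mod_cast (by omega : Nat.card 𝓀[F] ≠ 1)

end ResidueField

section BesselFunction

variable {F : Type*} [Field F] [ValuativeRel F] [TopologicalSpace F]
  [IsNonarchimedeanLocalField F] [CharZero F]

/-- The function `B` lies in `B(Λ, θ)^I`, for data that satisfy the standing hypotheses. -/
structure IsBessel (ϖ : Fˣ) (a b c : F) (ψ : AddChar F Circle) (Λ : (L a b c)ˣ →* ℂˣ) (ω q : ℂ)
    (B : GSp4 F → ℂ) : Prop where
  adm : IsAdmissible a b c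
  unif : IsUniformizer ϖ
  cond : HasConductorO ψ
  sq : ω * ω = 1
  card : q = (Nat.card 𝓀[F] : ℂ)
  trivF : ∀ x : Fˣ, Λ (Units.map (algebraMap F (L a b c) : F →* L a b c) x) = 1
  smooth : IsSmoothChar Λ
  mem : B ∈ besselSpace ϖ a b c ψ Λ ω

namespace IsBessel

variable {ϖ : Fˣ} {a b c : F} {ψ : AddChar F Circle} {Λ : (L a b c)ˣ →* ℂˣ} {ω q : ℂ}
  {B : GSp4 F → ℂ} (hB : IsBessel ϖ a b c ψ Λ ω q B)
include hB

theorem right (h : GSp4 F) {k : GSp4 F} (hk : k ∈ Iwahori F) : B (h * k) = B h :=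
  hB.mem.2.1 h k hk

theorem right_of_shape {g g' : GSp4 F} {M : Matrix (Fin 4) (Fin 4) F} (hM : IwahoriShape M)
    (e : toMat g' = toMat g * M) : B g' = B g := by
  have := hB.right g (k := g⁻¹ * g') (mem_Iwahori (by rwa [toMat_inv_mul e]))
  rwa [mul_inv_cancel_left] at this

theorem tor (z : (L a b c)ˣ) (h : GSp4 F) :
    B (levi (torusUnit a b c z) * h) = (Λ z : ℂ) * B h := by
  have e : siegelUnip (0 : Matrix (Fin 2) (Fin 2) F) Matrix.isSymm_zero = 1 := by
    apply toMat_injective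
    change block 1 0 0 1 = 1
    ext i j
    fin_cases i <;> fin_cases j <;> simp [block]
  have := hB.mem.2.2.1 z 0 Matrix.isSymm_zero h
  rw [e, mul_one] at this
  rw [this]
  simp [θ]

theorem unip (x y z : F) (h : GSp4 F) :
    B (symUnip x y z * h) = (ψ (a * x + b * y + c * z) : ℂ) * B h := by
  have e : levi (torusUnit a b c 1) = (1 : GSp4 F) := by
    rw [map_one]
    apply toMat_injective
    rw [toMat_levi, toMat_one]
    ext i j
    fin_cases i <;> fin_cases j <;> simp
  have := hB.mem.2.2.1 1 !![x, y; y, z] (by ext i j; fin_cases i <;> fin_cases j <;> rfl) h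
  rw [e, one_mul] at this
  change B (siegelUnip _ _ * h) = _
  rw [this, θ]
  have e2 : (Smat a b c * !![x, y; y, z]).trace = a * x + b * y + c * z := by
    simp [Smat, Matrix.trace_fin_two]
    ring
  rw [e2]
  simp

/-- The centre of `GSp₄(F)` acts trivially. -/
theorem center {t : F} (ht : t * t - 0 * 0 ≠ 0) (h : GSp4 F) :
    B (levi (gl2 t 0 0 t ht) * h) = B h := by
  have ht0 : t ≠ 0 := by rintro rfl; simp at ht
  have e : gl2 t 0 0 t ht =
      torusUnit a b c (Units.map (algebraMap F (L a b c) : F →* L a b c) (Units.mk0 t ht0)) := by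
    apply Units.ext
    change !![t, 0; 0, t] = torusAlg a b c (algebraMap F (L a b c) t)
    rw [AlgHom.commutes]
    ext i j
    fin_cases i <;> fin_cases j <;> simp [Matrix.algebraMap_matrix_apply]
  rw [e, hB.tor, hB.trivF]
  simp

/-- The vanishing trace over the parahoric subgroup of `s₁`. -/
theorem hecke_s₁ (h : GSp4 F) : B h + ∑ᶠ w : 𝓀[F], B (h * Wmat (rep w) * s₁) = 0 := by
  have := hB.mem.2.2.2.1 (h * s₁)
  rw [mul_assoc, s₁_mul_s₁, mul_one, add_comm] at this
  simpa only [mul_assoc, s₁_mul_upperLevi] using this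

/-- The vanishing trace over the parahoric subgroup of `s₂`. -/
theorem hecke_s₂ (h : GSp4 F) :
    B h + ∑ᶠ x : 𝓀[F], B (h * symUnip (-rep x) 0 0 * s₂) = 0 := by
  have h1 := hB.mem.2.2.2.2.2 (h * s₂)
  have h2 : B (h * s₂ * s₂) = B h := by
    refine hB.right_of_shape (M := !![-1, 0, 0, 0; 0, 1, 0, 0; 0, 0, -1, 0; 0, 0, 0, 1]) ?_ ?_
    · have hz := InP.zero (F := F)
      have h0 := zero_mem 𝒪[F]
      have h1 := one_mem 𝒪[F]
      exact iwahoriShape_of IsIntUnit.one.neg hz h0 h0 h0 h1 h0 h0 hz hz IsIntUnit.one.neg h0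
        hz hz hz h1
    · rw [toMat_mul, toMat_mul, toMat_s₂, mul_assoc, mul_fin_four]
      congr 1
      simp
  rw [h2, add_comm] at h1
  simpa only [mul_assoc, s₂_mul_lowerLong] using h1

theorem atkinLehner (h : GSp4 F) : B (h * η₀ ϖ) = ω * B h := hB.mem.2.2.2.2.1 h

end IsBessel

/-- The value at `(w, ϖ^m)` of the form `c x² + b x y + a y²`. -/
def formValue (ϖ : Fˣ) (a b c : F) (m : ℕ) (w : F) : F :=
  a * (ϖ : F) ^ (2 * m) + b * (ϖ : F) ^ m * w + c * w ^ 2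

/-- The derivative with respect to `x` at `(w, ϖ^m)` of the form `c x² + b x y + a y²`. -/
def formDeriv (ϖ : Fˣ) (b c : F) (m : ℕ) (w : F) : F := b * (ϖ : F) ^ m + 2 * c * w

namespace IsBessel

variable {ϖ : Fˣ} {a b c : F} {ψ : AddChar F Circle} {Λ : (L a b c)ˣ →* ℂˣ} {ω q : ℂ}
  {B : GSp4 F → ℂ} (hB : IsBessel ϖ a b c ψ Λ ω q B)
include hB

/-- The phase of `θ` on the conjugate of `U(F)` by `h(l, m) W_w`. -/
theorem cell_symUnip (m : ℕ) (w : F) (l : ℤ) (x y z : F) (r : GSp4 F) :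
    B (cell ϖ m w l * symUnip x y z * r) =
      (ψ ((ϖ : F) ^ l * (formValue ϖ a b c m w * x + formDeriv ϖ b c m w * y + c * z)) : ℂ) *
        B (cell ϖ m w l * r) := by
  rw [cell, mul_assoc (hElt ϖ l m), Wmat_mul_symUnip, ← mul_assoc, hElt_mul_symUnip, mul_assoc,
    mul_assoc, hB.unip, mul_assoc (hElt ϖ l m)]
  congr 3
  rw [zpow_add₀ ϖ.ne_zero, zpow_natCast, formValue, formDeriv]
  ring

/-- If `r` normalizes a line of unipotent elements into the Iwahori subgroup and the phase is
nontrivial on it, `B` vanishes. -/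
theorem cell_eq_zero {m : ℕ} {w : F} {l : ℤ} {r : GSp4 F} (x y z : F)
    (hr : ∀ t ∈ 𝒪[F], ∃ k ∈ Iwahori F, symUnip (t * x) (t * y) (t * z) * r = r * k)
    (hne : (ϖ : F) ^ l * (formValue ϖ a b c m w * x + formDeriv ϖ b c m w * y + c * z) ∉ 𝒪[F]) :
    B (cell ϖ m w l * r) = 0 := by
  obtain ⟨t, ht, hψ⟩ := exists_char_ne_one hB.cond hne
  obtain ⟨k, hk, e⟩ := hr t ht
  have h1 := hB.cell_symUnip m w l (t * x) (t * y) (t * z) r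
  rw [mul_assoc, e, ← mul_assoc, hB.right _ hk] at h1
  have h2 : (ϖ : F) ^ l * (formValue ϖ a b c m w * (t * x) + formDeriv ϖ b c m w * (t * y) +
      c * (t * z)) =
      (ϖ : F) ^ l * (formValue ϖ a b c m w * x + formDeriv ϖ b c m w * y + c * z) * t := by
    ring
  rw [h2] at h1
  by_contra h0
  apply hψ
  have h3 := mul_right_cancel₀ h0 ((one_mul _).trans h1)
  exact (Circle.ext h3).symm

theorem cell_hecke_s₂ {m : ℕ} {w : F} {l : ℤ} {r : GSp4 F} (x y z : F)
    (hr : ∀ t, r * symUnip t 0 0 = symUnip (t * x) (t * y) (t * z) * r)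
    (hint : (ϖ : F) ^ l * (formValue ϖ a b c m w * x + formDeriv ϖ b c m w * y + c * z) ∈ 𝒪[F]) :
    B (cell ϖ m w l * r) + q * B (cell ϖ m w l * r * s₂) = 0 := by
  have h := hB.hecke_s₂ (cell ϖ m w l * r)
  rw [hB.card, ← finsum_const_residue, ← h]
  congr 1
  apply finsum_congr
  intro v
  symm
  rw [mul_assoc (cell ϖ m w l), hr, mul_assoc, mul_assoc, ← mul_assoc (cell ϖ m w l),
    hB.cell_symUnip]
  have h2 : (ϖ : F) ^ l * (formValue ϖ a b c m w * (-rep v * x) +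
      formDeriv ϖ b c m w * (-rep v * y) + c * (-rep v * z)) =
      (ϖ : F) ^ l * (formValue ϖ a b c m w * x + formDeriv ϖ b c m w * y + c * z) * (-rep v) := by
    ring
  rw [h2, char_eq_one hB.cond (mul_mem hint (neg_mem (rep_int v)))]
  simp [mul_assoc]

theorem cell_hecke_s₁ {m : ℕ} {w : F} {l : ℤ} {r : GSp4 F} (x y z : F)
    (hr : ∀ t, r * Wmat t = symUnip (t * x) (t * y) (t * z) * r)
    (hint : (ϖ : F) ^ l * (formValue ϖ a b c m w * x + formDeriv ϖ b c m w * y + c * z) ∈ 𝒪[F]) :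
    B (cell ϖ m w l * r) + q * B (cell ϖ m w l * r * s₁) = 0 := by
  have h := hB.hecke_s₁ (cell ϖ m w l * r)
  rw [hB.card, ← finsum_const_residue, ← h]
  congr 1
  apply finsum_congr
  intro v
  symm
  rw [mul_assoc (cell ϖ m w l), hr, mul_assoc, mul_assoc, ← mul_assoc (cell ϖ m w l),
    hB.cell_symUnip]
  have h2 : (ϖ : F) ^ l * (formValue ϖ a b c m w * (rep v * x) +
      formDeriv ϖ b c m w * (rep v * y) + c * (rep v * z)) =
      (ϖ : F) ^ l * (formValue ϖ a b c m w * x + formDeriv ϖ b c m w * y + c * z) * (rep v) := by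
    ring
  rw [h2, char_eq_one hB.cond (mul_mem hint (rep_int v))]
  simp [mul_assoc]

end IsBessel

end BesselFunction

/-! ### Recursion relations for the values -/

section Integrality

variable {F : Type*} [Field F] [ValuativeRel F]

theorem formValue_int {ϖ : Fˣ} {a b c : F} (adm : IsAdmissible a b c) (hϖ : IsUniformizer ϖ)
    (m : ℕ) {w : F} (hw : w ∈ 𝒪[F]) : formValue ϖ a b c m w ∈ 𝒪[F] :=
  add_mem (add_mem (mul_mem adm.a_int (pow_mem hϖ.int _))
    (mul_mem (mul_mem adm.b_int (pow_mem hϖ.int _)) hw)) (mul_mem adm.c_unit.int (pow_mem hw 2))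

theorem formDeriv_int {ϖ : Fˣ} {a b c : F} (adm : IsAdmissible a b c) (hϖ : IsUniformizer ϖ)
    (m : ℕ) {w : F} (hw : w ∈ 𝒪[F]) : formDeriv ϖ b c m w ∈ 𝒪[F] :=
  add_mem (mul_mem adm.b_int (pow_mem hϖ.int _))
    (mul_mem (mul_mem (2 : 𝒪[F]).2 adm.c_unit.int) hw)

theorem IsIntUnit.zpow_mul_not_int {ϖ : Fˣ} (hϖ : IsUniformizer ϖ) {x : F} (hx : IsIntUnit x)
    {l : ℤ} (hl : l ≤ -1) : (ϖ : F) ^ l * x ∉ 𝒪[F] := by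
  intro h
  apply hϖ.not_int_zpow hl
  have := mul_mem h hx.inv_int
  rwa [mul_assoc, mul_inv_cancel₀ hx.ne_zero, mul_one] at this

theorem iwahori_symUnip {x y z : F} (hx : x ∈ 𝒪[F]) (hy : y ∈ 𝒪[F]) (hz : z ∈ 𝒪[F]) :
    symUnip x y z ∈ Iwahori F := by
  apply mem_Iwahori
  rw [toMat_symUnip]
  have h0 := zero_mem 𝒪[F]
  have hp := InP.zero (F := F)
  have h1 := IsIntUnit.one (F := F)
  exact iwahoriShape_of h1 hp hx hy h0 h1.int hy hz hp hp h1 h0 hp hp hp h1.int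

theorem iwahori_Wmat {w : F} (hw : w ∈ 𝒪[F]) : Wmat w ∈ Iwahori F := by
  apply mem_Iwahori
  rw [toMat_Wmat]
  have h0 := zero_mem 𝒪[F]
  have hp := InP.zero (F := F)
  have h1 := IsIntUnit.one (F := F)
  exact iwahoriShape_of h1 hp h0 h0 hw h1.int h0 h0 hp hp h1 (neg_mem hw) hp hp hp h1.int

theorem InP.zpow_mul_int [TopologicalSpace F] [IsNonarchimedeanLocalField F] {ϖ : Fˣ}
    (hϖ : IsUniformizer ϖ) {x : F} (hx : InP x) {l : ℤ} (hl : -1 ≤ l) : (ϖ : F) ^ l * x ∈ 𝒪[F] := by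
  obtain ⟨y, hy, rfl⟩ := hx.exists_eq_mul hϖ
  rw [← mul_assoc, ← zpow_add_one₀ ϖ.ne_zero]
  exact mul_mem (hϖ.zpow_int (by omega)) hy

end Integrality

section Recursion

variable {F : Type*} [Field F] [ValuativeRel F] [TopologicalSpace F]
  [IsNonarchimedeanLocalField F] [CharZero F]

namespace IsBessel

variable {ϖ : Fˣ} {a b c : F} {ψ : AddChar F Circle} {Λ : (L a b c)ˣ →* ℂˣ} {ω q : ℂ}
  {B : GSp4 F → ℂ} (hB : IsBessel ϖ a b c ψ Λ ω q B)
include hB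

theorem q_ne_zero : q ≠ 0 := by
  rw [hB.card]; exact card_residue_ne_zero

theorem q_sub_one_ne_zero : q - 1 ≠ 0 := by
  rw [hB.card]; exact card_residue_sub_one_ne_zero

/-- The effect of the Atkin-Lehner element, which is `s₂s₁s₂` up to the centre and a diagonal
element. -/
theorem atkinLehner_s₂s₁s₂ (g : GSp4 F) : B (g * s₂ * s₁ * s₂) = ω * B (g * simil ϖ) := by
  have ht : (ϖ : F) * ϖ - 0 * 0 ≠ 0 := by simp
  rw [← hB.atkinLehner, ← hB.center ht, levi_scalar_mul ht]
  refine hB.right_of_shape (M := !![-1, 0, 0, 0; 0, -1, 0, 0; 0, 0, 1, 0; 0, 0, 0, 1]) ?_ ?_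
  · have h0 := zero_mem 𝒪[F]
    have hp := InP.zero (F := F)
    have h1 := IsIntUnit.one (F := F)
    exact iwahoriShape_of h1.neg hp h0 h0 h0 h1.neg.int h0 h0 hp hp h1 h0 hp hp hp h1.int
  · simp only [toMat_mul, Matrix.mul_assoc]
    congr 1
    simp only [toMat_s₁, toMat_s₂, toMat_simil, toMat_η₀, toMat_levi, coe_gl2, mul_fin_four]
    simp

theorem cell_s₂s₁s₂ (m : ℕ) (w : F) (l : ℤ) :
    B (cell ϖ m w l * s₂ * s₁ * s₂) = ω * B (cell ϖ m w (l + 1)) := by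
  rw [hB.atkinLehner_s₂s₁s₂, cell_mul_simil]

theorem cell_s₁s₂s₁s₂ (m : ℕ) (w : F) (l : ℤ) :
    B (cell ϖ m w l * s₁ * s₂ * s₁ * s₂) = ω * B (cell ϖ m w (l + 1) * s₁) := by
  rw [hB.atkinLehner_s₂s₁s₂, mul_assoc _ s₁, ← simil_mul_s₁, ← mul_assoc, cell_mul_simil]

theorem hElt_s₁s₂ (l : ℤ) (m : ℕ) :
    B (hElt ϖ (l - 1) (m + 1) * s₁ * s₂) = ω * B (hElt ϖ l m * s₂) := by
  rw [← hB.atkinLehner]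
  refine hB.right_of_shape (M := !![-1, 0, 0, 0; 0, 1, 0, 0; 0, 0, 1, 0; 0, 0, 0, -1]) ?_ ?_
  · have h0 := zero_mem 𝒪[F]
    have hp := InP.zero (F := F)
    have h1 := IsIntUnit.one (F := F)
    exact iwahoriShape_of h1.neg hp h0 h0 h0 h1.int h0 h0 hp hp h1 h0 hp hp hp h1.neg.int
  · simp only [toMat_mul, toMat_s₁, toMat_s₂, toMat_hElt, toMat_η₀, mul_fin_four]
    have : l - 1 + ((m + 1 : ℕ) : ℤ) = l + m := by push_cast; ring
    rw [this]
    simp [pow_succ]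
    ring

section

variable {m : ℕ} {w : F} {l : ℤ}

theorem cell_one_eq_zero (hl : l ≤ -1) : B (cell ϖ m w l) = 0 := by
  have := hB.cell_eq_zero (m := m) (w := w) (l := l) (r := 1) 0 0 1
    (fun t ht => ⟨symUnip (t * 0) (t * 0) (t * 1), iwahori_symUnip (by simp)
      (by simp) (by simpa using ht), by simp⟩)
    (by simpa using hB.adm.c_unit.zpow_mul_not_int hB.unif hl)
  rwa [mul_one] at this

theorem cell_s₂_eq_zero (hl : l ≤ -1) : B (cell ϖ m w l * s₂) = 0 := by
  refine hB.cell_eq_zero (r := s₂) 0 0 1 (fun t ht => ⟨symUnip 0 0 t, ?_, ?_⟩)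
    (by simpa using hB.adm.c_unit.zpow_mul_not_int hB.unif hl)
  · exact iwahori_symUnip (zero_mem _) (zero_mem _) ht
  · rw [s₂_mul_symUnip]; simp

theorem cell_s₁_eq_zero (hl : l ≤ -1) : B (cell ϖ m w l * s₁) = 0 := by
  refine hB.cell_eq_zero (r := s₁) 0 0 1 (fun t ht => ⟨symUnip t 0 0, ?_, ?_⟩)
    (by simpa using hB.adm.c_unit.zpow_mul_not_int hB.unif hl)
  · exact iwahori_symUnip ht (zero_mem _) (zero_mem _)
  · rw [s₁_mul_symUnip]; simp

theorem cell_s₂s₁_eq_zero (hl : l ≤ -1) : B (cell ϖ m w l * s₂ * s₁) = 0 := by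
  rw [mul_assoc]
  refine hB.cell_eq_zero (r := s₂ * s₁) 0 0 1 (fun t ht => ⟨symUnip t 0 0, ?_, ?_⟩)
    (by simpa using hB.adm.c_unit.zpow_mul_not_int hB.unif hl)
  · exact iwahori_symUnip ht (zero_mem _) (zero_mem _)
  · rw [mul_assoc s₂, s₁_mul_symUnip, ← mul_assoc s₂, s₂_mul_symUnip]; simp [mul_assoc]

/-- If the derivative of the form is a unit, the phase forces `B(h(l, m) W_w s₁s₂)` to vanish
already for `l = -1`. -/
theorem cell_s₁s₂_eq_zero (hu : IsIntUnit (formDeriv ϖ b c m w)) (hl : l ≤ -1) :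
    B (cell ϖ m w l * s₁ * s₂) = 0 := by
  rw [mul_assoc]
  refine hB.cell_eq_zero (r := s₁ * s₂) 0 1 0 (fun t ht => ⟨Wmat (-t), ?_, ?_⟩)
    (by simpa using hu.zpow_mul_not_int hB.unif hl)
  · exact iwahori_Wmat (neg_mem ht)
  · rw [mul_assoc s₁, s₂_mul_Wmat, ← mul_assoc s₁, s₁_mul_symUnip]; simp [mul_assoc]

theorem cell_hecke_one_s₂ (h : (ϖ : F) ^ l * formValue ϖ a b c m w ∈ 𝒪[F]) :
    B (cell ϖ m w l) + q * B (cell ϖ m w l * s₂) = 0 := by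
  have := hB.cell_hecke_s₂ (m := m) (w := w) (l := l) (r := 1) 1 0 0 (fun t => by simp)
    (by simpa using h)
  rwa [mul_one] at this

theorem cell_hecke_s₂_s₁ (h : (ϖ : F) ^ l * formDeriv ϖ b c m w ∈ 𝒪[F]) :
    B (cell ϖ m w l * s₂) + q * B (cell ϖ m w l * s₂ * s₁) = 0 :=
  hB.cell_hecke_s₁ (r := s₂) 0 (-1) 0 (fun t => by rw [s₂_mul_Wmat]; simp)
    (by simpa using neg_mem h)

theorem cell_hecke_s₂s₁_s₂ (h : (ϖ : F) ^ l ∈ 𝒪[F]) :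
    B (cell ϖ m w l * s₂ * s₁) + q * B (cell ϖ m w l * s₂ * s₁ * s₂) = 0 := by
  have := hB.cell_hecke_s₂ (m := m) (w := w) (l := l) (r := s₂ * s₁) 0 0 1
    (fun t => by rw [mul_assoc, s₁_mul_symUnip, ← mul_assoc, s₂_mul_symUnip]; simp [mul_assoc])
    (by simpa using mul_mem h hB.adm.c_unit.int)
  simpa only [mul_assoc] using this

theorem cell_hecke_s₁_s₂ (h : (ϖ : F) ^ l ∈ 𝒪[F]) :
    B (cell ϖ m w l * s₁) + q * B (cell ϖ m w l * s₁ * s₂) = 0 :=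
  hB.cell_hecke_s₂ (r := s₁) 0 0 1 (fun t => by rw [s₁_mul_symUnip]; simp)
    (by simpa using mul_mem h hB.adm.c_unit.int)

theorem cell_hecke_s₁s₂_s₁ (h : (ϖ : F) ^ l * formDeriv ϖ b c m w ∈ 𝒪[F]) :
    B (cell ϖ m w l * s₁ * s₂) + q * B (cell ϖ m w l * s₁ * s₂ * s₁) = 0 := by
  have := hB.cell_hecke_s₁ (m := m) (w := w) (l := l) (r := s₁ * s₂) 0 (-1) 0
    (fun t => by rw [mul_assoc, s₂_mul_Wmat, ← mul_assoc, s₁_mul_symUnip]; simp [mul_assoc])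
    (by simpa using neg_mem h)
  simpa only [mul_assoc] using this

theorem cell_hecke_s₁s₂s₁_s₂ (h : (ϖ : F) ^ l * formValue ϖ a b c m w ∈ 𝒪[F]) :
    B (cell ϖ m w l * s₁ * s₂ * s₁) + q * B (cell ϖ m w l * s₁ * s₂ * s₁ * s₂) = 0 := by
  have := hB.cell_hecke_s₂ (m := m) (w := w) (l := l) (r := s₁ * s₂ * s₁) 1 0 0
    (fun t => by
      rw [mul_assoc, s₁_mul_symUnip, ← mul_assoc, mul_assoc s₁, s₂_mul_symUnip, ← mul_assoc,
        s₁_mul_symUnip]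
      simp [mul_assoc])
    (by simpa using h)
  simpa only [mul_assoc] using this

end

end IsBessel

end Recursion

/-! ### Consequences of the equivariance under the torus -/

section Torus

variable {F : Type*} [Field F] [ValuativeRel F] [TopologicalSpace F]
  [IsNonarchimedeanLocalField F] [CharZero F]

namespace IsBessel

variable {ϖ : Fˣ} {a b c : F} {ψ : AddChar F Circle} {Λ : (L a b c)ˣ →* ℂˣ} {ω q : ℂ}
  {B : GSp4 F → ℂ} (hB : IsBessel ϖ a b c ψ Λ ω q B)
include hB

/-- The Levi component of the Iwahori subgroup may be moved past the elements of `W⁽¹⁾`. -/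
theorem levi_right {A A' : GL (Fin 2) F} {p r t v : F} (hp : IsIntUnit p) (hr : InP r)
    (ht : t ∈ 𝒪[F]) (hv : IsIntUnit v)
    (e : (A' : Matrix (Fin 2) (Fin 2) F) = A * !![p, r; t, v]) (u : Fˣ) {s : GSp4 F}
    (hs : s ∈ W1) : B (levi A' * simil u * s) = B (levi A * simil u * s) := by
  have hdet : p * v - r * t ≠ 0 := by
    rw [sub_eq_add_neg]
    exact ((hp.mul hv).add_inP (hr.mul_right ht).neg).ne_zero
  have e' : A' = A * gl2 p r t v hdet := Units.ext e
  obtain ⟨k, hk, ek⟩ := exists_iwahori_levi_mul (gl2 p r t v hdet) hp hr ht hv hs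
  rw [e', levi_mul, mul_assoc, mul_assoc, ← mul_assoc (levi (gl2 _ _ _ _ _)), ← simil_mul_levi,
    mul_assoc, ek, ← mul_assoc, ← mul_assoc, hB.right _ hk]

/-- If the torus element `x + y ξ` carries `A` to `A' k`, with `k` lower triangular modulo `𝔭`, it
relates the values at `A` and `A'` by `Λ`. -/
theorem levi_tor {x y : F} (h : nm a b c x y ≠ 0) {A A' : GL (Fin 2) F} {p r t v : F}
    (hp : IsIntUnit p) (hr : InP r) (ht : t ∈ 𝒪[F]) (hv : IsIntUnit v)
    (e : !![x + b * y, c * y; -(a * y), x] * (A : Matrix (Fin 2) (Fin 2) F) =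
      A' * !![p, r; t, v]) (u : Fˣ) {s : GSp4 F} (hs : s ∈ W1) :
    (Λ (linUnit h) : ℂ) * B (levi A * simil u * s) = B (levi A' * simil u * s) := by
  rw [← hB.tor, ← mul_assoc, ← mul_assoc, ← levi_mul]
  exact hB.levi_right hp hr ht hv (by rw [Units.val_mul, torusUnit_linUnit, e]) u hs

theorem simil_right {t : Fˣ} (ht : IsIntUnit (t : F)) (g : GSp4 F) {s : GSp4 F} (hs : s ∈ W1) :
    B (g * simil t * s) = B (g * s) := by
  obtain ⟨k, hk, e⟩ := exists_iwahori_simil_mul t ht hs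
  rw [mul_assoc, e, ← mul_assoc, hB.right _ hk]

theorem cell_s₁_eq_levi (l : ℤ) (m : ℕ) (w : F) {s : GSp4 F} (hs : s ∈ W1) :
    B (cell ϖ m w l * s₁ * s) =
      B (levi (gl2 0 (-(ϖ : F) ^ m) (-1) (-w) (by simp)) * simil (ϖ ^ (l + m)) * s) := by
  rw [cell, hElt_mul_Wmat_mul_s₁, hB.simil_right (by simpa using IsIntUnit.one.neg) _ hs]

/-- The units in `1 + 𝔓^(m+1)` fix the coset of `h(l, m)`. -/
theorem hElt_eq_zero {m : ℕ} (hm : m + 2 ≤ conductorExp Λ) (l : ℤ) : B (hElt ϖ l m) = 0 := by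
  obtain ⟨k, hk⟩ : ∃ k, conductorExp Λ = m + 1 + k + 1 := ⟨conductorExp Λ - m - 2, by omega⟩
  obtain ⟨x, y, h, hx, hy, hne⟩ := exists_linUnit_ne_one hB.adm hB.unif
    (Λ := Λ) (m := m + 1 + k) (by omega)
  have hϖ := hB.unif
  have hP : InP ((ϖ : F) ^ (m + 1 + k)) := hϖ.pow_inP (by omega)
  have hX : IsIntUnit (1 + (ϖ : F) ^ (m + 1 + k) * x) := IsIntUnit.one.add_inP (hP.mul_right hx)
  have hY : InP ((ϖ : F) ^ (m + 1 + k) * y) := hP.mul_right hy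
  have := hB.levi_tor h.ne_zero (A := gl2 ((ϖ : F) ^ m) 0 0 1 (by simp))
    (A' := gl2 ((ϖ : F) ^ m) 0 0 1 (by simp))
    (hX.add_inP (InP.mul_left hB.adm.b_int hY)) (r := c * ((ϖ : F) ^ (k + 1) * y))
    (InP.mul_left hB.adm.c_unit.int ((hϖ.pow_inP (by omega)).mul_right hy))
    (t := -(a * ((ϖ : F) ^ (m + 1 + k) * y)) * ϖ ^ m)
    (mul_mem (neg_mem (mul_mem hB.adm.a_int hY.int)) (pow_mem hϖ.int _)) hX
    (by
      simp only [coe_gl2, Matrix.mul_fin_two]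
      ext i j
      fin_cases i <;> fin_cases j <;> simp <;> ring)
    (ϖ ^ (l + m)) one_mem_W1
  rw [mul_one, ← hElt_eq_levi] at this
  by_contra h0
  apply hne
  have h3 := mul_right_cancel₀ h0 (this.trans (one_mul _).symm)
  exact Units.ext h3

/-- The units in `1 + 𝔓^m` fix the coset of `h(l, m) s₁`. -/
theorem hElt_s₁_eq_zero {m : ℕ} (hm0 : 0 < m) (hm : m + 1 ≤ conductorExp Λ) (l : ℤ) :
    B (hElt ϖ l m * s₁) = 0 := by
  obtain ⟨k, hk⟩ : ∃ k, conductorExp Λ = m + k + 1 := ⟨conductorExp Λ - m - 1, by omega⟩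
  obtain ⟨x, y, h, hx, hy, hne⟩ := exists_linUnit_ne_one hB.adm hB.unif
    (Λ := Λ) (m := m + k) (by omega)
  have hϖ := hB.unif
  have hP : InP ((ϖ : F) ^ (m + k)) := hϖ.pow_inP (by omega)
  have hX : IsIntUnit (1 + (ϖ : F) ^ (m + k) * x) := IsIntUnit.one.add_inP (hP.mul_right hx)
  have hY : InP ((ϖ : F) ^ (m + k) * y) := hP.mul_right hy
  have := hB.levi_tor h.ne_zero (A := gl2 0 (-(ϖ : F) ^ m) (-1) (-0) (by simp))
    (A' := gl2 0 (-(ϖ : F) ^ m) (-1) (-0) (by simp)) hX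
    (r := -(a * ((ϖ : F) ^ (m + k) * y)) * ϖ ^ m)
    ((InP.mul_left hB.adm.a_int hY).neg.mul_right (pow_mem hϖ.int _))
    (t := c * ((ϖ : F) ^ k * y))
    (mul_mem hB.adm.c_unit.int (mul_mem (pow_mem hϖ.int _) hy))
    (hX.add_inP (InP.mul_left hB.adm.b_int hY))
    (by
      simp only [coe_gl2, Matrix.mul_fin_two]
      ext i j
      fin_cases i <;> fin_cases j <;> simp <;> ring)
    (ϖ ^ (l + m)) one_mem_W1
  rw [← hB.cell_s₁_eq_levi l m 0 one_mem_W1, cell_zero, mul_one] at this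
  by_contra h0
  apply hne
  have h3 := mul_right_cancel₀ h0 (this.trans (one_mul _).symm)
  exact Units.ext h3

theorem char_linUnit_eq_one {m : ℕ} (hm : conductorExp Λ ≤ m) {x y : F} (hx : x ∈ 𝒪[F])
    (hy : y ∈ 𝒪[F]) (h : IsIntUnit (nm a b c (1 + (ϖ : F) ^ m * x) (ϖ ^ m * y))) :
    Λ (linUnit h.ne_zero) = 1 := by
  obtain ⟨k, rfl⟩ := Nat.exists_eq_add_of_le hm
  have ht := (trivialAt_iff hB.adm hB.unif Λ _).mp (trivialAt_conductorExp hB.smooth)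
  have e : ∀ x : F, (ϖ : F) ^ (conductorExp Λ + k) * x =
      ϖ ^ conductorExp Λ * (ϖ ^ k * x) := fun x => by rw [pow_add, mul_assoc]
  have h' := h
  simp only [e] at h'
  have := ht (ϖ ^ k * x) (ϖ ^ k * y) h' (mul_mem (pow_mem hB.unif.int _) hx)
    (mul_mem (pow_mem hB.unif.int _) hy)
  rw [← this]
  congr 1
  apply Units.ext
  rw [linUnit_val, linUnit_val, e, e]

/-- For unramified `Λ`. -/
theorem char_unit_eq_one (h0 : conductorExp Λ = 0) {x y : F} (hx : x ∈ 𝒪[F])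
    (hy : y ∈ 𝒪[F]) (h : IsIntUnit (nm a b c x y)) : Λ (linUnit h.ne_zero) = 1 := by
  have e1 : 1 + (ϖ : F) ^ 0 * (x - 1) = x := by simp
  have e2 : (ϖ : F) ^ 0 * y = y := by simp
  have h' := h
  rw [← e1, ← e2] at h'
  have := hB.char_linUnit_eq_one h0.le (sub_mem hx (one_mem _)) hy h'
  rw [← this]
  congr 1
  apply Units.ext
  rw [linUnit_val, linUnit_val, e1, e2]

/-- For `m > 0` the units in `1 + 𝔓^m` permute the cosets of `h(l, m) [1, w; 0, 1]`
transitively. -/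
theorem exists_upperLevi {m : ℕ} (hm : 0 < m) {w : F} (hw : w ∈ 𝒪[F]) :
    ∃ z, (conductorExp Λ ≤ m → Λ z = 1) ∧ ∀ (u : Fˣ), ∀ s ∈ W1,
      (Λ z : ℂ) * B (levi (gl2 ((ϖ : F) ^ m) 0 0 1 (by simp)) * simil u * s) =
        B (levi (gl2 ((ϖ : F) ^ m) ((ϖ : F) ^ m * w) 0 1 (by simp)) * simil u * s) := by
  have hϖ := hB.unif
  have hc := hB.adm.c_unit
  have hP : InP ((ϖ : F) ^ m) := hϖ.pow_inP (by omega)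
  have hy : w / c ∈ 𝒪[F] := by rw [div_eq_mul_inv]; exact mul_mem hw hc.inv_int
  have hY : InP ((ϖ : F) ^ m * (w / c)) := hP.mul_right hy
  have h : IsIntUnit (nm a b c (1 + (ϖ : F) ^ m * 0) (ϖ ^ m * (w / c))) := by
    have : nm a b c (1 + (ϖ : F) ^ m * 0) (ϖ ^ m * (w / c)) =
        1 + ((ϖ : F) ^ m * (w / c)) * (b + a * c * (ϖ ^ m * (w / c))) := by
      simp only [nm]; ring
    rw [this]
    exact IsIntUnit.one.add_inP (hY.mul_right (add_mem hB.adm.b_int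
      (mul_mem (mul_mem hB.adm.a_int hc.int) hY.int)))
  refine ⟨linUnit h.ne_zero, fun hle => hB.char_linUnit_eq_one hle (zero_mem _) hy h, ?_⟩
  intro u s hs
  refine hB.levi_tor h.ne_zero (p := 1 + (ϖ : F) ^ m * (w / c) * (b + a * w * ϖ ^ m)) (r := 0)
    (t := -(a * ((ϖ : F) ^ m * (w / c))) * ϖ ^ m) (v := 1) ?_ InP.zero ?_ IsIntUnit.one ?_ u hs
  · exact IsIntUnit.one.add_inP (hY.mul_right (add_mem hB.adm.b_int
      (mul_mem (mul_mem hB.adm.a_int hw) hP.int)))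
  · exact mul_mem (neg_mem (mul_mem hB.adm.a_int hY.int)) hP.int
  · have := hc.ne_zero
    simp only [coe_gl2, Matrix.mul_fin_two]
    ext i j
    fin_cases i <;> fin_cases j <;> simp <;> field_simp
    ring

theorem hElt_s₁ {m : ℕ} (hm : 0 < m) (hc : conductorExp Λ ≤ m) (l : ℤ) :
    B (hElt ϖ l m * s₁) = -q * B (hElt ϖ l m) := by
  have h := hB.mem.2.2.2.1 (hElt ϖ l m)
  have h2 : ∀ v : 𝓀[F], B (hElt ϖ l m * upperLevi (rep v)) = B (hElt ϖ l m) := by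
    intro v
    obtain ⟨z, hz, hs⟩ := hB.exists_upperLevi hm (rep_int v)
    have := hs (ϖ ^ (l + m)) 1 one_mem_W1
    rw [mul_one (_ * _), mul_one (_ * _), ← hElt_eq_levi, ← hElt_mul_upperLevi, hz hc] at this
    rw [← this]
    simp
  rw [finsum_congr h2, finsum_const_residue, ← hB.card] at h
  linear_combination h

/-- If `w` is a root modulo `𝔭`, all units of `𝔬_L` fix the corresponding line. -/
theorem cell_s₁_mul_eq_zero (h0 : 1 ≤ conductorExp Λ) {w : F} (hw : w ∈ 𝒪[F])
    (hP : InP (formValue ϖ a b c 0 w)) (l : ℤ) {s : GSp4 F} (hs : s ∈ W1) :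
    B (cell ϖ 0 w l * s₁ * s) = 0 := by
  obtain ⟨x, y, h, hx, hy, hne⟩ := exists_linUnit_ne_one hB.adm hB.unif
    (Λ := Λ) (m := 0) (by omega)
  have hc := hB.adm.c_unit
  have hP' : InP (a + b * w + c * w ^ 2) := by simpa [formValue] using hP
  set X := 1 + (ϖ : F) ^ 0 * x with hXdef
  set Y := (ϖ : F) ^ 0 * y with hYdef
  have hX : X ∈ 𝒪[F] := by simpa [hXdef] using add_mem (one_mem _) hx
  have hY : Y ∈ 𝒪[F] := by simpa [hYdef] using hy
  have h1 : X - w * c * Y ∈ 𝒪[F] := sub_mem hX (mul_mem (mul_mem hw hc.int) hY)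
  have h2 : X + b * Y + c * Y * w ∈ 𝒪[F] := add_mem (add_mem hX (mul_mem hB.adm.b_int hY))
    (mul_mem (mul_mem hc.int hY) hw)
  have h3 : IsIntUnit ((X - w * c * Y) * (X + b * Y + c * Y * w)) := by
    have e : (X - w * c * Y) * (X + b * Y + c * Y * w) =
        nm a b c X Y + -(c * Y ^ 2) * (a + b * w + c * w ^ 2) := by
      simp only [nm]; ring
    rw [e]
    exact h.add_inP (InP.mul_left (neg_mem (mul_mem hc.int (pow_mem hY 2))) hP')
  have := hB.levi_tor h.ne_zero (A := gl2 0 (-(ϖ : F) ^ 0) (-1) (-w) (by simp))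
    (A' := gl2 0 (-(ϖ : F) ^ 0) (-1) (-w) (by simp)) (IsIntUnit.of_mul h1 h2 h3)
    (r := -Y * (a + b * w + c * w ^ 2)) (InP.mul_left (neg_mem hY) hP')
    (t := c * Y) (mul_mem hc.int hY)
    (IsIntUnit.of_mul h2 h1 (by rwa [mul_comm]))
    (by
      simp only [coe_gl2, Matrix.mul_fin_two]
      ext i j
      fin_cases i <;> fin_cases j <;> simp <;> ring)
    (ϖ ^ (l + (0 : ℕ))) hs
  rw [← hB.cell_s₁_eq_levi l 0 w hs] at this
  by_contra h0
  apply hne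
  have h3 := mul_right_cancel₀ h0 (this.trans (one_mul _).symm)
  exact Units.ext h3

/-- If `w` is not a root modulo `𝔭`, the torus moves the corresponding line to the standard
one. -/
theorem exists_char_mul_cell {w : F} (hw : w ∈ 𝒪[F]) (hP : ¬ InP (formValue ϖ a b c 0 w)) :
    ∃ z, (conductorExp Λ = 0 → Λ z = 1) ∧ ∀ (l : ℤ), ∀ s ∈ W1,
      (Λ z : ℂ) * B (hElt ϖ l 0 * s) = B (cell ϖ 0 w l * s₁ * s) := by
  have hc := hB.adm.c_unit
  have hu := isIntUnit_of_not_inP (formValue_int hB.adm hB.unif 0 hw) hP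
  have hu' : IsIntUnit (a + b * w + c * w ^ 2) := by simpa [formValue] using hu
  have h : IsIntUnit (nm a b c (w * c) 1) := by
    have : nm a b c (w * c) 1 = c * (a + b * w + c * w ^ 2) := by simp only [nm]; ring
    rw [this]
    exact hc.mul hu'
  refine ⟨linUnit h.ne_zero, fun h0 => hB.char_unit_eq_one h0 (mul_mem hw hc.int)
    (one_mem _) h, ?_⟩
  intro l s hs
  rw [hB.cell_s₁_eq_levi l 0 w hs, hElt_eq_levi]
  refine hB.levi_tor h.ne_zero hu' InP.zero (t := -(w * c + b)) ?_ hc.neg ?_ _ hs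
  · exact neg_mem (add_mem (mul_mem hw hc.int) hB.adm.b_int)
  · simp only [coe_gl2, Matrix.mul_fin_two]
    ext i j
    fin_cases i <;> fin_cases j <;> simp
    ring

theorem cell_s₁_congr {w w' : F} (hw : InP (w - w')) (m : ℕ) (l : ℤ) {s : GSp4 F} (hs : s ∈ W1) :
    B (cell ϖ m w l * s₁ * s) = B (cell ϖ m w' l * s₁ * s) := by
  rw [hB.cell_s₁_eq_levi l m w hs, hB.cell_s₁_eq_levi l m w' hs]
  refine hB.levi_right IsIntUnit.one hw (zero_mem _) IsIntUnit.one ?_ _ hs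
  simp only [coe_gl2, Matrix.mul_fin_two]
  ext i j
  fin_cases i <;> fin_cases j <;> simp
  ring

/-- The Atkin-Lehner element turns `diag(1, ϖ)` into the reflection of `GL₂`. -/
theorem levi_eq_mul_of_s₂ (w : F) (u : Fˣ) {s : GSp4 F} (hs : s = s₂ ∨ s = s₂ * s₁) :
    B (levi (gl2 1 0 w ϖ (by simp)) * simil u * s) =
      ω * B (levi (gl2 0 (-1) (-1) (-w) (by simp)) * simil u * s) := by
  have h0 := zero_mem 𝒪[F]
  have hp := InP.zero (F := F)
  have h1 := IsIntUnit.one (F := F)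
  rw [← hB.atkinLehner]
  refine (hB.right_of_shape
    (M := !![-1, 0, 0, 0; 0, -1, 0, 0; 0, 0, -1, 0; 0, 0, 0, -1]) ?_ ?_).symm
  · exact iwahoriShape_of h1.neg hp h0 h0 h0 h1.neg.int h0 h0 hp hp h1.neg h0 hp hp hp h1.neg.int
  · rcases hs with rfl | rfl <;>
    · simp only [toMat_mul, toMat_s₁, toMat_s₂, toMat_simil, toMat_η₀, toMat_levi, coe_gl2,
        mul_fin_four]
      simp
      ring

theorem cell_zero_s₁_eq_levi (l : ℤ) (w : F) {s : GSp4 F} (hs : s ∈ W1) :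
    B (cell ϖ 0 w l * s₁ * s) =
      B (levi (gl2 0 (-1) (-1) (-w) (by simp)) * simil (ϖ ^ l) * s) := by
  simpa using hB.cell_s₁_eq_levi l 0 w hs

/-- In the ramified case the uniformizer `c w + ξ` of `L` fixes the line of the root `w`. -/
theorem char_mul_cell_of_ramified {w u : F} (hb : InP (b + 2 * c * w)) (hu : IsIntUnit u)
    (hP : a + b * w + c * w ^ 2 = ϖ * u) (h : nm a b c (w * c) 1 ≠ 0) (l : ℤ) {s : GSp4 F}
    (hs : s = s₂ ∨ s = s₂ * s₁) :
    (Λ (linUnit h) : ℂ) * B (cell ϖ 0 w l * s₁ * s) = ω * B (cell ϖ 0 w l * s₁ * s) := by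
  have hs' : s ∈ W1 := by
    rcases hs with rfl | rfl
    exacts [s₂_mem_W1, s₂s₁_mem_W1]
  rw [hB.cell_zero_s₁_eq_levi l w hs', ← hB.levi_eq_mul_of_s₂ w _ hs]
  refine hB.levi_tor h (p := -c) (r := -(b + 2 * c * w)) (t := 0) (v := u)
    hB.adm.c_unit.neg hb.neg (zero_mem _) hu ?_ _ hs'
  simp only [coe_gl2, Matrix.mul_fin_two]
  ext i j
  fin_cases i <;> fin_cases j <;> simp
  · ring
  · linear_combination hP

/-- In the split case the element `(1, ϖ)` of `L` exchanges the lines of the two roots. -/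
theorem char_mul_cell_of_split {δ : F} (hδ : δ ^ 2 = disc a b c) (hd : disc a b c ≠ 0) (l : ℤ)
    {s : GSp4 F} (hs : s = s₂ ∨ s = s₂ * s₁) :
    (Λ (splitUnit hδ hd 1 ϖ) : ℂ) * B (cell ϖ 0 ((-b - δ) / (2 * c)) l * s₁ * s) =
      ω * B (cell ϖ 0 ((-b + δ) / (2 * c)) l * s₁ * s) := by
  have hs' : s ∈ W1 := by
    rcases hs with rfl | rfl
    exacts [s₂_mem_W1, s₂s₁_mem_W1]
  have hc0 := hB.adm.c_unit.ne_zero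
  have hδu : IsIntUnit δ := by
    apply IsIntUnit.of_pow_two
    rw [hδ]
    exact hB.adm.split ⟨δ, by rw [← hδ, pow_two]⟩
  have hδ0 := hδu.ne_zero
  obtain ⟨h, e⟩ := splitUnit_eq_linUnit (ϖ := ϖ) hδ hd
  have hY : IsIntUnit ((1 - (ϖ : F)) / δ) :=
    (by simpa [sub_eq_add_neg] using IsIntUnit.one.add_inP hB.unif.inP.neg : IsIntUnit
      (1 - (ϖ : F))).div hδu
  rw [e, hB.cell_zero_s₁_eq_levi l _ hs', hB.cell_zero_s₁_eq_levi l _ hs',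
    ← hB.levi_eq_mul_of_s₂ _ _ hs]
  refine hB.levi_tor h (p := -(c * ((1 - ϖ) / δ))) (r := -ϖ) (t := -1) (v := δ / c)
    (hB.adm.c_unit.mul hY).neg hB.unif.inP.neg (neg_mem (one_mem _)) (hδu.div hB.adm.c_unit) ?_ _
    hs'
  have ha : a = (b ^ 2 - δ ^ 2) / (4 * c) := by
    rw [hδ, disc]
    field_simp
    ring
  simp only [coe_gl2, Matrix.mul_fin_two]
  ext i j
  fin_cases i <;> fin_cases j <;> simp <;> (try rw [ha]) <;> field_simp <;> ring

end IsBessel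

end Torus

/-! ### The values on the double cosets -/

section Values

variable {F : Type*} [Field F] [ValuativeRel F] [TopologicalSpace F]
  [IsNonarchimedeanLocalField F] [CharZero F]

namespace IsBessel

variable {ϖ : Fˣ} {a b c : F} {ψ : AddChar F Circle} {Λ : (L a b c)ˣ →* ℂˣ} {ω q : ℂ}
  {B : GSp4 F → ℂ} (hB : IsBessel ϖ a b c ψ Λ ω q B)
include hB

section Integral

variable {m : ℕ} {w : F} (hw : w ∈ 𝒪[F]) {l : ℤ}
include hw

theorem zpow_mul_formValue_int (hl : 0 ≤ l) : (ϖ : F) ^ l * formValue ϖ a b c m w ∈ 𝒪[F] :=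
  mul_mem (hB.unif.zpow_int hl) (formValue_int hB.adm hB.unif m hw)

theorem zpow_mul_formDeriv_int (hl : 0 ≤ l) : (ϖ : F) ^ l * formDeriv ϖ b c m w ∈ 𝒪[F] :=
  mul_mem (hB.unif.zpow_int hl) (formDeriv_int hB.adm hB.unif m hw)

theorem cell_s₂ (hl : 0 ≤ l) : B (cell ϖ m w l * s₂) = -(1 / q) * B (cell ϖ m w l) := by
  have h := hB.cell_hecke_one_s₂ (hB.zpow_mul_formValue_int (m := m) hw hl)
  have := hB.q_ne_zero
  field_simp
  linear_combination h

theorem cell_s₂s₁ (hl : 0 ≤ l) : B (cell ϖ m w l * s₂ * s₁) = 1 / q ^ 2 * B (cell ϖ m w l) := by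
  have h := hB.cell_hecke_s₂_s₁ (hB.zpow_mul_formDeriv_int (m := m) hw hl)
  rw [hB.cell_s₂ hw hl] at h
  have := hB.q_ne_zero
  field_simp
  field_simp at h
  linear_combination h

/-- The recursion in `l`. -/
theorem cell_succ (hl : 0 ≤ l) :
    B (cell ϖ m w (l + 1)) = -ω * q ^ (-3 : ℤ) * B (cell ϖ m w l) := by
  have h := hB.cell_hecke_s₂s₁_s₂ (m := m) (w := w) (hB.unif.zpow_int hl)
  rw [hB.cell_s₂s₁ hw hl, hB.cell_s₂s₁s₂] at h
  have := hB.q_ne_zero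
  rw [zpow_neg]
  norm_cast
  field_simp
  field_simp at h
  linear_combination ω * h - B (cell ϖ m w (l + 1)) * q ^ 3 * hB.sq

omit hw in
theorem cell_s₁s₂ (hl : 0 ≤ l) :
    B (cell ϖ m w l * s₁ * s₂) = -(1 / q) * B (cell ϖ m w l * s₁) := by
  have h := hB.cell_hecke_s₁_s₂ (m := m) (w := w) (hB.unif.zpow_int hl)
  have := hB.q_ne_zero
  field_simp
  linear_combination h

theorem cell_s₁_succ (hl : 0 ≤ l) :
    B (cell ϖ m w (l + 1) * s₁) = -ω * q ^ (-3 : ℤ) * B (cell ϖ m w l * s₁) := by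
  have h := hB.cell_hecke_s₁s₂s₁_s₂ (hB.zpow_mul_formValue_int (m := m) hw hl)
  have h' := hB.cell_hecke_s₁s₂_s₁ (hB.zpow_mul_formDeriv_int (m := m) hw hl)
  rw [hB.cell_s₁s₂s₁s₂] at h
  rw [hB.cell_s₁s₂ hl] at h'
  have := hB.q_ne_zero
  rw [zpow_neg]
  norm_cast
  field_simp
  field_simp at h'
  linear_combination ω * q ^ 2 * h - ω * h' - B (cell ϖ m w (l + 1) * s₁) * q ^ 3 * hB.sq

end Integral

omit hB in
theorem eq_zpow_mul_of_succ {f : ℤ → ℂ} {r : ℂ} (hr : r ≠ 0)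
    (h : ∀ l : ℤ, 0 ≤ l → f (l + 1) = r * f l) {l : ℤ} (hl : 0 ≤ l) : f l = r ^ l * f 0 := by
  induction l, hl using Int.leInduction with
  | base => simp
  | succ n hn ih => rw [h n hn, ih, zpow_add_one₀ hr]; ring

theorem ratio_ne_zero : -ω * q ^ (-3 : ℤ) ≠ 0 := by
  have h1 : ω ≠ 0 := by
    rintro h; have := hB.sq; rw [h] at this; simp at this
  exact mul_ne_zero (neg_ne_zero.mpr h1) (zpow_ne_zero _ hB.q_ne_zero)

theorem cell_eq_zpow_mul (m : ℕ) {w : F} (hw : w ∈ 𝒪[F]) {l : ℤ} (hl : 0 ≤ l) :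
    B (cell ϖ m w l) = (-ω * q ^ (-3 : ℤ)) ^ l * B (cell ϖ m w 0) :=
  eq_zpow_mul_of_succ (f := fun l => B (cell ϖ m w l)) hB.ratio_ne_zero
    (fun _ h => hB.cell_succ hw h) hl

theorem cell_s₁_eq_zpow_mul (m : ℕ) {w : F} (hw : w ∈ 𝒪[F]) {l : ℤ} (hl : 0 ≤ l) :
    B (cell ϖ m w l * s₁) = (-ω * q ^ (-3 : ℤ)) ^ l * B (cell ϖ m w 0 * s₁) :=
  eq_zpow_mul_of_succ (f := fun l => B (cell ϖ m w l * s₁)) hB.ratio_ne_zero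
    (fun _ h => hB.cell_s₁_succ hw h) hl

section Small

variable {m : ℕ} {w : F} {l : ℤ}

theorem cell_s₁s₂s₁ (hA : (ϖ : F) ^ l * formValue ϖ a b c m w ∈ 𝒪[F]) :
    B (cell ϖ m w l * s₁ * s₂ * s₁) = -ω * q * B (cell ϖ m w (l + 1) * s₁) := by
  have h := hB.cell_hecke_s₁s₂s₁_s₂ hA
  rw [hB.cell_s₁s₂s₁s₂] at h
  linear_combination h

theorem cell_s₁s₂_of_inP (hA : InP (formValue ϖ a b c m w)) (hβ : InP (formDeriv ϖ b c m w))
    (hl : -1 ≤ l) :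
    B (cell ϖ m w l * s₁ * s₂) = ω * q ^ 2 * B (cell ϖ m w (l + 1) * s₁) := by
  have h := hB.cell_hecke_s₁s₂_s₁ (m := m) (w := w) (l := l) (hβ.zpow_mul_int hB.unif hl)
  rw [hB.cell_s₁s₂s₁ (hA.zpow_mul_int hB.unif hl)] at h
  linear_combination h

theorem zpow_mul_uniformizer_not_int (hl : l ≤ -2) : (ϖ : F) ^ l * (c * ϖ) ∉ 𝒪[F] := by
  have e : (ϖ : F) ^ l * (c * ϖ) = ϖ ^ (l + 1) * c := by
    rw [zpow_add_one₀ ϖ.ne_zero]; ring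
  rw [e]
  exact hB.adm.c_unit.zpow_mul_not_int hB.unif (by omega)

theorem cell_s₁s₂_eq_zero_of_le (hl : l ≤ -2) : B (cell ϖ m w l * s₁ * s₂) = 0 := by
  rw [mul_assoc]
  refine hB.cell_eq_zero (r := s₁ * s₂) 0 0 ϖ (fun t ht => ?_)
    (by simpa using hB.zpow_mul_uniformizer_not_int hl)
  have hp := InP.zero (F := F)
  have h0 := zero_mem 𝒪[F]
  have h1 := IsIntUnit.one (F := F)
  have e : toMat (symUnip (t * 0) (t * 0) (t * ϖ) * (s₁ * s₂)) = toMat (s₁ * s₂) *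
      !![1, 0, 0, 0; 0, 1, 0, 0; -(t * ϖ), 0, 1, 0; 0, 0, 0, 1] := by
    simp only [toMat_mul, toMat_s₁, toMat_s₂, toMat_symUnip, mul_fin_four]
    simp
  refine ⟨(s₁ * s₂)⁻¹ * (symUnip (t * 0) (t * 0) (t * ϖ) * (s₁ * s₂)), mem_Iwahori ?_, by group⟩
  rw [toMat_inv_mul e]
  exact iwahoriShape_of h1 hp h0 h0 h0 h1.int h0 h0 (InP.mul_left ht hB.unif.inP).neg hp h1 h0
    hp hp hp h1.int

theorem cell_s₁s₂s₁_eq_zero_of_le (hl : l ≤ -2) : B (cell ϖ m w l * s₁ * s₂ * s₁) = 0 := by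
  rw [mul_assoc, mul_assoc]
  refine hB.cell_eq_zero (r := s₁ * (s₂ * s₁)) 0 0 ϖ (fun t ht => ?_)
    (by simpa using hB.zpow_mul_uniformizer_not_int hl)
  have hp := InP.zero (F := F)
  have h0 := zero_mem 𝒪[F]
  have h1 := IsIntUnit.one (F := F)
  have e : toMat (symUnip (t * 0) (t * 0) (t * ϖ) * (s₁ * (s₂ * s₁))) =
      toMat (s₁ * (s₂ * s₁)) *
      !![1, 0, 0, 0; 0, 1, 0, 0; 0, 0, 1, 0; 0, -(t * ϖ), 0, 1] := by
    simp only [toMat_mul, toMat_s₁, toMat_s₂, toMat_symUnip, mul_fin_four]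
    simp
  refine ⟨(s₁ * (s₂ * s₁))⁻¹ * (symUnip (t * 0) (t * 0) (t * ϖ) * (s₁ * (s₂ * s₁))),
    mem_Iwahori ?_, by group⟩
  rw [toMat_inv_mul e]
  exact iwahoriShape_of h1 hp h0 h0 h0 h1.int h0 h0 hp hp h1 h0 hp
    (InP.mul_left ht hB.unif.inP).neg hp h1.int

end Small

theorem formValue_zero_inP {m : ℕ} (hm : 0 < m) : InP (formValue ϖ a b c m 0) := by
  have : formValue ϖ a b c m 0 = a * (ϖ : F) ^ (2 * m) := by simp [formValue]
  rw [this]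
  exact InP.mul_left hB.adm.a_int (hB.unif.pow_inP (by omega))

theorem formDeriv_zero_inP {m : ℕ} (hm : 0 < m) : InP (formDeriv ϖ b c m 0) := by
  have : formDeriv ϖ b c m 0 = b * (ϖ : F) ^ m := by simp [formDeriv]
  rw [this]
  exact InP.mul_left hB.adm.b_int (hB.unif.pow_inP (by omega))

/-- The recursion in `m`. -/
theorem hElt_zero_succ {m : ℕ} (hm : conductorExp Λ ≤ m + 1) :
    B (hElt ϖ 0 (m + 1)) = q ^ (-4 : ℤ) * B (hElt ϖ 0 m) := by
  have h1 := hB.hElt_s₁s₂ 0 m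
  have h2 := hB.cell_s₁s₂_of_inP (m := m + 1) (w := 0) (l := -1)
    (hB.formValue_zero_inP m.succ_pos) (hB.formDeriv_zero_inP m.succ_pos) le_rfl
  have h3 := hB.cell_s₂ (m := m) (zero_mem _) (le_refl 0)
  rw [cell_zero] at h3
  rw [cell_zero, cell_zero, neg_add_cancel, hB.hElt_s₁ m.succ_pos hm] at h2
  rw [zero_sub, h2, h3] at h1
  have := hB.q_ne_zero
  rw [zpow_neg]
  norm_cast
  field_simp
  field_simp at h1
  linear_combination -ω * h1 + (B (hElt ϖ 0 m) - B (hElt ϖ 0 (m + 1)) * q ^ 4) * hB.sq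

theorem hElt_zero_add {n : ℕ} (hn : conductorExp Λ ≤ n + 1) (k : ℕ) :
    B (hElt ϖ 0 (n + k)) = q ^ (-4 * (k : ℤ)) * B (hElt ϖ 0 n) := by
  induction k with
  | zero => simp
  | succ k ih =>
    rw [← add_assoc, hB.hElt_zero_succ (by omega), ih, ← mul_assoc, ← zpow_add₀ hB.q_ne_zero]
    congr 2
    push_cast
    ring

theorem hElt_eq {l : ℤ} (hl : 0 ≤ l) {m : ℕ} (hm : conductorExp Λ ≤ m + 1) :
    B (hElt ϖ l m) = coefA q ω (conductorExp Λ) l m * constC ϖ (conductorExp Λ) B := by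
  have h1 := hB.cell_eq_zpow_mul m (zero_mem 𝒪[F]) hl
  rw [cell_zero, cell_zero] at h1
  rw [h1, coefA, constC]
  split_ifs with h0
  · obtain ⟨k, rfl⟩ : ∃ k, m = conductorExp Λ - 1 + k := ⟨m - (conductorExp Λ - 1), by omega⟩
    rw [hB.hElt_zero_add (by omega)]
    have e : ((conductorExp Λ - 1 + k : ℕ) : ℤ) - (conductorExp Λ : ℤ) + 1 = k := by omega
    rw [e]
    ring
  · have h2 := hB.hElt_zero_add (n := 0) (by omega) m
    rw [zero_add, hElt_zero_zero] at h2
    rw [h2]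
    ring

/-- The values at `h(l, m) s` for `s ∈ W⁽¹⁾`. -/
theorem values_hElt (l : ℤ) (m : ℕ) :
    B (hElt ϖ l m) =
      (if l ≤ -1 ∨ (m : ℤ) ≤ (conductorExp Λ : ℤ) - 2 then 0
        else coefA q ω (conductorExp Λ) l m * constC ϖ (conductorExp Λ) B) ∧
    B (hElt ϖ l m * s₂) =
      (if l ≤ -1 ∨ (m : ℤ) ≤ (conductorExp Λ : ℤ) - 2 then 0
        else -(1 / q) * coefA q ω (conductorExp Λ) l m * constC ϖ (conductorExp Λ) B) ∧
    B (hElt ϖ l m * s₂ * s₁) =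
      (if l ≤ -1 ∨ (m : ℤ) ≤ (conductorExp Λ : ℤ) - 2 then 0
        else 1 / q ^ 2 * coefA q ω (conductorExp Λ) l m * constC ϖ (conductorExp Λ) B) ∧
    B (hElt ϖ l m * s₂ * s₁ * s₂) =
      (if l ≤ -2 ∨ (m : ℤ) ≤ (conductorExp Λ : ℤ) - 2 then 0
        else if l = -1 then ω * coefA q ω (conductorExp Λ) 0 m * constC ϖ (conductorExp Λ) B
        else -(1 / q ^ 3) * coefA q ω (conductorExp Λ) l m * constC ϖ (conductorExp Λ) B) := by
  have hneg : ∀ l : ℤ, l ≤ -1 → B (hElt ϖ l m) = 0 := fun l hl => by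
    have := hB.cell_one_eq_zero (m := m) (w := 0) hl
    rwa [cell_zero] at this
  have hsmall : (m : ℤ) ≤ (conductorExp Λ : ℤ) - 2 → ∀ l : ℤ, B (hElt ϖ l m) = 0 :=
    fun h l => hB.hElt_eq_zero (by omega) l
  have h1 := hB.cell_s₂ (m := m) (l := l) (zero_mem 𝒪[F])
  have h2 := hB.cell_s₂s₁ (m := m) (l := l) (zero_mem 𝒪[F])
  have h3 := hB.cell_s₂s₁s₂ m 0 l
  have h1' := hB.cell_s₂_eq_zero (m := m) (w := 0) (l := l)
  have h2' := hB.cell_s₂s₁_eq_zero (m := m) (w := 0) (l := l)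
  have h4 := hB.cell_succ (m := m) (l := l) (zero_mem 𝒪[F])
  simp only [cell_zero] at h1 h2 h3 h4 h1' h2'
  refine ⟨?_, ?_, ?_, ?_⟩
  · split_ifs with h
    · rcases h with h | h
      exacts [hneg l h, hsmall h l]
    · exact hB.hElt_eq (by omega) (by omega)
  · split_ifs with h
    · by_cases hl : l ≤ -1
      · exact h1' hl
      · rw [h1 (by omega), hsmall (by omega) l, mul_zero]
    · rw [h1 (by omega), hB.hElt_eq (by omega) (by omega), mul_assoc]
  · split_ifs with h
    · by_cases hl : l ≤ -1
      · exact h2' hl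
      · rw [h2 (by omega), hsmall (by omega) l, mul_zero]
    · rw [h2 (by omega), hB.hElt_eq (by omega) (by omega), mul_assoc]
  · rw [h3]
    split_ifs with h h'
    · rcases h with h | h
      · rw [hneg _ (by omega), mul_zero]
      · rw [hsmall h, mul_zero]
    · subst h'
      rw [neg_add_cancel, hB.hElt_eq le_rfl (by omega), mul_assoc]
    · rw [h4 (by omega), hB.hElt_eq (l := l) (by omega) (by omega)]
      rw [zpow_neg]
      norm_cast
      linear_combination (-(1 / q ^ 3) * coefA q ω (conductorExp Λ) l m *
        constC ϖ (conductorExp Λ) B) * hB.sq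

/-- The values at `h(l, m) s₁ s` for `s ∈ W⁽¹⁾` and `m > 0`. -/
theorem values_hElt_s₁ (l : ℤ) (m : ℕ) (hm : 0 < m) :
    B (hElt ϖ l m * s₁) =
      (if l ≤ -1 ∨ (m : ℤ) ≤ (conductorExp Λ : ℤ) - 1 then 0
        else -q * coefA q ω (conductorExp Λ) l m * constC ϖ (conductorExp Λ) B) ∧
    B (hElt ϖ l m * s₁ * s₂) =
      (if l ≤ -2 ∨ (m : ℤ) ≤ (conductorExp Λ : ℤ) - 1 then 0
        else if l = -1 then
          -ω * q ^ 3 * coefA q ω (conductorExp Λ) 0 m * constC ϖ (conductorExp Λ) B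
        else coefA q ω (conductorExp Λ) l m * constC ϖ (conductorExp Λ) B) ∧
    B (hElt ϖ l m * s₁ * s₂ * s₁) =
      (if l ≤ -2 ∨ (m : ℤ) ≤ (conductorExp Λ : ℤ) - 1 then 0
        else if l = -1 then
          ω * q ^ 2 * coefA q ω (conductorExp Λ) 0 m * constC ϖ (conductorExp Λ) B
        else -(1 / q) * coefA q ω (conductorExp Λ) l m * constC ϖ (conductorExp Λ) B) ∧
    B (hElt ϖ l m * s₁ * s₂ * s₁ * s₂) =
      (if l ≤ -2 ∨ (m : ℤ) ≤ (conductorExp Λ : ℤ) - 1 then 0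
        else if l = -1 then
          -ω * q * coefA q ω (conductorExp Λ) 0 m * constC ϖ (conductorExp Λ) B
        else 1 / q ^ 2 * coefA q ω (conductorExp Λ) l m * constC ϖ (conductorExp Λ) B) := by
  have hq := hB.q_ne_zero
  have hA := hB.formValue_zero_inP hm
  have hβ := hB.formDeriv_zero_inP hm
  have hneg : ∀ l : ℤ, l ≤ -1 → B (hElt ϖ l m * s₁) = 0 := fun l hl => by
    have := hB.cell_s₁_eq_zero (m := m) (w := 0) hl
    rwa [cell_zero] at this
  have hsmall : (m : ℤ) ≤ (conductorExp Λ : ℤ) - 1 → ∀ l : ℤ, B (hElt ϖ l m * s₁) = 0 :=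
    fun h l => hB.hElt_s₁_eq_zero hm (by omega) l
  have hval : ∀ l : ℤ, 0 ≤ l → ¬ (m : ℤ) ≤ (conductorExp Λ : ℤ) - 1 → B (hElt ϖ l m * s₁) =
      -q * (coefA q ω (conductorExp Λ) l m * constC ϖ (conductorExp Λ) B) := fun l hl h => by
    rw [hB.hElt_s₁ hm (by omega), hB.hElt_eq hl (by omega)]
  have h1 := hB.cell_s₁s₂_of_inP (l := l) hA hβ
  have h2 : -1 ≤ l → _ := fun hl => hB.cell_s₁s₂s₁ (l := l) (hA.zpow_mul_int hB.unif hl)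
  have h3 := hB.cell_s₁s₂s₁s₂ m 0 l
  have h4 := hB.cell_s₁_succ (m := m) (l := l) (zero_mem 𝒪[F])
  have h1' := hB.cell_s₁s₂_eq_zero_of_le (m := m) (w := 0) (l := l)
  have h2' := hB.cell_s₁s₂s₁_eq_zero_of_le (m := m) (w := 0) (l := l)
  simp only [cell_zero] at h1 h2 h3 h4 h1' h2'
  rw [zpow_neg] at h4
  norm_cast at h4
  refine ⟨?_, ?_, ?_, ?_⟩
  · split_ifs with h
    · rcases h with h | h
      exacts [hneg l h, hsmall h l]
    · rw [hval l (by omega) (by omega)]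
      ring
  · split_ifs with h h'
    · by_cases hl : l ≤ -2
      · exact h1' hl
      · rw [h1 (by omega), hsmall (by omega), mul_zero]
    · rw [h1 (by omega), h', neg_add_cancel, hval 0 le_rfl (by omega)]
      ring
    · rw [h1 (by omega), h4 (by omega), hval l (by omega) (by omega)]
      field_simp
      linear_combination (coefA q ω (conductorExp Λ) l m * constC ϖ (conductorExp Λ) B) * hB.sq
  · split_ifs with h h'
    · by_cases hl : l ≤ -2
      · exact h2' hl
      · rw [h2 (by omega), hsmall (by omega), mul_zero]
    · rw [h2 (by omega), h', neg_add_cancel, hval 0 le_rfl (by omega)]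
      ring
    · rw [h2 (by omega), h4 (by omega), hval l (by omega) (by omega)]
      field_simp
      linear_combination -(coefA q ω (conductorExp Λ) l m * constC ϖ (conductorExp Λ) B) * hB.sq
  · rw [h3]
    split_ifs with h h'
    · rcases h with h | h
      · rw [hneg _ (by omega), mul_zero]
      · rw [hsmall h, mul_zero]
    · rw [h', neg_add_cancel, hval 0 le_rfl (by omega)]
      ring
    · rw [h4 (by omega), hval l (by omega) (by omega)]
      field_simp
      linear_combination (coefA q ω (conductorExp Λ) l m * constC ϖ (conductorExp Λ) B) * hB.sq

end IsBessel

end Values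

/-! ### The values on the remaining cosets with `m = 0` -/

section Roots

variable {F : Type*} [Field F]

theorem formValue_zero (ϖ : Fˣ) (a b c w : F) :
    formValue ϖ a b c 0 w = a + b * w + c * w ^ 2 := by simp [formValue]

theorem formDeriv_zero (ϖ : Fˣ) (b c w : F) : formDeriv ϖ b c 0 w = b + 2 * c * w := by
  simp [formDeriv]

theorem coefA_zero_zero (q ω : ℂ) (l : ℤ) : coefA q ω 0 l 0 = (-ω * q ^ (-3 : ℤ)) ^ l := by
  simp [coefA]

theorem cell_zero_zero (ϖ : Fˣ) (w : F) : cell ϖ 0 w 0 = Wmat w := by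
  rw [cell, hElt_zero_zero, one_mul]

theorem constC_zero_eq (ϖ : Fˣ) (B : GSp4 F → ℂ) : constC ϖ 0 B = B (hElt ϖ 0 0) := by
  simp [constC, hElt_zero_zero]

variable [ValuativeRel F]

/-- A root of `c x² + b x + a` is integral. -/
theorem int_of_root {a b c w : F} (adm : IsAdmissible a b c) (h : a + b * w + c * w ^ 2 = 0) :
    w ∈ 𝒪[F] := by
  by_contra hw
  have hw' : 1 < valuation F w := not_le.mp hw
  have hw0 : w ≠ 0 := by rintro rfl; exact hw (zero_mem _)
  have hi : InP w⁻¹ := by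
    rw [InP, map_inv₀]
    exact inv_lt_one_of_one_lt₀ hw'
  apply adm.c_unit.not_inP
  have : c = (-b - a * w⁻¹) * w⁻¹ := by
    field_simp
    linear_combination h
  rw [this]
  exact InP.mul_left (sub_mem (neg_mem adm.b_int) (mul_mem adm.a_int hi.int)) hi

theorem inP_disc_of_legendre {a b c : F} (h : legendre a b c = 0) : InP (disc a b c) := by
  by_contra hd
  rw [legendre, if_neg hd] at h
  split_ifs at h
  norm_num at h

/-- `w` is a root of `c x² + b x + a` that stays simple modulo `𝔭`. -/
def IsSimpleRoot (a b c w : F) : Prop := a + b * w + c * w ^ 2 = 0 ∧ IsIntUnit (b + 2 * c * w)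

variable [CharZero F]

theorem isSimpleRoot_add {a b c δ : F} (adm : IsAdmissible a b c) (hδ : δ ^ 2 = disc a b c) :
    IsSimpleRoot a b c ((-b + δ) / (2 * c)) := by
  have hc := adm.c_unit.ne_zero
  constructor
  · rw [disc] at hδ
    field_simp
    linear_combination hδ
  · have e : b + 2 * c * ((-b + δ) / (2 * c)) = δ := by
      field_simp
      ring
    rw [e]
    apply IsIntUnit.of_pow_two
    rw [hδ]
    exact adm.split ⟨δ, by rw [← hδ, pow_two]⟩

theorem isSimpleRoot_sub {a b c δ : F} (adm : IsAdmissible a b c) (hδ : δ ^ 2 = disc a b c) :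
    IsSimpleRoot a b c ((-b - δ) / (2 * c)) := by
  rw [sub_eq_add_neg]
  exact isSimpleRoot_add adm (by rw [neg_sq, hδ])

/-- The two roots in the split case. -/
theorem IsSimpleRoot.eq_or {a b c w δ : F} (adm : IsAdmissible a b c) (hδ : δ ^ 2 = disc a b c)
    (h : IsSimpleRoot a b c w) : w = (-b + δ) / (2 * c) ∨ w = (-b - δ) / (2 * c) := by
  have hc := adm.c_unit.ne_zero
  have h2 : (2 * c * w + b - δ) * (2 * c * w + b + δ) = 0 := by
    rw [disc] at hδ
    linear_combination 4 * c * h.1 - hδ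
  rcases mul_eq_zero.mp h2 with h3 | h3
  · left
    field_simp
    linear_combination h3
  · right
    field_simp
    linear_combination h3

/-- In the split case every root modulo `𝔭` lifts to a root. -/
theorem exists_simpleRoot {a b c w : F} (adm : IsAdmissible a b c) (hs : IsSquare (disc a b c))
    (hw : w ∈ 𝒪[F]) (hP : InP (a + b * w + c * w ^ 2)) :
    ∃ w', IsSimpleRoot a b c w' ∧ InP (w - w') := by
  obtain ⟨δ, hδ⟩ := hs
  have hδ' : δ ^ 2 = disc a b c := by rw [pow_two, hδ]
  have hc := adm.c_unit.ne_zero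
  have hp := isSimpleRoot_add adm hδ'
  have e : a + b * w + c * w ^ 2 =
      c * ((w - (-b + δ) / (2 * c)) * (w - (-b - δ) / (2 * c))) := by
    rw [disc] at hδ'
    field_simp
    linear_combination hδ'
  rw [e] at hP
  by_cases h : InP (w - (-b + δ) / (2 * c))
  · exact ⟨_, hp, h⟩
  · exact ⟨_, isSimpleRoot_sub adm hδ', (hP.of_mul_unit adm.c_unit).of_mul_unit
      (isIntUnit_of_not_inP (sub_mem hw (int_of_root adm hp.1)) h)⟩

end Roots

section RootValues

variable {F : Type*} [Field F] [ValuativeRel F] [TopologicalSpace F]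
  [IsNonarchimedeanLocalField F] [CharZero F]

omit [CharZero F] in
/-- In the inert case `c x² + b x + a` has no root modulo `𝔭`. -/
theorem not_inP_of_legendre {a b c w : F} (adm : IsAdmissible a b c) (h : legendre a b c = -1)
    (hw : w ∈ 𝒪[F]) : ¬ InP (a + b * w + c * w ^ 2) := by
  rw [legendre] at h
  split_ifs at h with h1 h2
  intro hP
  exact h1 (exists_root_of_inP adm.a_int adm.b_int adm.c_unit
    (isIntUnit_of_not_inP adm.disc_int h2) hw hP)

namespace IsBessel

variable {ϖ : Fˣ} {a b c : F} {ψ : AddChar F Circle} {Λ : (L a b c)ˣ →* ℂˣ} {ω q : ℂ}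
  {B : GSp4 F → ℂ} (hB : IsBessel ϖ a b c ψ Λ ω q B)
include hB

/-- The first Hecke relation at `h(l, 0)`, sorted by the roots modulo `𝔭`. -/
theorem sum_roots (h0 : conductorExp Λ = 0) (l : ℤ) (S : Finset 𝓀[F])
    (hS : ∀ v, v ∈ S ↔ InP (a + b * rep v + c * rep v ^ 2)) :
    (1 + q - S.card) * B (hElt ϖ l 0) + ∑ v ∈ S, B (cell ϖ 0 (rep v) l * s₁) = 0 := by
  classical
  have := Fintype.ofFinite 𝓀[F]
  have h := hB.hecke_s₁ (hElt ϖ l 0)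
  have hcompl : ∀ v ∈ Sᶜ, B (cell ϖ 0 (rep v) l * s₁) = B (hElt ϖ l 0) := by
    intro v hv
    rw [Finset.mem_compl, hS] at hv
    obtain ⟨z, hz, hs⟩ := hB.exists_char_mul_cell (rep_int v) (by rwa [formValue_zero])
    have := hs l 1 one_mem_W1
    rw [hz h0, mul_one, mul_one] at this
    rw [← this]
    simp
  have hcard : ((Sᶜ.card : ℕ) : ℂ) = q - S.card := by
    rw [hB.card, Nat.card_eq_fintype_card, Finset.card_compl, Nat.cast_sub (Finset.card_le_univ S)]
  rw [finsum_eq_sum_of_fintype] at h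
  change _ + ∑ v, B (cell ϖ 0 (rep v) l * s₁) = 0 at h
  rw [← Finset.sum_add_sum_compl S, Finset.sum_congr rfl hcompl, Finset.sum_const,
    nsmul_eq_mul, hcard] at h
  linear_combination h

/-- If `c x² + b x + a` has no root modulo `𝔭`, an unramified `Λ` admits no nonzero value at
`h(l, 0)`. -/
theorem hElt_eq_zero_of_no_root (h0 : conductorExp Λ = 0)
    (hP : ∀ w ∈ 𝒪[F], ¬ InP (a + b * w + c * w ^ 2)) (l : ℤ) : B (hElt ϖ l 0) = 0 := by
  have h := hB.sum_roots h0 l ∅ (fun v => by simpa using hP _ (rep_int v))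
  simp only [Finset.card_empty, Finset.sum_empty, add_zero, Nat.cast_zero, sub_zero] at h
  refine (mul_eq_zero.mp h).resolve_left ?_
  rw [hB.card]
  norm_cast
  omega

/-- In the ramified case there is one root modulo `𝔭`. -/
theorem cell_s₁_of_ramified (h0 : conductorExp Λ = 0) {w : F} (hw : w ∈ 𝒪[F])
    (hP : InP (a + b * w + c * w ^ 2)) (hb : InP (b + 2 * c * w)) (l : ℤ) :
    B (cell ϖ 0 w l * s₁) = -q * B (hElt ϖ l 0) := by
  obtain ⟨v₀, hv₀⟩ := exists_rep_sub_inP hw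
  have taylor : ∀ v : F, a + b * v + c * v ^ 2 =
      (a + b * w + c * w ^ 2 + (b + 2 * c * w) * (v - w)) + c * (v - w) ^ 2 := fun v => by ring
  have h := hB.sum_roots h0 l {v₀} (fun v => by
    rw [Finset.mem_singleton, taylor]
    have h1 : InP (a + b * w + c * w ^ 2 + (b + 2 * c * w) * (rep v - w)) :=
      hP.add (hb.mul_right (sub_mem (rep_int v) hw))
    constructor
    · rintro rfl
      exact h1.add (InP.mul_left hB.adm.c_unit.int (by rw [pow_two]; exact hv₀.mul_right hv₀.int))
    · intro h2
      have h3 := h2.sub h1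
      rw [add_sub_cancel_left] at h3
      have h4 := ((h3.of_mul_unit hB.adm.c_unit).of_pow_two).sub hv₀
      rw [sub_sub_sub_cancel_right] at h4
      exact rep_inj h4)
  rw [Finset.card_singleton, Finset.sum_singleton] at h
  have h5 := hB.cell_s₁_congr hv₀ 0 l one_mem_W1
  rw [mul_one, mul_one] at h5
  rw [h5] at h
  push_cast at h
  linear_combination h

/-- In the split case there are two roots modulo `𝔭`. -/
theorem cell_s₁_add_of_split (h0 : conductorExp Λ = 0) {δ : F} (hδ : δ ^ 2 = disc a b c) (l : ℤ) :
    (q - 1) * B (hElt ϖ l 0) + B (cell ϖ 0 ((-b + δ) / (2 * c)) l * s₁) +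
      B (cell ϖ 0 ((-b - δ) / (2 * c)) l * s₁) = 0 := by
  classical
  have hc := hB.adm.c_unit
  have hc0 := hc.ne_zero
  have hp := int_of_root hB.adm (isSimpleRoot_add hB.adm hδ).1
  have hm := int_of_root hB.adm (isSimpleRoot_sub hB.adm hδ).1
  have hu : IsIntUnit δ := by
    apply IsIntUnit.of_pow_two
    rw [hδ]
    exact hB.adm.split ⟨δ, by rw [← hδ, pow_two]⟩
  obtain ⟨v₁, hv₁⟩ := exists_rep_sub_inP hp
  obtain ⟨v₂, hv₂⟩ := exists_rep_sub_inP hm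
  have factor : ∀ v : F, a + b * v + c * v ^ 2 =
      c * ((v - (-b + δ) / (2 * c)) * (v - (-b - δ) / (2 * c))) := by
    intro v
    rw [disc] at hδ
    field_simp
    linear_combination hδ
  have hne : v₁ ≠ v₂ := by
    rintro rfl
    have h := hv₂.sub hv₁
    have e : rep v₁ - (-b - δ) / (2 * c) - (rep v₁ - (-b + δ) / (2 * c)) = δ / c := by
      field_simp
      ring
    rw [e] at h
    exact (hu.div hc).not_inP h
  have h := hB.sum_roots h0 l {v₁, v₂} (fun v => by
    rw [Finset.mem_insert, Finset.mem_singleton, factor]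
    constructor
    · rintro (rfl | rfl)
      · exact InP.mul_left hc.int (hv₁.mul_right (sub_mem (rep_int _) hm))
      · exact InP.mul_left hc.int (InP.mul_left (sub_mem (rep_int _) hp) hv₂)
    · intro h2
      have h3 := h2.of_mul_unit hc
      by_cases h4 : InP (rep v - (-b + δ) / (2 * c))
      · have h5 := h4.sub hv₁
        rw [sub_sub_sub_cancel_right] at h5
        exact Or.inl (rep_inj h5)
      · have h4' := isIntUnit_of_not_inP (sub_mem (rep_int v) hp) h4
        have h5 := (h3.of_mul_unit h4').sub hv₂
        rw [sub_sub_sub_cancel_right] at h5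
        exact Or.inr (rep_inj h5))
  rw [Finset.card_pair hne, Finset.sum_pair hne] at h
  have h5 := hB.cell_s₁_congr hv₁ 0 l one_mem_W1
  have h6 := hB.cell_s₁_congr hv₂ 0 l one_mem_W1
  rw [mul_one, mul_one] at h5 h6
  rw [h5, h6] at h
  push_cast at h
  linear_combination h

/-- The values on the line of the root in the ramified case. -/
theorem values_ramified (h0 : conductorExp Λ = 0) {w : F} (hw : w ∈ 𝒪[F])
    (hP : InP (a + b * w + c * w ^ 2)) (hb : InP (b + 2 * c * w)) (l : ℤ) :
    B (cell ϖ 0 w l * s₁) =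
      (if l ≤ -1 then 0 else -q * coefA q ω 0 l 0 * constC ϖ 0 B) ∧
    B (cell ϖ 0 w l * s₁ * s₂) =
      (if l ≤ -2 then 0
        else if l = -1 then -ω * q ^ 3 * constC ϖ 0 B
        else coefA q ω 0 l 0 * constC ϖ 0 B) ∧
    B (cell ϖ 0 w l * s₁ * s₂ * s₁) =
      (if l ≤ -2 then 0 else ω * q ^ 2 * coefA q ω 0 (l + 1) 0 * constC ϖ 0 B) ∧
    B (cell ϖ 0 w l * s₁ * s₂ * s₁ * s₂) =
      (if l ≤ -2 then 0 else -ω * q * coefA q ω 0 (l + 1) 0 * constC ϖ 0 B) := by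
  have hq := hB.q_ne_zero
  have hP' : InP (formValue ϖ a b c 0 w) := by rwa [formValue_zero]
  have hb' : InP (formDeriv ϖ b c 0 w) := by rwa [formDeriv_zero]
  have hval : ∀ l : ℤ, B (cell ϖ 0 w l * s₁) =
      (if l ≤ -1 then 0 else -q * coefA q ω 0 l 0 * constC ϖ 0 B) := by
    intro l
    split_ifs with hl
    · exact hB.cell_s₁_eq_zero hl
    · rw [hB.cell_s₁_eq_zpow_mul 0 hw (by omega), hB.cell_s₁_of_ramified h0 hw hP hb,
        constC_zero_eq, coefA_zero_zero]
      ring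
  refine ⟨hval l, ?_, ?_, ?_⟩
  · split_ifs with h1 h2
    · exact hB.cell_s₁s₂_eq_zero_of_le h1
    · subst h2
      rw [hB.cell_s₁s₂_of_inP hP' hb' le_rfl, hval, if_neg (by norm_num), coefA_zero_zero]
      simp
      ring
    · rw [hB.cell_s₁s₂ (by omega), hval, if_neg (by omega)]
      field_simp
  · split_ifs with h1
    · exact hB.cell_s₁s₂s₁_eq_zero_of_le h1
    · rw [hB.cell_s₁s₂s₁ (hP'.zpow_mul_int hB.unif (by omega)), hval, if_neg (by omega)]
      ring
  · rw [hB.cell_s₁s₂s₁s₂, hval]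
    by_cases h1 : l ≤ -2
    · rw [if_pos h1, if_pos (by omega), mul_zero]
    · rw [if_neg h1, if_neg (by omega)]
      ring

/-- The values on the line of an exact simple root. -/
theorem values_root {w : F} (hr : IsSimpleRoot a b c w) (l : ℤ) :
    B (cell ϖ 0 w l * s₁) =
      (if l ≤ -1 then 0 else coefA q ω 0 l 0 * B (Wmat w * s₁)) ∧
    B (cell ϖ 0 w l * s₁ * s₂) =
      (if l ≤ -1 then 0 else -(1 / q) * coefA q ω 0 l 0 * B (Wmat w * s₁)) ∧
    B (cell ϖ 0 w l * s₁ * s₂ * s₁) =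
      (if l ≤ -2 then 0 else -ω * q * coefA q ω 0 (l + 1) 0 * B (Wmat w * s₁)) ∧
    B (cell ϖ 0 w l * s₁ * s₂ * s₁ * s₂) =
      (if l ≤ -2 then 0 else ω * coefA q ω 0 (l + 1) 0 * B (Wmat w * s₁)) := by
  obtain ⟨hP, hb⟩ := hr
  have hw := int_of_root hB.adm hP
  have hval : ∀ l : ℤ, B (cell ϖ 0 w l * s₁) =
      (if l ≤ -1 then 0 else coefA q ω 0 l 0 * B (Wmat w * s₁)) := by
    intro l
    split_ifs with hl
    · exact hB.cell_s₁_eq_zero hl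
    · rw [hB.cell_s₁_eq_zpow_mul 0 hw (by omega), coefA_zero_zero, cell_zero_zero]
  refine ⟨hval l, ?_, ?_, ?_⟩
  · split_ifs with h1
    · exact hB.cell_s₁s₂_eq_zero (by rwa [formDeriv_zero]) h1
    · rw [hB.cell_s₁s₂ (by omega), hval, if_neg h1, mul_assoc]
  · rw [hB.cell_s₁s₂s₁ (by rw [formValue_zero, hP, mul_zero]; exact zero_mem _), hval]
    by_cases h1 : l ≤ -2
    · rw [if_pos h1, if_pos (by omega), mul_zero]
    · rw [if_neg h1, if_neg (by omega), mul_assoc _ (coefA _ _ _ _ _)]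
  · rw [hB.cell_s₁s₂s₁s₂, hval]
    by_cases h1 : l ≤ -2
    · rw [if_pos h1, if_pos (by omega), mul_zero]
    · rw [if_neg h1, if_neg (by omega), mul_assoc]

/-- For `Λ = Ω ∘ N` the uniformizer of a ramified `L` acts with the wrong sign. -/
theorem eq_zero_of_ramified (h0 : conductorExp Λ = 0) (hd : InP (disc a b c))
    {Ω : Fˣ →* ℂˣ} (hΩ : ∀ x : Fˣ, IsIntUnit (x : F) → Ω x = 1) (hω : ω = -(Ω ϖ : ℂ))
    (hΛ : ∀ z : (L a b c)ˣ, Λ z = Ω (Units.map QuadraticAlgebra.norm z)) :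
    B (hElt ϖ 0 0) = 0 := by
  by_cases hr : ∀ w ∈ 𝒪[F], ¬ InP (a + b * w + c * w ^ 2)
  · exact hB.hElt_eq_zero_of_no_root h0 hr 0
  push Not at hr
  obtain ⟨w, hw, hP⟩ := hr
  obtain ⟨hb, u, hu, e⟩ := hB.adm.eq_unit_mul_of_inP hB.unif hd hP
  have hn : nm a b c (w * c) 1 = ϖ * (c * u) := by
    simp only [nm]
    linear_combination c * e
  have hcu := hB.adm.c_unit.mul hu
  have hne : nm a b c (w * c) 1 ≠ 0 := by
    rw [hn]
    exact mul_ne_zero ϖ.ne_zero hcu.ne_zero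
  have hval : (Λ (linUnit hne) : ℂ) = -ω := by
    have e2 : Units.map (QuadraticAlgebra.norm : L a b c →* F) (linUnit hne) =
        ϖ * Units.mk0 (c * u) hcu.ne_zero := by
      apply Units.ext
      change QuadraticAlgebra.norm (lin a b c (w * c) 1) = ϖ * (c * u)
      rw [norm_lin, hn]
    rw [hΛ, e2, map_mul, hΩ (Units.mk0 (c * u) _) hcu, mul_one, hω, neg_neg]
  have h1 := hB.char_mul_cell_of_ramified hb hu e hne 0 (Or.inl rfl)
  rw [hval, (hB.values_ramified h0 hw hP hb 0).2.1, if_neg (by norm_num), if_neg (by norm_num),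
    coefA_zero_zero, zpow_zero, one_mul, constC_zero_eq] at h1
  have h2 : ω * B (hElt ϖ 0 0) = 0 := by linear_combination -h1 / 2
  linear_combination ω * h2 - B (hElt ϖ 0 0) * hB.sq

/-- The element `(1, ϖ)` relates the lines of the two roots in the split case. -/
theorem Wmat_s₁_of_split {δ : F} (hδ : δ ^ 2 = disc a b c) (hd : disc a b c ≠ 0) :
    ω * (Λ (splitUnit hδ hd 1 ϖ) : ℂ) * B (Wmat ((-b - δ) / (2 * c)) * s₁) =
      B (Wmat ((-b + δ) / (2 * c)) * s₁) := by
  have h := hB.char_mul_cell_of_split hδ hd 0 (Or.inl rfl)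
  have h1 := (hB.values_root (isSimpleRoot_add hB.adm hδ) 0).2.1
  have h2 := (hB.values_root (isSimpleRoot_sub hB.adm hδ) 0).2.1
  rw [if_neg (by norm_num), coefA_zero_zero, zpow_zero] at h1 h2
  rw [h1, h2] at h
  have hq := hB.q_ne_zero
  field_simp at h
  linear_combination -ω * h + B (Wmat ((-b + δ) / (2 * c)) * s₁) * hB.sq

/-- The transformation between the two roots for all elements of `W⁽¹⁾`. -/
theorem cell_s₁_of_split {δ : F} (hδ : δ ^ 2 = disc a b c) (hd : disc a b c ≠ 0) (l : ℤ)
    {s : GSp4 F} (hs : s ∈ W1) :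
    B (cell ϖ 0 ((-b - δ) / (2 * c)) l * s₁ * s) =
      1 / (ω * (Λ (splitUnit hδ hd 1 ϖ) : ℂ)) * B (cell ϖ 0 ((-b + δ) / (2 * c)) l * s₁ * s) := by
  have hr : ω * (Λ (splitUnit hδ hd 1 ϖ) : ℂ) ≠ 0 := by
    refine mul_ne_zero ?_ (Units.ne_zero _)
    rintro h
    have := hB.sq
    rw [h] at this
    simp at this
  obtain ⟨p1, p2, p3, p4⟩ := hB.values_root (isSimpleRoot_add hB.adm hδ) l
  obtain ⟨m1, m2, m3, m4⟩ := hB.values_root (isSimpleRoot_sub hB.adm hδ) l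
  have key : B (Wmat ((-b - δ) / (2 * c)) * s₁) =
      1 / (ω * (Λ (splitUnit hδ hd 1 ϖ) : ℂ)) * B (Wmat ((-b + δ) / (2 * c)) * s₁) := by
    rw [← hB.Wmat_s₁_of_split hδ hd, ← mul_assoc, one_div,
      inv_mul_cancel₀ hr, one_mul]
  rw [key] at m1 m2 m3 m4
  rcases hs with rfl | rfl | rfl | rfl
  · rw [mul_one, mul_one, m1, p1, mul_ite, mul_zero]
    congr 1
    ring
  · rw [m2, p2, mul_ite, mul_zero]
    congr 1
    ring
  · rw [← mul_assoc, ← mul_assoc, m3, p3, mul_ite, mul_zero]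
    congr 1
    ring
  · simp only [← mul_assoc]
    rw [m4, p4, mul_ite, mul_zero]
    congr 1
    ring

theorem constC_eq_zero_of_split (h0 : conductorExp Λ = 0) {δ : F} (hδ : δ ^ 2 = disc a b c)
    (hd : disc a b c ≠ 0) (hr : ω * (Λ (splitUnit hδ hd 1 ϖ) : ℂ) = -1) : constC ϖ 0 B = 0 := by
  have h1 := hB.cell_s₁_add_of_split h0 hδ 0
  have h2 := hB.Wmat_s₁_of_split hδ hd
  rw [cell_zero_zero, cell_zero_zero, ← constC_zero_eq ϖ B] at h1
  rw [hr] at h2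
  rw [← h2] at h1
  have h3 : (q - 1) * constC ϖ 0 B = 0 := by linear_combination h1
  exact (mul_eq_zero.mp h3).resolve_left hB.q_sub_one_ne_zero

theorem Wmat_s₁_eq_of_split (h0 : conductorExp Λ = 0) {δ : F} (hδ : δ ^ 2 = disc a b c)
    (hd : disc a b c ≠ 0) (hr : ω * (Λ (splitUnit hδ hd 1 ϖ) : ℂ) ≠ -1) :
    B (Wmat ((-b - δ) / (2 * c)) * s₁) =
      -((q - 1) / (1 + ω * (Λ (splitUnit hδ hd 1 ϖ) : ℂ))) * constC ϖ 0 B := by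
  have h1 := hB.cell_s₁_add_of_split h0 hδ 0
  have h2 := hB.Wmat_s₁_of_split hδ hd
  rw [cell_zero_zero, cell_zero_zero, ← constC_zero_eq ϖ B] at h1
  rw [← h2] at h1
  have : 1 + ω * (Λ (splitUnit hδ hd 1 ϖ) : ℂ) ≠ 0 := by
    intro h
    apply hr
    linear_combination h
  field_simp
  linear_combination h1

end IsBessel

end RootValues

/-! ### Representatives of the double cosets -/

section Siegel

variable {F : Type*} [Field F]

/-- The lower triangular unipotent element `[1₂, 0; X, 1₂]` with `X = [x, y; y, z]`. -/
def lowerUnip (x y z : F) : GSp4 F :=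
  ofMatrix !![1, 0, 0, 0; 0, 1, 0, 0; x, y, 1, 0; y, z, 0, 1] 1 one_ne_zero (by
    ext i j
    fin_cases i <;> fin_cases j <;> simp [J, Matrix.mul_apply, Fin.sum_univ_four])

theorem toMat_lowerUnip (x y z : F) : toMat (lowerUnip x y z) =
    !![1, 0, 0, 0; 0, 1, 0, 0; x, y, 1, 0; y, z, 0, 1] := rfl

/-- The minors of the lower half of an element of `GSp₄(F)`: the Plücker coordinates of its class
modulo the Siegel parabolic subgroup. -/
def minor (g : GSp4 F) (i j : Fin 4) : F :=
  toMat g 2 i * toMat g 3 j - toMat g 2 j * toMat g 3 i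

theorem exists_multiplier (g : GSp4 F) : ∃ μ : F, μ ≠ 0 ∧ (toMat g)ᵀ * J F * toMat g = μ • J F := by
  obtain ⟨μ, hμ⟩ := g.2
  exact ⟨μ, μ.ne_zero, hμ⟩

theorem exists_multiplier_transpose (g : GSp4 F) :
    ∃ μ : F, μ ≠ 0 ∧ toMat g * J F * (toMat g)ᵀ = μ • J F := by
  obtain ⟨μ, hμ, h⟩ := exists_multiplier g
  refine ⟨μ, hμ, ?_⟩
  have h1 : (-μ⁻¹ • (J F * (toMat g)ᵀ * J F)) * toMat g = 1 := by
    rw [Matrix.smul_mul, Matrix.mul_assoc, Matrix.mul_assoc, ← Matrix.mul_assoc (toMat g)ᵀ, h,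
      Matrix.mul_smul, J_mul_J, smul_smul]
    simp [hμ]
  have h2 := congrArg (· * J F) (mul_eq_one_comm.mp h1)
  simp only [Matrix.mul_smul, Matrix.smul_mul, one_mul, ← Matrix.mul_assoc] at h2
  rw [Matrix.mul_assoc (_ * _) (J F) (J F), J_mul_J, mul_neg, mul_one, smul_neg, neg_smul,
    neg_neg] at h2
  conv_rhs => rw [← h2, smul_smul, mul_inv_cancel₀ hμ, one_smul]

theorem minor_zero_two (g : GSp4 F) : minor g 0 2 = -minor g 1 3 := by
  obtain ⟨μ, -, h⟩ := exists_multiplier_transpose g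
  have e := congrFun (congrFun h 2) 3
  simp [J, Matrix.mul_apply, Fin.sum_univ_four] at e
  simp only [minor]
  linear_combination e

theorem minor_plucker (g : GSp4 F) :
    minor g 0 1 * minor g 2 3 + minor g 1 3 ^ 2 + minor g 0 3 * minor g 1 2 = 0 := by
  have h := minor_zero_two g
  have : minor g 0 1 * minor g 2 3 - minor g 0 2 * minor g 1 3 + minor g 0 3 * minor g 1 2 = 0 := by
    simp only [minor]
    ring
  rw [h] at this
  linear_combination this

theorem exists_minor_ne_zero (g : GSp4 F) :
    minor g 0 1 ≠ 0 ∨ minor g 1 2 ≠ 0 ∨ minor g 0 3 ≠ 0 ∨ minor g 2 3 ≠ 0 := by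
  by_contra! h
  obtain ⟨h01, h12, h03, h23⟩ := h
  have h13 : minor g 1 3 = 0 := by
    have := minor_plucker g
    rw [h01, h03] at this
    simpa using this
  have h02 : minor g 0 2 = 0 := by rw [minor_zero_two, h13, neg_zero]
  obtain ⟨μ, hμ, h⟩ := exists_multiplier_transpose g
  have e1 := congrFun (congrFun h 0) 2
  have e2 := congrFun (congrFun h 0) 3
  have e3 := congrFun (congrFun h 1) 3
  simp [J, Matrix.mul_apply, Fin.sum_univ_four] at e1 e2 e3
  simp only [minor] at h01 h12 h03 h23 h13 h02
  -- the last row is orthogonal to everything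
  have r0 : toMat g 3 0 = 0 := by
    apply mul_left_cancel₀ hμ
    linear_combination -toMat g 3 0 * e1 + toMat g 2 0 * e2 - toMat g 0 0 * h02 - toMat g 0 1 * h03
      + toMat g 0 3 * h01
  have r1 : toMat g 3 1 = 0 := by
    apply mul_left_cancel₀ hμ
    linear_combination -toMat g 3 1 * e1 + toMat g 2 1 * e2 - toMat g 0 0 * h12 - toMat g 0 1 * h13
      - toMat g 0 2 * h01
  have r2 : toMat g 3 2 = 0 := by
    apply mul_left_cancel₀ hμ
    linear_combination -toMat g 3 2 * e1 + toMat g 2 2 * e2 - toMat g 0 1 * h23 - toMat g 0 2 * h02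
      - toMat g 0 3 * h12
  have r3 : toMat g 3 3 = 0 := by
    apply mul_left_cancel₀ hμ
    linear_combination -toMat g 3 3 * e1 + toMat g 2 3 * e2 + toMat g 0 0 * h23
      - toMat g 0 2 * h03 - toMat g 0 3 * h13
  rw [r0, r1, r2, r3] at e3
  simp at e3
  exact hμ e3.symm

omit [Field F] in
theorem matrix_eta_four (M : Matrix (Fin 4) (Fin 4) F) : M =
    !![M 0 0, M 0 1, M 0 2, M 0 3; M 1 0, M 1 1, M 1 2, M 1 3; M 2 0, M 2 1, M 2 2, M 2 3;
      M 3 0, M 3 1, M 3 2, M 3 3] := by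
  ext i j
  fin_cases i <;> fin_cases j <;> rfl

theorem minor_mul_s₁ (g : GSp4 F) : minor (g * s₁) 0 1 = -minor g 0 1 ∧
    minor (g * s₁) 1 2 = minor g 0 3 ∧ minor (g * s₁) 0 3 = minor g 1 2 ∧
    minor (g * s₁) 2 3 = -minor g 2 3 := by
  simp only [minor, toMat_mul, toMat_s₁, Matrix.mul_apply, Fin.sum_univ_four]
  simp

theorem minor_mul_s₂ (g : GSp4 F) : minor (g * s₂) 0 1 = minor g 1 2 ∧
    minor (g * s₂) 1 2 = -minor g 0 1 ∧ minor (g * s₂) 0 3 = -minor g 2 3 ∧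
    minor (g * s₂) 2 3 = minor g 0 3 := by
  simp only [minor, toMat_mul, toMat_s₂, Matrix.mul_apply, Fin.sum_univ_four]
  simp
  constructor <;> ring

theorem exists_eq_symUnip_levi_simil {h : GSp4 F} (h20 : toMat h 2 0 = 0) (h21 : toMat h 2 1 = 0)
    (h30 : toMat h 3 0 = 0) (h31 : toMat h 3 1 = 0) :
    ∃ (x y z : F) (A : GL (Fin 2) F) (u : Fˣ), h = symUnip x y z * (levi A * simil u) := by
  obtain ⟨μ, hμ, e⟩ := exists_multiplier h
  have e02 := congrFun (congrFun e 0) 2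
  have e03 := congrFun (congrFun e 0) 3
  have e12 := congrFun (congrFun e 1) 2
  have e13 := congrFun (congrFun e 1) 3
  have e23 := congrFun (congrFun e 2) 3
  simp [J, Matrix.mul_apply, Fin.sum_univ_four, h20, h21, h30, h31] at e02 e03 e12 e13 e23
  set a₁ := toMat h 0 0
  set a₂ := toMat h 0 1
  set a₃ := toMat h 1 0
  set a₄ := toMat h 1 1
  set b₁ := toMat h 0 2
  set b₂ := toMat h 0 3
  set b₃ := toMat h 1 2
  set b₄ := toMat h 1 3
  set d₁ := toMat h 2 2
  set d₂ := toMat h 2 3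
  set d₃ := toMat h 3 2
  set d₄ := toMat h 3 3
  have hD : d₄ * d₁ - -d₃ * -d₂ ≠ 0 := by
    intro h0
    apply pow_ne_zero 2 hμ
    linear_combination (-(a₂ * d₂ + a₄ * d₄)) * e02 - μ * e13 + (a₂ * d₁ + a₄ * d₃) * e03 +
      (a₁ * a₄ - a₂ * a₃) * h0
  have hD' : d₄ * d₁ - d₃ * d₂ ≠ 0 := by rwa [neg_mul_neg] at hD
  refine ⟨(b₁ * d₄ - b₂ * d₃) / (d₄ * d₁ - d₃ * d₂), (b₃ * d₄ - b₄ * d₃) / (d₄ * d₁ - d₃ * d₂),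
    (b₄ * d₁ - b₃ * d₂) / (d₄ * d₁ - d₃ * d₂), gl2 d₄ (-d₃) (-d₂) d₁ hD,
    Units.mk0 (μ / (d₄ * d₁ - d₃ * d₂)) (div_ne_zero hμ hD'), ?_⟩
  apply toMat_injective
  rw [toMat_mul, toMat_mul, toMat_symUnip, toMat_levi, toMat_simil, coe_gl2, Units.val_mk0,
    matrix_eta_four (toMat h), mul_fin_four, mul_fin_four, h20, h21, h30, h31]
  change !![a₁, a₂, b₁, b₂; a₃, a₄, b₃, b₄; 0, 0, d₁, d₂; 0, 0, d₃, d₄] = _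
  ext i j
  fin_cases i <;> fin_cases j <;> simp <;> field_simp
  · linear_combination d₄ * e02 - d₃ * e03
  · linear_combination d₄ * e12 - d₃ * e13
  · linear_combination -d₃ * e23
  · linear_combination -d₄ * e23
  · rw [← neg_div, eq_div_iff (by rwa [mul_comm d₂])]
    linear_combination -d₂ * e02 + d₁ * e03
  · rw [eq_div_iff (by rwa [mul_comm d₁])]
    linear_combination -d₂ * e12 + d₁ * e13
  · ring
  · ring

/-- If the last minor does not vanish, a lower unipotent element moves `g` into the Siegel
parabolic subgroup. -/
theorem exists_mul_lowerUnip (g : GSp4 F) (h : minor g 2 3 ≠ 0) :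
    ∃ y, y ^ 2 = -(minor g 0 3 / minor g 2 3) * (minor g 1 2 / minor g 2 3) -
        minor g 0 1 / minor g 2 3 ∧
      ∃ (x' y' z' : F) (A : GL (Fin 2) F) (u : Fˣ),
        g * lowerUnip (-(minor g 0 3 / minor g 2 3)) y (minor g 1 2 / minor g 2 3) =
          symUnip x' y' z' * (levi A * simil u) := by
  have h02 := minor_zero_two g
  refine ⟨-(minor g 1 3 / minor g 2 3), ?_, exists_eq_symUnip_levi_simil ?_ ?_ ?_ ?_⟩
  · have := minor_plucker g
    field_simp
    linear_combination this
  all_goals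
    rw [toMat_mul, toMat_lowerUnip, matrix_eta_four (toMat g), mul_fin_four]
    simp
    field_simp
    simp only [minor] at h02 ⊢
  · linear_combination -toMat g 2 3 * h02
  · ring
  · linear_combination -toMat g 3 3 * h02
  · ring

end Siegel

section IwahoriDecomposition

variable {F : Type*} [Field F] [ValuativeRel F]

theorem int_div {x y : F} (h : valuation F x ≤ valuation F y) : x / y ∈ 𝒪[F] := by
  rw [mem_int, map_div₀]
  exact div_le_one_of_le₀ h zero_le

theorem inP_div {x y : F} (h : valuation F x < valuation F y) : InP (x / y) := by
  rw [InP, map_div₀]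
  exact (div_lt_one₀ (zero_le.trans_lt h)).mpr h

theorem ne_zero_of_valuation_lt {x y : F} (h : valuation F x < valuation F y) : y ≠ 0 := by
  rintro rfl
  rw [map_zero] at h
  exact not_lt_zero h

theorem exists_pivot {α : Type*} [LinearOrder α] (p₁ p₂ p₃ p₄ : α) :
    (p₂ ≤ p₁ ∧ p₃ ≤ p₁ ∧ p₄ ≤ p₁) ∨ (p₁ < p₂ ∧ p₃ ≤ p₂ ∧ p₄ ≤ p₂) ∨
      (p₁ < p₃ ∧ p₂ < p₃ ∧ p₄ ≤ p₃) ∨ (p₁ < p₄ ∧ p₂ < p₄ ∧ p₃ < p₄) := by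
  grind

theorem exists_iwahori_lowerUnip_mul {s : GSp4 F} {x y z : F} {M : Matrix (Fin 4) (Fin 4) F}
    (hM : IwahoriShape M) (e : toMat (lowerUnip x y z * s) = toMat s * M) :
    ∃ k ∈ Iwahori F, lowerUnip x y z * s = s * k :=
  ⟨s⁻¹ * (lowerUnip x y z * s), mem_Iwahori (by rwa [toMat_inv_mul e]), by group⟩

/-- `GSp₄(F)` is the union of the cosets `P s I`, where `P` is the Siegel parabolic subgroup and
`s ∈ W⁽¹⁾`. The element `s` is read off from the largest Plücker coordinate. -/
theorem exists_siegel_decomposition (g : GSp4 F) :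
    ∃ (x y z : F) (A : GL (Fin 2) F) (u : Fˣ), ∃ s ∈ W1, ∃ k ∈ Iwahori F,
      g * k = symUnip x y z * (levi A * simil u) * s := by
  have hz := InP.zero (F := F)
  have h0 := zero_mem 𝒪[F]
  have h1 := IsIntUnit.one (F := F)
  have h1' := one_mem 𝒪[F]
  -- it suffices to find `s` with suitable Plücker coordinates of `g s⁻¹`
  have reduction : ∀ s ∈ W1, ∀ g' : GSp4 F, g = g' * s → minor g' 2 3 ≠ 0 →
      (∀ y : F, y ^ 2 = -(minor g' 0 3 / minor g' 2 3) * (minor g' 1 2 / minor g' 2 3) -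
        minor g' 0 1 / minor g' 2 3 → ∃ M, IwahoriShape M ∧
        toMat (lowerUnip (-(minor g' 0 3 / minor g' 2 3)) y (minor g' 1 2 / minor g' 2 3) * s) =
          toMat s * M) →
      ∃ (x y z : F) (A : GL (Fin 2) F) (u : Fˣ), ∃ s ∈ W1, ∃ k ∈ Iwahori F,
        g * k = symUnip x y z * (levi A * simil u) * s := by
    intro s hs g' hg hne H
    obtain ⟨y, hy, x', y', z', A, u, e⟩ := exists_mul_lowerUnip g' hne
    obtain ⟨M, hM, eM⟩ := H y hy
    obtain ⟨k, hk, ek⟩ := exists_iwahori_lowerUnip_mul hM eM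
    exact ⟨x', y', z', A, u, s, hs, k, hk, by rw [hg, mul_assoc, ← ek, ← mul_assoc, e]⟩
  rcases exists_pivot (valuation F (minor g 0 1)) (valuation F (minor g 1 2))
    (valuation F (minor g 0 3)) (valuation F (minor g 2 3)) with
    ⟨c₁, c₂, c₃⟩ | ⟨c₁, c₂, c₃⟩ | ⟨c₁, c₂, c₃⟩ | ⟨c₁, c₂, c₃⟩
  · have hne : minor g 0 1 ≠ 0 := by
      intro h
      rw [h, map_zero] at c₁ c₂ c₃
      simp only [nonpos_iff_eq_zero, map_eq_zero] at c₁ c₂ c₃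
      simpa [h, c₁, c₂, c₃] using exists_minor_ne_zero g
    obtain ⟨g', rfl⟩ : ∃ g', g = g' * s₂ * s₁ * s₂ := ⟨g * s₂⁻¹ * s₁⁻¹ * s₂⁻¹, by group⟩
    simp only [minor_mul_s₁, minor_mul_s₂, Valuation.map_neg] at c₁ c₂ c₃ hne
    rw [neg_ne_zero] at hne
    refine reduction _ s₂s₁s₂_mem_W1 g' (by group) hne fun y hy => ?_
    have hx := int_div c₂
    have hz' := int_div c₁
    have hy' : y ∈ 𝒪[F] := by
      apply int_of_sq_int
      rw [hy]
      exact sub_mem (mul_mem (neg_mem hx) hz') (int_div c₃)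
    refine ⟨_, iwahoriShape_of h1 hz (neg_mem hz') (neg_mem hy') h0 h1' (neg_mem hy')
      (neg_mem (neg_mem hx)) hz hz h1 h0 hz hz hz h1', ?_⟩
    simp only [toMat_mul, toMat_s₁, toMat_s₂, toMat_lowerUnip, mul_fin_four]
    simp
  · have hne := ne_zero_of_valuation_lt c₁
    obtain ⟨g', rfl⟩ : ∃ g', g = g' * s₂ * s₁ := ⟨g * s₁⁻¹ * s₂⁻¹, by group⟩
    simp only [minor_mul_s₁, minor_mul_s₂, Valuation.map_neg] at c₁ c₂ c₃ hne
    rw [neg_ne_zero] at hne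
    refine reduction _ s₂s₁_mem_W1 g' (by group) hne fun y hy => ?_
    have hx := int_div c₃
    have hz' := inP_div c₁
    have hy' : y ∈ 𝒪[F] := by
      apply int_of_sq_int
      rw [hy]
      exact sub_mem (mul_mem (neg_mem hx) hz'.int) (int_div c₂)
    refine ⟨_, iwahoriShape_of h1 hz h0 h0 (neg_mem hy') h1' h0
      (neg_mem (neg_mem hx)) hz' hz h1 hy' hz hz hz h1', ?_⟩
    simp only [toMat_mul, toMat_s₁, toMat_s₂, toMat_lowerUnip, mul_fin_four]
    simp
  · have hne := ne_zero_of_valuation_lt c₁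
    obtain ⟨g', rfl⟩ : ∃ g', g = g' * s₂ := ⟨g * s₂⁻¹, by group⟩
    simp only [minor_mul_s₂, Valuation.map_neg] at c₁ c₂ c₃ hne
    rw [neg_ne_zero] at hne
    refine reduction _ s₂_mem_W1 g' rfl hne fun y hy => ?_
    have hx := int_div c₃
    have hz' := inP_div c₁
    have hy' : InP y := by
      apply InP.of_pow_two
      rw [hy]
      exact (InP.mul_left (neg_mem hx) hz').sub (inP_div c₂)
    refine ⟨_, iwahoriShape_of h1 hy'.neg (neg_mem (neg_mem hx)) h0 h0 h1' h0 h0 hz hz h1 h0 hz hz'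
      hy' h1', ?_⟩
    simp only [toMat_mul, toMat_s₂, toMat_lowerUnip, mul_fin_four]
    simp
  · have hne := ne_zero_of_valuation_lt c₁
    refine reduction _ one_mem_W1 g (by rw [mul_one]) hne fun y hy => ?_
    have hx := inP_div c₃
    have hz' := inP_div c₂
    have hy' : InP y := by
      apply InP.of_pow_two
      rw [hy]
      exact (InP.mul_left (neg_mem hx.int) hz').sub (inP_div c₁)
    refine ⟨_, iwahoriShape_of h1 hz h0 h0 h0 h1' h0 h0 hx.neg hy' h1 h0 hy' hz' hz h1', ?_⟩
    rw [mul_one, toMat_one, one_mul, toMat_lowerUnip]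

end IwahoriDecomposition

/-! ### The torus and the double cosets of `GL₂` -/

section LeviDecomposition

variable {F : Type*} [Field F] [ValuativeRel F] [TopologicalSpace F]
  [IsNonarchimedeanLocalField F] [CharZero F]

/-- The quadratic form on columns `(u, v)` that is, up to the factor `c`, the norm form of `L`
under the identification `[x + b y, c y; -a y, x] * (0, 1) = (c y, x)`. -/
def colForm (a b c u v : F) : F := c * v ^ 2 + b * u * v + a * u ^ 2

/-- If the form is maximal at the second column of `A`, then `A` lies in
`T(F) diag(ϖ^m, 1) GL₂(𝔬)`: the quotient of the columns is integral in `L`. -/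
theorem exists_levi_of_max {ϖ : Fˣ} {a b c : F} (adm : IsAdmissible a b c) (hϖ : IsUniformizer ϖ)
    {p q r s : F} (hA : p * s - q * r ≠ 0) (hne : colForm a b c q s ≠ 0)
    (h1 : valuation F (colForm a b c p r) ≤ valuation F (colForm a b c q s))
    (h2 : valuation F (colForm a b c (p + q) (r + s)) ≤ valuation F (colForm a b c q s)) :
    ∃ (m : ℕ) (t v x y : F), nm a b c x y ≠ 0 ∧ IsIntUnit t ∧ v ∈ 𝒪[F] ∧
      !![p, q; r, s] = !![x + b * y, c * y; -(a * y), x] * !![(ϖ : F) ^ m * t, 0; v, 1] := by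
  have hc := adm.c_unit
  have hc0 := hc.ne_zero
  have hN : colForm a b c q s = c * s ^ 2 + b * q * s + a * q ^ 2 := rfl
  set N := colForm a b c q s
  clear_value N
  set y := (p * s - q * r) / N with hy
  set v := (c * r * s + b * r * q + a * p * q) / N with hv
  have e1 : nm a b c v y = colForm a b c p r / N := by
    rw [hv, hy]
    simp only [nm, colForm]
    field_simp
    rw [hN]
    ring
  have e2 : nm a b c (v + 1) y = colForm a b c (p + q) (r + s) / N := by
    rw [hv, hy]
    simp only [nm, colForm]
    field_simp
    rw [hN]
    ring
  have h1' := int_div h1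
  have h2' := int_div h2
  rw [← e1] at h1'
  rw [← e2] at h2'
  have hmem : lin a b c v y ∈ OL a b c := by
    refine lin_mem_OL_of_trace_norm ?_ h1'
    have : 2 * v + b * y = nm a b c (v + 1) y - nm a b c v y - 1 := by
      simp only [nm]
      ring
    rw [this]
    exact sub_mem (sub_mem h2' h1') (one_mem _)
  obtain ⟨hvi, hyi⟩ := int_of_lin_mem_OL adm hmem
  have hy0 : c * y ≠ 0 := mul_ne_zero hc0 (div_ne_zero hA hne)
  obtain ⟨m, t, ht, e⟩ := exists_int_eq_unit_mul_pow hϖ (mul_mem hc.int hyi) hy0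
  have hn : nm a b c s (q / c) = N / c := by
    rw [hN, nm]
    field_simp
  refine ⟨m, t, v, s, q / c, hn ▸ div_ne_zero hne hc0, ht, hvi, ?_⟩
  rw [mul_comm ((ϖ : F) ^ m), ← e, Matrix.mul_fin_two, hv, hy]
  ext i j
  fin_cases i <;> fin_cases j <;> simp <;> field_simp <;> (try rw [hN]) <;> ring

/-- `GL₂(F)` is the union of the `T(F) diag(ϖ^m, 1) GL₂(𝔬)`. Among the two columns of `A` and their
sum, one on which the norm form is maximal becomes the second column by operations over `𝔬`. -/
theorem exists_levi_decomposition {ϖ : Fˣ} {a b c : F} (adm : IsAdmissible a b c)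
    (hϖ : IsUniformizer ϖ) (A : GL (Fin 2) F) :
    ∃ (m : ℕ) (p q r s x y : F), nm a b c x y ≠ 0 ∧
      p ∈ 𝒪[F] ∧ q ∈ 𝒪[F] ∧ r ∈ 𝒪[F] ∧ s ∈ 𝒪[F] ∧ IsIntUnit (p * s - q * r) ∧
      (A : Matrix (Fin 2) (Fin 2) F) = !![x + b * y, c * y; -(a * y), x] *
        !![(ϖ : F) ^ m * p, (ϖ : F) ^ m * q; r, s] := by
  have hdet : A 0 0 * A 1 1 - A 0 1 * A 1 0 ≠ 0 := by
    rw [← Matrix.det_fin_two]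
    exact ((Matrix.isUnit_iff_isUnit_det _).mp A.isUnit).ne_zero
  have h0 := zero_mem 𝒪[F]
  have h1 := one_mem 𝒪[F]
  have hA := Matrix.eta_fin_two (A : Matrix (Fin 2) (Fin 2) F)
  set α₁ := A 0 0
  set α₂ := A 0 1
  set α₃ := A 1 0
  set α₄ := A 1 1
  have hdisc : (colForm a b c (α₁ + α₂) (α₃ + α₄) - colForm a b c α₁ α₃ - colForm a b c α₂ α₄) ^ 2
      - 4 * colForm a b c α₁ α₃ * colForm a b c α₂ α₄ =
        disc a b c * (α₁ * α₄ - α₂ * α₃) ^ 2 := by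
    simp only [colForm, disc]
    ring
  have hdisc0 : disc a b c * (α₁ * α₄ - α₂ * α₃) ^ 2 ≠ 0 :=
    mul_ne_zero adm.disc_ne (pow_ne_zero 2 hdet)
  have hmax : ∀ α β γ : ValueGroupWithZero F,
      (β ≤ α ∧ γ ≤ α) ∨ (α ≤ β ∧ γ ≤ β) ∨ (α ≤ γ ∧ β ≤ γ) := by
    intro α β γ
    grind
  rcases hmax (valuation F (colForm a b c α₂ α₄)) (valuation F (colForm a b c α₁ α₃))
    (valuation F (colForm a b c (α₁ + α₂) (α₃ + α₄))) with ⟨c₁, c₂⟩ | ⟨c₁, c₂⟩ | ⟨c₁, c₂⟩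
  · have hne : colForm a b c α₂ α₄ ≠ 0 := by
      intro h
      rw [h, map_zero] at c₁ c₂
      simp only [nonpos_iff_eq_zero, map_eq_zero] at c₁ c₂
      rw [h, c₁, c₂] at hdisc
      exact hdisc0 (by rw [← hdisc]; ring)
    obtain ⟨m, t, v, x, y, hn, ht, hv, e⟩ := exists_levi_of_max adm hϖ hdet hne c₁ c₂
    refine ⟨m, t, 0, v, 1, x, y, hn, ht.int, h0, hv, h1, by simpa using ht, ?_⟩
    rw [hA, e, mul_zero]
  · have hne : colForm a b c α₁ α₃ ≠ 0 := by
      intro h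
      rw [h, map_zero] at c₁ c₂
      simp only [nonpos_iff_eq_zero, map_eq_zero] at c₁ c₂
      rw [h, c₁, c₂] at hdisc
      exact hdisc0 (by rw [← hdisc]; ring)
    obtain ⟨m, t, v, x, y, hn, ht, hv, e⟩ := exists_levi_of_max adm hϖ (p := α₂) (q := α₁)
      (r := α₄) (s := α₃) (by
        intro h
        apply hdet
        linear_combination -h) hne c₁ (by rwa [add_comm α₂, add_comm α₄])
    refine ⟨m, 0, t, 1, v, x, y, hn, h0, ht.int, h1, hv, by simpa using ht.neg, ?_⟩
    have e' := congrArg (· * !![0, 1; 1, 0]) e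
    simp only [Matrix.mul_assoc] at e'
    simp only [Matrix.mul_fin_two] at e' ⊢
    rw [hA]
    simpa using e'
  · have hne : colForm a b c (α₁ + α₂) (α₃ + α₄) ≠ 0 := by
      intro h
      rw [h, map_zero] at c₁ c₂
      simp only [nonpos_iff_eq_zero, map_eq_zero] at c₁ c₂
      rw [h, c₁, c₂] at hdisc
      exact hdisc0 (by rw [← hdisc]; ring)
    obtain ⟨m, t, v, x, y, hn, ht, hv, e⟩ := exists_levi_of_max adm hϖ (p := -α₁)
      (q := α₁ + α₂) (r := -α₃) (s := α₃ + α₄) (by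
        intro h
        apply hdet
        linear_combination -h) hne (by
        have : colForm a b c (-α₁) (-α₃) = colForm a b c α₁ α₃ := by
          simp only [colForm]
          ring
        rwa [this]) (by rwa [neg_add_cancel_left, neg_add_cancel_left])
    refine ⟨m, -t, t, -v, v + 1, x, y, hn, neg_mem ht.int, ht.int, neg_mem hv, add_mem hv h1,
      ?_, ?_⟩
    · have : -t * (v + 1) - t * -v = -t := by ring
      rw [this]
      exact ht.neg
    · have e' := congrArg (· * !![-1, 1; 0, 1]) e
      simp only [Matrix.mul_assoc] at e'
      simp only [Matrix.mul_fin_two] at e' ⊢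
      rw [hA]
      simpa using e'

end LeviDecomposition

/-! ### Functions that vanish at the representatives -/

section Exhaustion

variable {F : Type*} [Field F] [ValuativeRel F] [TopologicalSpace F]
  [IsNonarchimedeanLocalField F] [CharZero F]

namespace IsBessel

variable {ϖ : Fˣ} {a b c : F} {ψ : AddChar F Circle} {Λ : (L a b c)ˣ →* ℂˣ} {ω q : ℂ}
  {B : GSp4 F → ℂ} (hB : IsBessel ϖ a b c ψ Λ ω q B)
include hB

theorem simil_unit_mul {t : F} (ht : IsIntUnit t) (u u' : Fˣ) (hu : (u' : F) = t * u)
    (A : GL (Fin 2) F) {s : GSp4 F} (hs : s ∈ W1) :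
    B (levi A * simil u' * s) = B (levi A * simil u * s) := by
  have e : u' = u * Units.mk0 t ht.ne_zero := by
    apply Units.ext
    rw [hu, Units.val_mul, Units.val_mk0, mul_comm]
  rw [e, simil_mul, ← mul_assoc, hB.simil_right (t := Units.mk0 t ht.ne_zero) ht _ hs]

/-- The double cosets of `GL₂`: a Bessel function that vanishes at the standard representatives
vanishes on the Levi component. -/
theorem levi_eq_zero (h1 : ∀ (l : ℤ) (m : ℕ), ∀ s ∈ W1, B (hElt ϖ l m * s) = 0)
    (h2 : ∀ (l : ℤ) (m : ℕ), 0 < m → ∀ s ∈ W1, B (hElt ϖ l m * s₁ * s) = 0)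
    (h3 : ∀ w ∈ 𝒪[F], ∀ l : ℤ, ∀ s ∈ W1, B (cell ϖ 0 w l * s₁ * s) = 0)
    (A : GL (Fin 2) F) (u : Fˣ) {σ : GSp4 F} (hσ : σ ∈ W1) : B (levi A * simil u * σ) = 0 := by
  obtain ⟨m, p, q, r, s, x, y, hn, hp, hq, hr, hs, hdet, e⟩ :=
    exists_levi_decomposition hB.adm hB.unif A
  obtain ⟨l, t, ht, eu⟩ := exists_eq_unit_mul_zpow hB.unif u.ne_zero
  have hdet' : (ϖ : F) ^ m * p * s - (ϖ : F) ^ m * q * r ≠ 0 := by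
    have : (ϖ : F) ^ m * p * s - (ϖ : F) ^ m * q * r = ϖ ^ m * (p * s - q * r) := by ring
    rw [this]
    exact mul_ne_zero (pow_ne_zero _ ϖ.ne_zero) hdet.ne_zero
  have eA : A = torusUnit a b c (linUnit hn) * gl2 (ϖ ^ m * p) (ϖ ^ m * q) r s hdet' := by
    apply Units.ext
    rw [e, Units.val_mul, torusUnit_linUnit, coe_gl2]
  rw [hB.simil_unit_mul ht (ϖ ^ l) u (by simpa using eu) A hσ, eA, levi_mul, mul_assoc, mul_assoc,
    hB.tor, ← mul_assoc]
  refine mul_eq_zero_of_right _ ?_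
  have el : l = l - m + m := by ring
  -- the standard representatives
  have k1 : B (levi (gl2 ((ϖ : F) ^ m) 0 0 1 (by simp)) * simil (ϖ ^ l) * σ) = 0 := by
    have := h1 (l - m) m σ hσ
    rwa [hElt_eq_levi, ← el] at this
  rcases Nat.eq_zero_or_pos m with rfl | hm
  · by_cases hqP : InP q
    · have hps : IsIntUnit (p * s) := by
        have := hdet.add_inP (hqP.mul_right hr)
        rwa [sub_add_cancel] at this
      rw [← k1]
      refine hB.levi_right (IsIntUnit.of_mul hp hs hps) hqP hr
        (IsIntUnit.of_mul hs hp (by rwa [mul_comm])) ?_ _ hσ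
      simp [coe_gl2]
    · have hqu := isIntUnit_of_not_inP hq hqP
      have hq0 := hqu.ne_zero
      have hw : s / q ∈ 𝒪[F] := by
        rw [div_eq_mul_inv]
        exact mul_mem hs hqu.inv_int
      have := h3 _ hw l σ hσ
      rw [hB.cell_zero_s₁_eq_levi l _ hσ] at this
      rw [← this]
      refine hB.levi_right (p := (p * s - q * r) / q) (r := 0) (t := -p) (v := -q)
        (hdet.div hqu) InP.zero (neg_mem hp) hqu.neg ?_ _ hσ
      simp only [coe_gl2, Matrix.mul_fin_two]
      ext i j
      fin_cases i <;> fin_cases j <;> simp <;> field_simp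
      ring
  · by_cases hsP : InP s
    · have hqr : IsIntUnit (-(q * r)) := by
        have := hdet.add_inP (InP.mul_left hp hsP).neg
        rwa [sub_eq_add_neg, add_assoc, add_comm, add_assoc, neg_add_cancel, add_zero] at this
      have hqr' : IsIntUnit (q * r) := by simpa using hqr.neg
      have := h2 (l - m) m hm σ hσ
      rw [← cell_zero, hB.cell_s₁_eq_levi _ _ _ hσ, ← el] at this
      rw [← this]
      refine hB.levi_right (p := -r) (r := -s) (t := -p) (v := -q)
        (IsIntUnit.of_mul hr hq (by rwa [mul_comm])).neg hsP.neg (neg_mem hp)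
        (IsIntUnit.of_mul hq hr hqr').neg ?_ _ hσ
      simp only [coe_gl2, Matrix.mul_fin_two]
      ext i j
      fin_cases i <;> fin_cases j <;> simp
    · have hsu := isIntUnit_of_not_inP hs hsP
      have hs0 := hsu.ne_zero
      have hw : q / s ∈ 𝒪[F] := by
        rw [div_eq_mul_inv]
        exact mul_mem hq hsu.inv_int
      obtain ⟨z, -, hz⟩ := hB.exists_upperLevi hm hw
      have := hz (ϖ ^ l) σ hσ
      rw [k1, mul_zero] at this
      rw [this]
      refine hB.levi_right (p := (p * s - q * r) / s) (r := 0) (t := r) (v := s)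
        (hdet.div hsu) InP.zero hr hsu ?_ _ hσ
      simp only [coe_gl2, Matrix.mul_fin_two]
      ext i j
      fin_cases i <;> fin_cases j <;> simp <;> field_simp
      ring

/-- The standard representatives meet all double cosets. -/
theorem eq_zero_of_values (h1 : ∀ (l : ℤ) (m : ℕ), ∀ s ∈ W1, B (hElt ϖ l m * s) = 0)
    (h2 : ∀ (l : ℤ) (m : ℕ), 0 < m → ∀ s ∈ W1, B (hElt ϖ l m * s₁ * s) = 0)
    (h3 : ∀ w ∈ 𝒪[F], ∀ l : ℤ, ∀ s ∈ W1, B (cell ϖ 0 w l * s₁ * s) = 0) : B = 0 := by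
  funext g
  obtain ⟨x, y, z, A, u, s, hs, k, hk, e⟩ := exists_siegel_decomposition g
  rw [← hB.right g hk, e, mul_assoc, hB.unip, hB.levi_eq_zero h1 h2 h3 A u hs, mul_zero]
  rfl

/-- A Bessel function is determined by its value `C` and, if `Λ` is unramified, by its values at
the roots. -/
theorem eq_zero_of_constC (hC : constC ϖ (conductorExp Λ) B = 0)
    (hW : conductorExp Λ = 0 → ∀ w, IsSimpleRoot a b c w → B (Wmat w * s₁) = 0) : B = 0 := by
  have h1 : ∀ (l : ℤ) (m : ℕ), ∀ s ∈ W1, B (hElt ϖ l m * s) = 0 := by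
    intro l m s hs
    obtain ⟨v1, v2, v3, v4⟩ := hB.values_hElt l m
    simp only [hC, mul_zero, ite_self] at v1 v2 v3 v4
    rcases hs with rfl | rfl | rfl | rfl
    · rwa [mul_one]
    · exact v2
    · rwa [← mul_assoc]
    · rwa [← mul_assoc, ← mul_assoc]
  refine hB.eq_zero_of_values h1 ?_ ?_
  · intro l m hm s hs
    obtain ⟨v1, v2, v3, v4⟩ := hB.values_hElt_s₁ l m hm
    simp only [hC, mul_zero, ite_self] at v1 v2 v3 v4
    rcases hs with rfl | rfl | rfl | rfl
    · rwa [mul_one]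
    · exact v2
    · rwa [← mul_assoc]
    · rwa [← mul_assoc, ← mul_assoc]
  · intro w hw l s hs
    by_cases hP : InP (formValue ϖ a b c 0 w)
    swap
    · obtain ⟨z, -, hz⟩ := hB.exists_char_mul_cell hw hP
      rw [← hz l s hs, h1 l 0 s hs, mul_zero]
    rcases Nat.eq_zero_or_pos (conductorExp Λ) with h0 | h0
    swap
    · exact hB.cell_s₁_mul_eq_zero h0 hw hP l hs
    rw [formValue_zero] at hP
    rw [h0] at hC
    by_cases hsq : IsSquare (disc a b c)
    · obtain ⟨w', hw', hr⟩ := exists_simpleRoot hB.adm hsq hw hP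
      rw [hB.cell_s₁_congr hr 0 l hs]
      obtain ⟨v1, v2, v3, v4⟩ := hB.values_root hw' l
      simp only [hW h0 w' hw', mul_zero, ite_self] at v1 v2 v3 v4
      rcases hs with rfl | rfl | rfl | rfl
      · rwa [mul_one]
      · exact v2
      · rwa [← mul_assoc]
      · rwa [← mul_assoc, ← mul_assoc]
    · have hd : InP (disc a b c) := by
        by_contra hd
        exact hsq (exists_root_of_inP hB.adm.a_int hB.adm.b_int hB.adm.c_unit
          (isIntUnit_of_not_inP hB.adm.disc_int hd) hw hP)
      obtain ⟨hb, -⟩ := hB.adm.eq_unit_mul_of_inP hB.unif hd hP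
      obtain ⟨v1, v2, v3, v4⟩ := hB.values_ramified h0 hw hP hb l
      simp only [hC, mul_zero, ite_self] at v1 v2 v3 v4
      rcases hs with rfl | rfl | rfl | rfl
      · rwa [mul_one]
      · exact v2
      · rwa [← mul_assoc]
      · rwa [← mul_assoc, ← mul_assoc]

end IsBessel

end Exhaustion

/-! ### The dimension, and the proof of the theorem -/

section Dimension

variable {F : Type*} [Field F] [ValuativeRel F] [TopologicalSpace F]
  [IsNonarchimedeanLocalField F] [CharZero F]

theorem rank_le_one_of_eval {α : Type*} (V : Submodule ℂ (α → ℂ)) (g : α)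
    (h : ∀ B ∈ V, B g = 0 → B = 0) : Module.rank ℂ V ≤ 1 := by
  have hf : Function.Injective (LinearMap.proj (R := ℂ) (φ := fun _ : α => ℂ) g ∘ₗ V.subtype) := by
    rw [← LinearMap.ker_eq_bot, LinearMap.ker_eq_bot']
    intro B hB
    exact Subtype.ext (h B B.2 hB)
  have := LinearMap.lift_rank_le_of_injective _ hf
  simpa using this

/-- A point at which no nonzero Bessel function vanishes. -/
theorem exists_eval_injective {ϖ : Fˣ} {a b c : F} {ψ : AddChar F Circle}
    {Λ : (L a b c)ˣ →* ℂˣ} {ω q : ℂ}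
    (H : ∀ B ∈ besselSpace ϖ a b c ψ Λ ω, IsBessel ϖ a b c ψ Λ ω q B) :
    ∃ g, ∀ B ∈ besselSpace ϖ a b c ψ Λ ω, B g = 0 → B = 0 := by
  have adm : IsAdmissible a b c := (H 0 (zero_mem _)).adm
  have hω : ω ≠ 0 := by
    rintro h
    have := (H 0 (zero_mem _)).sq
    rw [h] at this
    simp at this
  by_cases hexc : ∃ δ, ∃ hδ : δ ^ 2 = disc a b c,
      conductorExp Λ = 0 ∧ ω * (Λ (splitUnit hδ adm.disc_ne 1 ϖ) : ℂ) = -1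
  · obtain ⟨δ, hδ, h0, hr⟩ := hexc
    refine ⟨Wmat ((-b + δ) / (2 * c)) * s₁, fun B hB hg => ?_⟩
    have hB' := H B hB
    refine hB'.eq_zero_of_constC (by rw [h0]; exact hB'.constC_eq_zero_of_split h0 hδ _ hr) ?_
    intro _ w hw
    rcases hw.eq_or adm hδ with rfl | rfl
    · exact hg
    · have := hB'.Wmat_s₁_of_split hδ adm.disc_ne
      rw [hg, hr] at this
      simpa using this
  · push Not at hexc
    have hpt : ∃ g, ∀ B : GSp4 F → ℂ, constC ϖ (conductorExp Λ) B = B g := by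
      simp only [constC]
      split_ifs
      exacts [⟨_, fun _ => rfl⟩, ⟨_, fun _ => rfl⟩]
    obtain ⟨g, hg⟩ := hpt
    refine ⟨g, fun B hB hgB => ?_⟩
    have hB' := H B hB
    have hC : constC ϖ (conductorExp Λ) B = 0 := by rw [hg, hgB]
    refine hB'.eq_zero_of_constC hC fun h0 w hw => ?_
    rw [h0] at hC
    have hδ : (b + 2 * c * w) ^ 2 = disc a b c := by
      rw [disc]
      linear_combination 4 * c * hw.1
    have hm := hB'.Wmat_s₁_eq_of_split h0 hδ adm.disc_ne (hexc _ hδ h0)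
    rw [hC, mul_zero] at hm
    have hp := hB'.Wmat_s₁_of_split hδ adm.disc_ne
    rw [hm, mul_zero] at hp
    rcases hw.eq_or adm hδ with h | h
    · rw [h]
      exact hp.symm
    · rw [h]
      exact hm

end Dimension

end SteinbergBessel

theorem proposition3p3 {F : Type*} [Field F] [ValuativeRel F] [TopologicalSpace F]
    [IsNonarchimedeanLocalField F] [CharZero F]
    (ϖ : Fˣ) (hϖ : IsUniformizer ϖ)
    (a b c : F) (hd : disc a b c ≠ 0) (ha : a ∈ 𝒪[F]) (hb : b ∈ 𝒪[F]) (hc : IsIntUnit c)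
    (hfield : ¬ IsSquare (disc a b c) → discriminant a b c = Submodule.span 𝒪[F] {disc a b c})
    (hsplit : IsSquare (disc a b c) → IsIntUnit (disc a b c))
    (ψ : AddChar F Circle) (hψ : HasConductorO ψ)
    (Ω : Fˣ →* ℂˣ) (hΩ : ∀ x : Fˣ, IsIntUnit (x : F) → Ω x = 1) (hΩ2 : ∀ x : Fˣ, Ω x ^ 2 = 1)
    (ω : ℂ) (hω : ω = -(Ω ϖ : ℂ))
    (Λ : (L a b c)ˣ →* ℂˣ) (hΛ : IsSmoothChar Λ)
    (hΛF : ∀ x : Fˣ, Λ (Units.map (algebraMap F (L a b c) : F →* L a b c) x) = 1)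
    (m₀ : ℕ) (hm₀ : m₀ = conductorExp Λ)
    (q : ℂ) (hq : q = (Nat.card 𝓀[F] : ℂ)) :
    (∀ B ∈ besselSpace ϖ a b c ψ Λ ω,
      -- the values `B(h(l,m)s)`, `s ∈ {1, s₂, s₂s₁, s₂s₁s₂}`
      (∀ (l : ℤ) (m : ℕ),
        B (hElt ϖ l m) =
          (if l ≤ -1 ∨ (m : ℤ) ≤ (m₀ : ℤ) - 2 then 0
            else coefA q ω m₀ l m * constC ϖ m₀ B) ∧
        B (hElt ϖ l m * s₂) =
          (if l ≤ -1 ∨ (m : ℤ) ≤ (m₀ : ℤ) - 2 then 0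
            else -(1 / q) * coefA q ω m₀ l m * constC ϖ m₀ B) ∧
        B (hElt ϖ l m * s₂ * s₁) =
          (if l ≤ -1 ∨ (m : ℤ) ≤ (m₀ : ℤ) - 2 then 0
            else 1 / q ^ 2 * coefA q ω m₀ l m * constC ϖ m₀ B) ∧
        B (hElt ϖ l m * s₂ * s₁ * s₂) =
          (if l ≤ -2 ∨ (m : ℤ) ≤ (m₀ : ℤ) - 2 then 0
            else if l = -1 then ω * coefA q ω m₀ 0 m * constC ϖ m₀ B
            else -(1 / q ^ 3) * coefA q ω m₀ l m * constC ϖ m₀ B)) ∧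
      -- the values `B(h(l,m)s)`, `s ∈ {s₁, s₁s₂, s₁s₂s₁, s₁s₂s₁s₂}`, `m > 0`
      (∀ (l : ℤ) (m : ℕ), 0 < m →
        B (hElt ϖ l m * s₁) =
          (if l ≤ -1 ∨ (m : ℤ) ≤ (m₀ : ℤ) - 1 then 0
            else -q * coefA q ω m₀ l m * constC ϖ m₀ B) ∧
        B (hElt ϖ l m * s₁ * s₂) =
          (if l ≤ -2 ∨ (m : ℤ) ≤ (m₀ : ℤ) - 1 then 0
            else if l = -1 then -ω * q ^ 3 * coefA q ω m₀ 0 m * constC ϖ m₀ B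
            else coefA q ω m₀ l m * constC ϖ m₀ B) ∧
        B (hElt ϖ l m * s₁ * s₂ * s₁) =
          (if l ≤ -2 ∨ (m : ℤ) ≤ (m₀ : ℤ) - 1 then 0
            else if l = -1 then ω * q ^ 2 * coefA q ω m₀ 0 m * constC ϖ m₀ B
            else -(1 / q) * coefA q ω m₀ l m * constC ϖ m₀ B) ∧
        B (hElt ϖ l m * s₁ * s₂ * s₁ * s₂) =
          (if l ≤ -2 ∨ (m : ℤ) ≤ (m₀ : ℤ) - 1 then 0
            else if l = -1 then -ω * q * coefA q ω m₀ 0 m * constC ϖ m₀ B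
            else 1 / q ^ 2 * coefA q ω m₀ l m * constC ϖ m₀ B)) ∧
      -- the remaining values for `m₀ ≥ 1`
      (1 ≤ m₀ →
        (legendre a b c = 0 → ∀ w₀ ∈ 𝒪[F], AlphaAddNonunit a b c w₀ →
          ∀ s ∈ W1, ∀ l : ℤ, B (hElt ϖ l 0 * Wmat w₀ * s₁ * s) = 0) ∧
        (legendre a b c = 1 → ∀ δ : F, δ ^ 2 = disc a b c →
          ∀ s ∈ W1, ∀ l : ℤ,
            B (hElt ϖ l 0 * Wmat ((-b + δ) / (2 * c)) * s₁ * s) = 0 ∧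
            B (hElt ϖ l 0 * Wmat ((-b - δ) / (2 * c)) * s₁ * s) = 0)) ∧
      -- the remaining values for `m₀ = 0`
      (m₀ = 0 →
        (legendre a b c = -1 → constC ϖ 0 B = 0) ∧
        (legendre a b c = 0 → ∀ w₀ ∈ 𝒪[F], AlphaAddNonunit a b c w₀ → ∀ l : ℤ,
          B (hElt ϖ l 0 * Wmat w₀ * s₁) =
            (if l ≤ -1 then 0 else -q * coefA q ω 0 l 0 * constC ϖ 0 B) ∧
          B (hElt ϖ l 0 * Wmat w₀ * s₁ * s₂) =
            (if l ≤ -2 then 0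
              else if l = -1 then -ω * q ^ 3 * constC ϖ 0 B
              else coefA q ω 0 l 0 * constC ϖ 0 B) ∧
          B (hElt ϖ l 0 * Wmat w₀ * s₁ * s₂ * s₁) =
            (if l ≤ -2 then 0 else ω * q ^ 2 * coefA q ω 0 (l + 1) 0 * constC ϖ 0 B) ∧
          B (hElt ϖ l 0 * Wmat w₀ * s₁ * s₂ * s₁ * s₂) =
            (if l ≤ -2 then 0 else -ω * q * coefA q ω 0 (l + 1) 0 * constC ϖ 0 B)) ∧
        (legendre a b c = 0 →
          (∀ z : (L a b c)ˣ, Λ z = Ω (Units.map QuadraticAlgebra.norm z)) →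
          constC ϖ 0 B = 0) ∧
        (legendre a b c = 1 → ∀ (δ : F) (hδ : δ ^ 2 = disc a b c),
          -- the transformation between the two roots
          (∀ s ∈ W1, ∀ l : ℤ,
            B (hElt ϖ l 0 * Wmat ((-b - δ) / (2 * c)) * s₁ * s) =
              1 / (ω * (Λ (splitUnit hδ hd 1 ϖ) : ℂ)) *
                B (hElt ϖ l 0 * Wmat ((-b + δ) / (2 * c)) * s₁ * s)) ∧
          -- the case `ω Λ((1, ϖ)) = -1`
          (ω * (Λ (splitUnit hδ hd 1 ϖ) : ℂ) = -1 →
            constC ϖ 0 B = 0 ∧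
            ∀ l : ℤ,
              B (hElt ϖ l 0 * Wmat ((-b + δ) / (2 * c)) * s₁) =
                (if l ≤ -1 then 0
                  else coefA q ω 0 l 0 * B (Wmat ((-b + δ) / (2 * c)) * s₁)) ∧
              B (hElt ϖ l 0 * Wmat ((-b + δ) / (2 * c)) * s₁ * s₂) =
                (if l ≤ -1 then 0
                  else -(1 / q) * coefA q ω 0 l 0 * B (Wmat ((-b + δ) / (2 * c)) * s₁)) ∧
              B (hElt ϖ l 0 * Wmat ((-b + δ) / (2 * c)) * s₁ * s₂ * s₁) =
                (if l ≤ -2 then 0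
                  else -ω * q * coefA q ω 0 (l + 1) 0 * B (Wmat ((-b + δ) / (2 * c)) * s₁)) ∧
              B (hElt ϖ l 0 * Wmat ((-b + δ) / (2 * c)) * s₁ * s₂ * s₁ * s₂) =
                (if l ≤ -2 then 0
                  else ω * coefA q ω 0 (l + 1) 0 * B (Wmat ((-b + δ) / (2 * c)) * s₁))) ∧
          -- the case `ω Λ((1, ϖ)) ≠ -1`
          (ω * (Λ (splitUnit hδ hd 1 ϖ) : ℂ) ≠ -1 →
            ∀ l : ℤ,
              B (hElt ϖ l 0 * Wmat ((-b - δ) / (2 * c)) * s₁) =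
                (if l ≤ -1 then 0
                  else -((q - 1) / (1 + ω * (Λ (splitUnit hδ hd 1 ϖ) : ℂ))) *
                    coefA q ω 0 l 0 * constC ϖ 0 B) ∧
              B (hElt ϖ l 0 * Wmat ((-b - δ) / (2 * c)) * s₁ * s₂) =
                (if l ≤ -1 then 0
                  else (q - 1) / (q * (1 + ω * (Λ (splitUnit hδ hd 1 ϖ) : ℂ))) *
                    coefA q ω 0 l 0 * constC ϖ 0 B) ∧
              B (hElt ϖ l 0 * Wmat ((-b - δ) / (2 * c)) * s₁ * s₂ * s₁) =
                (if l ≤ -2 then 0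
                  else ω * q * (q - 1) / (1 + ω * (Λ (splitUnit hδ hd 1 ϖ) : ℂ)) *
                    coefA q ω 0 (l + 1) 0 * constC ϖ 0 B) ∧
              B (hElt ϖ l 0 * Wmat ((-b - δ) / (2 * c)) * s₁ * s₂ * s₁ * s₂) =
                (if l ≤ -2 then 0
                  else -(ω * (q - 1) / (1 + ω * (Λ (splitUnit hδ hd 1 ϖ) : ℂ))) *
                    coefA q ω 0 (l + 1) 0 * constC ϖ 0 B))))) ∧
    Module.rank ℂ (besselSpace ϖ a b c ψ Λ ω) ≤ 1 := by
  have adm : IsAdmissible a b c := ⟨ha, hb, hc, hd, hfield, hsplit⟩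
  have hω2 : ω * ω = 1 := by
    have := congrArg Units.val (hΩ2 ϖ)
    rw [Units.val_pow_eq_pow_val, Units.val_one] at this
    rw [hω]
    linear_combination this
  have H : ∀ B ∈ besselSpace ϖ a b c ψ Λ ω, IsBessel ϖ a b c ψ Λ ω q B :=
    fun B hB => ⟨adm, hϖ, hψ, hω2, hq, hΛF, hΛ, hB⟩
  refine ⟨fun B hBmem => ?_, ?_⟩
  · have hB := H B hBmem
    subst hm₀
    refine ⟨hB.values_hElt, hB.values_hElt_s₁, fun h0 => ⟨?_, ?_⟩, fun h0 => ⟨?_, ?_, ?_, ?_⟩⟩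
    · intro _ w hw hα s hs l
      exact hB.cell_s₁_mul_eq_zero h0 hw (by rw [formValue_zero]; exact hα.inP adm hw) l hs
    · intro _ δ hδ s hs l
      have hp := (isSimpleRoot_add adm hδ).1
      have hm := (isSimpleRoot_sub adm hδ).1
      constructor
      · exact hB.cell_s₁_mul_eq_zero h0 (int_of_root adm hp)
          (by rw [formValue_zero, hp]; exact InP.zero) l hs
      · exact hB.cell_s₁_mul_eq_zero h0 (int_of_root adm hm)
          (by rw [formValue_zero, hm]; exact InP.zero) l hs
    · intro hL
      rw [constC_zero_eq]
      exact hB.hElt_eq_zero_of_no_root h0 (fun w hw => not_inP_of_legendre adm hL hw) 0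
    · intro hL w hw hα l
      have hP := hα.inP adm hw
      exact hB.values_ramified h0 hw hP
        (adm.eq_unit_mul_of_inP hϖ (inP_disc_of_legendre hL) hP).1 l
    · intro hL hΛΩ
      rw [constC_zero_eq]
      exact hB.eq_zero_of_ramified h0 (inP_disc_of_legendre hL) hΩ hω hΛΩ
    · intro _ δ hδ
      refine ⟨fun s hs l => hB.cell_s₁_of_split hδ hd l hs, fun hr => ⟨?_, ?_⟩, fun hr l => ?_⟩
      · exact hB.constC_eq_zero_of_split h0 hδ hd hr
      · exact hB.values_root (isSimpleRoot_add adm hδ)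
      · obtain ⟨v1, v2, v3, v4⟩ := hB.values_root (isSimpleRoot_sub adm hδ) l
        rw [hB.Wmat_s₁_eq_of_split h0 hδ hd hr] at v1 v2 v3 v4
        have hq0 := hB.q_ne_zero
        have hr0 : 1 + ω * (Λ (splitUnit hδ hd 1 ϖ) : ℂ) ≠ 0 := by
          intro h
          apply hr
          linear_combination h
        refine ⟨v1.trans ?_, v2.trans ?_, v3.trans ?_, v4.trans ?_⟩ <;> congr 1 <;> field_simp
  · obtain ⟨g, hg⟩ := exists_eval_injective H
    exact rank_le_one_of_eval _ g hg
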